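/- Let $X$ be a compact complex manifold with $\dim_{\mathbb C}X=n$, and let $\omega$ be an SKT metric on $X$, i.e. a $C^\infty$ positive definite $(1,1)$-form such that $\partial\bar\partial\omega=0$. Let $\langle\langle\cdot,\cdot\rangle\rangle$ be the $L^2$ inner product induced by $\omega$ on smooth complex-valued differential forms (of any, possibly mixed, degree) on $X$, let $\|\cdot\|$ be its norm, let $^\star$ denote formal adjoints with respect to it, and let $[A,B]=AB-(-1)^{ab}BA$ be the graded commutator of operators $A,B$ of degrees $a,b$. For operators $A,B$ on smooth forms, $A\ge B$ means $\langle\langle Au,u\rangle\rangle\ge\langle\langle Bu,u\rangle\rangle$ for all smooth forms $u$. Put $$d_h=h\,\partial+\bar\partial,\qquad \Delta_h=d_hd_h^\star+d_h^\star d_h\quad(h>0),\qquad \Delta=dd^\star+d^\star d,\qquad \overline X_\omega=[\bar\partial\omega\wedge\cdot,\,(\bar\partial\omega\wedge\cdot)^\star],$$ let $\Lambda_\omega=(\omega\wedge\cdot)^\star$, let $\tau=[\Lambda_\omega,\,\partial\omega\wedge\cdot]$ be the torsion operator, and let $\bar\tau$ be its complex conjugate, $\bar\tau u=\overline{\tau\bar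 u}$. Then the operator $[\bar\tau,\bar\tau^\star]$ is bounded (there is $C'\ge0$ with $\|[\bar\tau,\bar\tau^\star]u\|\le C'\|u\|$ for all smooth forms $u$), there is a constant $C\ge 0$ with $[\bar\tau,\bar\tau^\star]\le C$, and for every real constant $C$ with $[\bar\tau,\bar\tau^\star]\le C$ one has $$\Delta_h-h^2\Delta\;\ge\;h^2\Big((1-h)\,\overline X_\omega-[\bar\tau,\bar\tau^\star]\Big)\;\ge\;-C\,h^2\qquad\text{for all }0<h<1 .$$ -/

import Mathlib

open scoped Manifold ContDiff

noncomputable section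

namespace HermitianForms

/-! ### Complex-valued differential forms on a complex manifold

The model space is `ℂⁿ`. The tangent space at a point `x` of a manifold `X` modelled on `ℂⁿ` is,
by Mathlib's convention for `TangentSpace`, a copy of `ℂⁿ`, through the preferred chart at `x`.
As the charts of `X` are holomorphic, the complex structure of the tangent space is the
multiplication by `I`. -/

/-- The model space `ℂⁿ`. -/
abbrev Cn (n : ℕ) : Type := EuclideanSpace ℂ (Fin n)

/-- Complex-valued alternating real `k`-linear forms on the tangent space `ℂⁿ`. -/
abbrev Alt (n k : ℕ) : Type := Cn n [⋀^Fin k]→L[ℝ] ℂ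

/-- Complex-valued `k`-forms on `X`, of any regularity. -/
abbrev KForm (n : ℕ) (X : Type*) (k : ℕ) : Type _ := X → Alt n k

/-- Complex-valued differential forms on `X` (of any regularity), not necessarily of pure degree:
`u k` is the component of degree `k` of `u`. For `k > 2n` this component is automatically zero. -/
abbrev Form (n : ℕ) (X : Type*) : Type _ := (k : ℕ) → KForm n X k

/-- Operators acting on forms. -/
abbrev Op (n : ℕ) (X : Type*) : Type _ := Form n X → Form n X

/-- The operator of multiplication by `I` on `ℂⁿ` (the complex structure `J`). -/
def mulI (n : ℕ) : Cn n →L[ℝ] Cn n := Complex.I • ContinuousLinearMap.id ℝ (Cn n)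

/-! ### Exterior product -/

/-- The real multilinear map `v ↦ α (v₁, …, v_p) * β (v_{p+1}, …, v_{p+q})`. -/
def prodForm {n p q m : ℕ} (h : p + q = m) (α : Alt n p) (β : Alt n q) :
    ContinuousMultilinearMap ℝ (fun _ : Fin m => Cn n) ℂ where
  toMultilinearMap :=
    ((LinearMap.mul' ℝ ℂ).compMultilinearMap
      (α.toMultilinearMap.domCoprod β.toMultilinearMap)).domDomCongr
        (finSumFinEquiv.trans (finCongr h))
  cont := by
    simp only [MultilinearMap.domDomCongr, LinearMap.compMultilinearMap,
      MultilinearMap.domCoprod]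
    exact (α.cont.comp (by fun_prop)).mul (β.cont.comp (by fun_prop))

/-- The exterior product: `(α ∧ β)(v) = 1/(p! q!) ∑_σ sgn(σ) α(v_{σ(1)}, …) β(…, v_{σ(p+q)})`. -/
def wedge {n p q m : ℕ} (h : p + q = m) (α : Alt n p) (β : Alt n q) : Alt n m :=
  ((p.factorial * q.factorial : ℝ)⁻¹) • (prodForm h α β).alternatization

/-- The operator `η ∧ ·` of left exterior multiplication by a `p`-form. -/
def extMul {n : ℕ} {X : Type*} {p : ℕ} (η : KForm n X p) : Op n X := fun u m x =>
  if h : p ≤ m then wedge (Nat.add_sub_of_le h) (η x) (u (m - p) x) else 0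

/-! ### Complex conjugation -/

/-- Complex conjugation of forms. -/
def conjForm {n : ℕ} {X : Type*} (u : Form n X) : Form n X := fun k x =>
  (Complex.conjCLE : ℂ →L[ℝ] ℂ).compContinuousAlternatingMap (u k x)

/-- The complex conjugate `u ↦ conj (T (conj u))` of the operator `T`. -/
def conjOp {n : ℕ} {X : Type*} (T : Op n X) : Op n X := fun u => conjForm (T (conjForm u))

/-- The graded commutator `[A, B] = AB - (-1)^{ab} BA` of operators of degrees `a` and `b`. -/
def gradedComm {n : ℕ} {X : Type*} (a b : ℤ) (A B : Op n X) : Op n X :=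
  A ∘ B - (-1 : ℂ) ^ (a * b) • (B ∘ A)

section Manifold

variable {n : ℕ} {X : Type*} [TopologicalSpace X] [ChartedSpace (Cn n) X]

/-! ### Smoothness and the operators `∂` and `∂̄` -/

/-- The expression of a form in a chart `e`: the pullback by `e.symm`. -/
def inChart {k : ℕ} (α : KForm n X k) (e : OpenPartialHomeomorph X (Cn n)) :
    Cn n → Alt n k := fun y =>
  (α (e.symm y)).compContinuousLinearMap (mfderiv 𝓘(ℝ, Cn n) 𝓘(ℝ, Cn n) e.symm y)

/-- A `k`-form is smooth if it is `C^∞` (in the real sense) in all charts. -/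
def KForm.IsSmooth {k : ℕ} (α : KForm n X k) : Prop :=
  ∀ e ∈ atlas (Cn n) X, ContDiffOn ℝ ∞ (inChart α e) e.target

/-- A form is smooth if all its homogeneous components are. -/
def Form.IsSmooth (u : Form n X) : Prop := ∀ k, KForm.IsSmooth (u k)

/-- The `ℂ`-linear part `v ↦ (D v - I D (I v)) / 2` of a real linear map `D`. If `D` is the
differential of a function, this is `∑ⱼ (∂/∂zⱼ) dzⱼ`. -/
def linPart {k : ℕ} (D : Cn n →L[ℝ] Alt n k) : Cn n →L[ℝ] Alt n k :=
  (1 / 2 : ℂ) • (D - Complex.I • D ∘L mulI n)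

/-- The `ℂ`-antilinear part `v ↦ (D v + I D (I v)) / 2` of a real linear map `D`. If `D` is the
differential of a function, this is `∑ⱼ (∂/∂z̄ⱼ) dz̄ⱼ`. -/
def antiPart {k : ℕ} (D : Cn n →L[ℝ] Alt n k) : Cn n →L[ℝ] Alt n k :=
  (1 / 2 : ℂ) • (D + Complex.I • D ∘L mulI n)

/-- The operator `∂` on `k`-forms. In holomorphic coordinates, `∂u = ∑ⱼ dzⱼ ∧ ∂u/∂zⱼ`, the
derivatives being those of the coefficients of `u`. At the point `x` this is computed in the
preferred chart at `x`, which is also the chart that identifies the tangent space at `x` to `ℂⁿ`. -/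
def del {k : ℕ} (α : KForm n X k) : KForm n X (k + 1) := fun x =>
  ContinuousAlternatingMap.alternatizeUncurryFin
    (linPart (fderiv ℝ (inChart α (chartAt (Cn n) x)) (chartAt (Cn n) x x)))

/-- The operator `∂̄` on `k`-forms. In holomorphic coordinates, `∂̄u = ∑ⱼ dz̄ⱼ ∧ ∂u/∂z̄ⱼ`. -/
def delbar {k : ℕ} (α : KForm n X k) : KForm n X (k + 1) := fun x =>
  ContinuousAlternatingMap.alternatizeUncurryFin
    (antiPart (fderiv ℝ (inChart α (chartAt (Cn n) x)) (chartAt (Cn n) x x)))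

/-- The operator `∂` on forms. -/
def delOp : Op n X := fun u k =>
  match k with
  | 0 => 0
  | j + 1 => del (u j)

/-- The operator `∂̄` on forms. -/
def delbarOp : Op n X := fun u k =>
  match k with
  | 0 => 0
  | j + 1 => delbar (u j)

/-- The rescaled differential `d_h = h ∂ + ∂̄`. For `h = 1` this is `d = ∂ + ∂̄`. -/
def dOp (h : ℝ) : Op n X := (h : ℂ) • delOp + delbarOp

end Manifold

/-! ### Hermitian metrics -/

/-- A Hermitian metric on `X`, given by its fundamental form `ω`, a smooth positive definite
`(1,1)`-form. (A real `2`-form is of type `(1,1)` if and only if it is invariant under the complex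
structure.) -/
structure HermitianMetric (n : ℕ) (X : Type*) [TopologicalSpace X] [ChartedSpace (Cn n) X] where
  /-- the fundamental form -/
  form : KForm n X 2
  smooth : KForm.IsSmooth form
  real : ∀ x v w, (form x ![v, w]).im = 0
  type_one_one : ∀ x v w, form x ![mulI n v, mulI n w] = form x ![v, w]
  pos : ∀ x v, v ≠ 0 → 0 < (form x ![v, mulI n v]).re

/-- The real basis `(e_j, I e_j)` of `ℂⁿ`. -/
def realBasis (n : ℕ) : Fin n ⊕ Fin n → Cn n :=
  Sum.elim (fun j => EuclideanSpace.single j 1) (fun j => EuclideanSpace.single j Complex.I)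

/-- The Gram matrix, in the basis `(e_j, I e_j)`, of the real bilinear form
`(v, w) ↦ η(v, I w)` attached to a `2`-form `η` on `ℂⁿ`. -/
def gram {n : ℕ} (η : Alt n 2) : Matrix (Fin n ⊕ Fin n) (Fin n ⊕ Fin n) ℝ :=
  Matrix.of fun a b => (η ![realBasis n a, mulI n (realBasis n b)]).re

namespace HermitianMetric

variable {n : ℕ} {X : Type*} [TopologicalSpace X] [ChartedSpace (Cn n) X]
  (g : HermitianMetric n X)

/-- The metric is SKT if `∂∂̄ω = 0`. -/
def IsSKT : Prop := del (delbar g.form) = 0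

/-- The pointwise Hermitian inner product of `k`-forms induced by the metric, linear in the first
variable: `⟨α, β⟩ = (1/k!) ∑ g^{a₁b₁} ⋯ g^{a_k b_k} α_{a₁…a_k} conj β_{b₁…b_k}` in terms of the
components in the real basis `(e_j, I e_j)`, where `(g^{ab})` is the inverse of the matrix of the
Riemannian metric `(v, w) ↦ ω(v, I w)`. -/
def fiberInner (x : X) {k : ℕ} (α β : Alt n k) : ℂ :=
  ((k.factorial : ℂ)⁻¹) * ∑ a : Fin k → Fin n ⊕ Fin n, ∑ b : Fin k → Fin n ⊕ Fin n,
    ((∏ s, (gram (g.form x))⁻¹ (a s) (b s) : ℝ) : ℂ) *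
      (α (realBasis n ∘ a) * (starRingEnd ℂ) (β (realBasis n ∘ b)))

variable [MeasurableSpace X]

/-- The Riemannian volume measure `√(det g) dx` in the chart `e`, as a measure on `X` carried by
`e.source`. -/
def chartVolume (e : OpenPartialHomeomorph X (Cn n)) : MeasureTheory.Measure X :=
  ((MeasureTheory.volume.restrict e.target).withDensity
    (fun y => ENNReal.ofReal (Real.sqrt (gram (inChart g.form e y)).det))).map e.symm

/-- The Riemannian volume measure `dV_ω = ωⁿ / n!` of the metric. The measures `g.chartVolume e`
agree on the overlaps of the charts; the supremum is the measure that they define by gluing. -/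
def vol : MeasureTheory.Measure X := ⨆ e ∈ atlas (Cn n) X, g.chartVolume e

/-- The `L²` inner product `⟪⟪u, v⟫⟫ = ∫_X ⟨u, v⟩ dV_ω`; forms of different degrees are orthogonal. -/
def l2Inner (u v : Form n X) : ℂ :=
  ∑ k ∈ Finset.range (2 * n + 1), ∫ x, g.fiberInner x (u k x) (v k x) ∂g.vol

/-- The `L²` norm. -/
def l2Norm (u : Form n X) : ℝ := Real.sqrt (g.l2Inner u u).re

open Classical in
/-- The formal adjoint `T*` of an operator `T` with respect to the `L²` inner product: `T* v` is
the (unique) smooth form `w` such that `⟪⟪T u, v⟫⟫ = ⟪⟪u, w⟫⟫` for all smooth forms `u`. -/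
def adj (T : Op n X) : Op n X := fun v =>
  if h : ∃ w : Form n X, Form.IsSmooth w ∧
      ∀ u : Form n X, Form.IsSmooth u → g.l2Inner (T u) v = g.l2Inner u w
  then h.choose else 0

open ComplexOrder in
/-- The order of operators: `A ≤ B` if `⟪⟪A u, u⟫⟫ ≤ ⟪⟪B u, u⟫⟫` for all smooth forms `u`. By the
convention for the order of `ℂ`, this inequality includes that the difference is real. -/
def OpLE (A B : Op n X) : Prop :=
  ∀ u : Form n X, Form.IsSmooth u → g.l2Inner (A u) u ≤ g.l2Inner (B u) u

/-- The rescaled Laplacian `Δ_h = d_h d_h* + d_h* d_h`. For `h = 1` this is the Laplacian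
`Δ = d d* + d* d`. -/
def laplacian (h : ℝ) : Op n X := gradedComm 1 (-1) (dOp h) (g.adj (dOp h))

/-- The operator `Λ`, the adjoint of the multiplication by `ω`. -/
def Lam : Op n X := g.adj (extMul g.form)

/-- The torsion operator `τ = [Λ, ∂ω ∧ ·]`. -/
def torsion : Op n X := gradedComm (-2) 3 g.Lam (extMul (del g.form))

/-- The operator `[τ̄, τ̄*]`. -/
def torsionLaplacian : Op n X :=
  gradedComm 1 (-1) (conjOp g.torsion) (g.adj (conjOp g.torsion))

/-- The operator `X̄_ω = [∂̄ω ∧ ·, (∂̄ω ∧ ·)*]`. -/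
def Xbar : Op n X :=
  gradedComm 3 (-3) (extMul (delbar g.form)) (g.adj (extMul (delbar g.form)))

end HermitianMetric

end HermitianForms

end

/-!
The comparison is a sum of squares, once the Bochner–Kodaira–Nakano identity is available for an
SKT metric. Write `L = ω ∧ ·`, `Λ = L*`, `N = ∂̄ω ∧ ·`, `τ̄ = [Λ, N]`.

*From the identity to the theorem.* The identity reads `[∂̄ + τ̄, (∂̄ + τ̄)*] = [∂, ∂*] + [N, N*]`
(`laplacian_identity`). It implies, by expanding the commutators (`laplacian_comparison`), that
`Δ_h - h²Δ - h²((1 - h)[N, N*] - [τ̄, τ̄*]) = (1 - h) Δ_h + h [B, B*]`, where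
`B = (1 - h)∂̄ - hτ̄`. An operator of the form `[T, T*]` is nonnegative, so this gives the first
inequality; the second one follows from `[N, N*] ≥ 0`. The operator `τ̄` has order zero, hence it
is bounded on a compact manifold, by a bound for exterior multiplications that is uniform near
each point (`exists_extOp_bound`), and so are its adjoint and `[τ̄, τ̄*]`.

*The identity.* It is formal (`bochner_kodaira_nakano`): it is deduced, with commutators with `Λ`,
from `[∂, ∂̄] = 0` and `[∂, N] = 0`, the latter being the SKT condition `∂∂̄ω = 0`. The other
ingredients are the commutation relations of Hermitian geometry
`∂̄* = -i[Λ, ∂] - τ̄*`, `∂* = i[Λ, ∂̄] - τ*`, `[Λ, τ̄] = 2iτ*` and `[L, τ̄] = 3N`.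
The last two are pointwise, between operators of order zero. They are proved in the algebra of
operators on the exterior algebra of one tangent space: the exterior multiplications `ε_a` by the
real coordinate covectors and their adjoints satisfy `ε_a* ε_b + ε_b ε_a* = g^{ab}` (`CARData`),
all operators involved are polynomials in these, and `∂̄ω` is a sum over `a` of the `(0,1)` part
of `ε_a` times `∂_a ω`, so that one direction can be treated at a time (`JetOps`). No normal
coordinates are needed, only that `ω` and its first derivatives are real of type `(1,1)`.

*The adjoint of `∂̄`.* That `-i[Λ, ∂] - τ̄*` is adjoint to `∂̄` is an integration by parts
(`isL2Adj_delbar`). In a chart, the difference of the two integrands is the divergence of the vector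
field with components `√det g · ⟪ε_a'' u, v⟫`, where `ε_a''` is the `(0,1)` part of `ε_a`
(`divergence_identity`); the derivatives of the metric that appear are expressed through the
derivatives of `ω`, by differentiating the relation between the inner product and `Λ`. A partition
of unity reduces the global statement to forms with support in a chart. Conjugation gives the
adjoint of `∂`.

*Formal adjoints.* The computations take place in the ring of endomorphisms of the space of smooth
forms, where adjoints are given by explicit formulas. The `L²` product is definite on smooth forms,
so an adjoint is unique when it exists, and the operators of the statement restrict to these
endomorphisms (`Restricts.adj`).
-/

noncomputable section

namespace HermitianForms

open ContinuousAlternatingMap (alternatizeUncurryFin alternatizeUncurryFinCLM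
  alternatizeUncurryFin_add alternatizeUncurryFin_smul alternatizeUncurryFin_apply
  alternatizeUncurryFin_curryLeft alternatizeUncurryFinCLM_apply curryLeft_same curryLeft_add)

variable {n : ℕ}

/-- The index set of the real basis `(e_j, I e_j)` of `ℂⁿ`. -/
abbrev Idx (n : ℕ) : Type := Fin n ⊕ Fin n

/-- The real coordinates on `ℂⁿ`, dual to `realBasis`. -/
def coord (a : Idx n) : Cn n →L[ℝ] ℝ :=
  Sum.elim (fun j => Complex.reCLM ∘L (EuclideanSpace.proj (𝕜 := ℂ) j).restrictScalars ℝ)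
    (fun j => Complex.imCLM ∘L (EuclideanSpace.proj (𝕜 := ℂ) j).restrictScalars ℝ) a

@[simp] lemma coord_inl (j : Fin n) (v : Cn n) : coord (Sum.inl j) v = (v j).re := rfl

@[simp] lemma coord_inr (j : Fin n) (v : Cn n) : coord (Sum.inr j) v = (v j).im := rfl

lemma coord_realBasis (a b : Idx n) : coord a (realBasis n b) = if a = b then 1 else 0 := by
  rcases a with i | i <;> rcases b with j | j <;>
    simp [realBasis] <;> split_ifs <;> simp_all

lemma sum_coord_smul_realBasis (v : Cn n) : ∑ a, coord a v • realBasis n a = v := by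
  ext i
  simp [Fintype.sum_sum_type, realBasis, Pi.single_apply, Complex.re_add_im]

/-- The matrix of the complex structure in the basis `(e_j, I e_j)` is `Matrix.J`. -/
lemma mulI_realBasis (a : Idx n) :
    mulI n (realBasis n a) = ∑ c, Matrix.J (Fin n) ℝ c a • realBasis n c := by
  rcases a with i | i <;> ext j <;>
    simp [mulI, realBasis, Matrix.J, Matrix.one_apply, Matrix.fromBlocks]
  split_ifs <;> simp

/-! ### Exterior multiplication by a covector and contraction -/

/-- The exterior multiplication of `k`-forms by the covector `coord a`. -/
def epsAlt (a : Idx n) {k : ℕ} : Alt n k →ₗ[ℂ] Alt n (k + 1) where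
  toFun u := alternatizeUncurryFin ((coord a).smulRight u)
  map_add' u v := by
    rw [← alternatizeUncurryFin_add]; congr 1; ext w; simp
  map_smul' c u := by
    rw [RingHom.id_apply, ← alternatizeUncurryFin_smul]; congr 1; ext w; simp; ring

lemma epsAlt_apply (a : Idx n) {k : ℕ} (u : Alt n k) (v : Fin (k + 1) → Cn n) :
    epsAlt a u v = ∑ i : Fin (k + 1), (-1) ^ i.val * (coord a (v i) * u (i.removeNth v)) := by
  simp [epsAlt, alternatizeUncurryFin_apply]

/-- The contraction with the basis vector `realBasis n a`. -/
def iotaAlt (a : Idx n) {k : ℕ} : Alt n (k + 1) →ₗ[ℂ] Alt n k where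
  toFun u := u.curryLeft (realBasis n a)
  map_add' u v := by ext; simp
  map_smul' c u := by ext; simp

lemma iotaAlt_apply (a : Idx n) {k : ℕ} (u : Alt n (k + 1)) (v : Fin k → Cn n) :
    iotaAlt a u v = u (Matrix.vecCons (realBasis n a) v) := rfl

lemma continuousLinearMap_eq_sum {F : Type*} [NormedAddCommGroup F] [NormedSpace ℝ F]
    (T : Cn n →L[ℝ] F) : T = ∑ a, (coord a).smulRight (T (realBasis n a)) := by
  ext v
  conv_lhs => rw [← sum_coord_smul_realBasis v]
  simp

/-- A linear map with values in forms is determined by its values on the real basis; its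
antisymmetrization is expanded accordingly. -/
lemma alternatizeUncurryFin_eq_sum {k : ℕ} (T : Cn n →L[ℝ] Alt n k) :
    alternatizeUncurryFin T = ∑ a, epsAlt a (T (realBasis n a)) := by
  conv_lhs => rw [continuousLinearMap_eq_sum T, ← alternatizeUncurryFinCLM_apply, map_sum]
  rfl

lemma sum_epsAlt_iotaAlt {k : ℕ} (u : Alt n (k + 1)) :
    ∑ a, epsAlt a (iotaAlt a u) = ((k : ℂ) + 1) • u := by
  have := alternatizeUncurryFin_curryLeft u
  rw [alternatizeUncurryFin_eq_sum] at this
  refine this.trans ?_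
  rw [← Nat.cast_smul_eq_nsmul ℂ]; push_cast; rfl

lemma alt_ext_iota {k : ℕ} {u v : Alt n (k + 1)} (h : ∀ a, iotaAlt a u = iotaAlt a v) : u = v := by
  have h1 := sum_epsAlt_iotaAlt u
  simp_rw [h] at h1
  rw [sum_epsAlt_iotaAlt v] at h1
  exact (smul_right_injective _ (Nat.cast_add_one_ne_zero k : ((k : ℂ) + 1) ≠ 0) h1).symm

lemma iotaAlt_epsAlt (a b : Idx n) {k : ℕ} (u : Alt n (k + 1)) :
    iotaAlt a (epsAlt b u) = (if b = a then (1 : ℂ) else 0) • u - epsAlt b (iotaAlt a u) := by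
  ext v
  rw [iotaAlt_apply, epsAlt_apply, Fin.sum_univ_succ, ContinuousAlternatingMap.sub_apply,
    epsAlt_apply, sub_eq_add_neg, ← Finset.sum_neg_distrib]
  congr 1
  · simp [coord_realBasis]
    split_ifs
    · simp
    · simp
  · refine Finset.sum_congr rfl fun i _ => ?_
    rw [iotaAlt_apply]
    have : (i.succ.removeNth (Matrix.vecCons (realBasis n a) v) : Fin (k + 1) → Cn n)
        = Matrix.vecCons (realBasis n a) (i.removeNth v) := by
      ext j : 1
      refine Fin.cases ?_ (fun j => ?_) j <;> simp [Fin.removeNth]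
    rw [this]
    simp [pow_succ]

lemma iotaAlt_epsAlt_zero (a b : Idx n) (u : Alt n 0) :
    iotaAlt a (epsAlt b u) = (if b = a then (1 : ℂ) else 0) • u := by
  ext v
  rw [iotaAlt_apply, epsAlt_apply]
  have : Fin.removeNth 0 (Matrix.vecCons (realBasis n a) v) = v := Subsingleton.elim _ _
  rw [Fin.sum_univ_one, this]
  simp [coord_realBasis]
  split_ifs <;> simp

lemma iotaAlt_iotaAlt (a b : Idx n) {k : ℕ} (u : Alt n (k + 2)) :
    iotaAlt a (iotaAlt b u) = - iotaAlt b (iotaAlt a u) := by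
  have h := curryLeft_same u (realBasis n a + realBasis n b)
  have ha := curryLeft_same u (realBasis n a)
  have hb := curryLeft_same u (realBasis n b)
  simp only [map_add, curryLeft_add, _root_.add_apply, ha, hb] at h
  rw [eq_neg_iff_add_eq_zero]
  simpa [iotaAlt, add_comm] using h

lemma epsAlt_epsAlt (a b : Idx n) {k : ℕ} (u : Alt n k) :
    epsAlt a (epsAlt b u) = - epsAlt b (epsAlt a u) := by
  induction k with
  | zero =>
    refine alt_ext_iota fun c => ?_
    simp only [iotaAlt_epsAlt, iotaAlt_epsAlt_zero, map_neg, map_smul]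
    module
  | succ k ih =>
    refine alt_ext_iota fun c => ?_
    simp only [iotaAlt_epsAlt, map_neg, map_smul, map_sub, ih (iotaAlt c u)]
    module

/-! ### The algebra of operators on the fibre -/

/-- The fibre of `Form n X`: forms of mixed degree on `ℂⁿ` with constant coefficients. -/
abbrev Fib (n : ℕ) : Type := (k : ℕ) → Alt n k

/-- Endomorphisms of the fibre. -/
abbrev FibOp (n : ℕ) : Type := Module.End ℂ (Fib n)

-- Shortcuts for instance search; with them all lemmas on rings see the same negation.
instance : Ring (FibOp n) := inferInstance
instance : Neg (FibOp n) := Ring.toNeg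
instance : AddCommGroup (FibOp n) := inferInstance
instance : AddCommMonoid (FibOp n) := inferInstance
instance : Module ℂ (FibOp n) := inferInstance
instance : Algebra ℂ (FibOp n) := inferInstance
instance : SMul ℂ (FibOp n) := Algebra.toSMul
instance : Sub (FibOp n) := Ring.toSub
instance : Add (FibOp n) := Distrib.toAdd
instance : Mul (FibOp n) := Distrib.toMul

/-- Exterior multiplication by the covector `coord a`. -/
def eps (a : Idx n) : FibOp n where
  toFun u k := match k with
    | 0 => 0
    | k + 1 => epsAlt a (u k)
  map_add' u v := by ext1 k; cases k <;> simp
  map_smul' c u := by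
    ext1 k
    cases k
    · exact (smul_zero (A := Alt n 0) c).symm
    · simp

/-- Contraction with the vector `realBasis n a`. -/
def iota (a : Idx n) : FibOp n where
  toFun u k := iotaAlt a (u (k + 1))
  map_add' u v := by ext1 k; simp
  map_smul' c u := by ext1 k; simp

@[simp] lemma eps_apply_zero (a : Idx n) (u : Fib n) : eps a u 0 = 0 := rfl
@[simp] lemma eps_apply_succ (a : Idx n) (u : Fib n) (k : ℕ) :
    eps a u (k + 1) = epsAlt a (u k) := rfl
@[simp] lemma iota_apply (a : Idx n) (u : Fib n) (k : ℕ) :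
    iota a u k = iotaAlt a (u (k + 1)) := rfl

lemma eps_mul_eps (a b : Idx n) : eps a * eps b = - (eps b * eps a) := by
  ext1 u; ext1 k
  rcases k with _ | _ | k
  · simp
  · simp
  · simp [epsAlt_epsAlt a b]

lemma iota_mul_iota (a b : Idx n) : iota a * iota b = - (iota b * iota a) := by
  ext1 u; ext1 k
  simp [iotaAlt_iotaAlt a b]

lemma iota_mul_eps (a b : Idx n) :
    iota a * eps b = (if b = a then (1 : ℂ) else 0) • 1 - eps b * iota a := by
  ext1 u; ext1 k
  rcases k with _ | k
  · change iotaAlt a (epsAlt b (u 0)) = (if b = a then (1 : ℂ) else 0) • u 0 - 0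
    rw [iotaAlt_epsAlt_zero, sub_zero]
  · exact iotaAlt_epsAlt a b (u (k + 1))

/-! ### Exterior multiplication by a form of arbitrary degree -/

/-- Sum of `F` over all permutations of the arguments, with signs. -/
def antisymm {V : Type*} {m : ℕ} (F : (Fin m → V) → ℂ) (v : Fin m → V) : ℂ :=
  ∑ σ : Equiv.Perm (Fin m), (Equiv.Perm.sign σ : ℤ) * F (v ∘ σ)

lemma antisymm_comp_perm {V : Type*} {m : ℕ} (F : (Fin m → V) → ℂ) (π : Equiv.Perm (Fin m))
    (v : Fin m → V) :
    antisymm (fun w => F (w ∘ π)) v = (Equiv.Perm.sign π : ℤ) * antisymm F v := by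
  unfold antisymm
  rw [Finset.mul_sum]
  refine Fintype.sum_equiv (Equiv.mulRight π) _ _ fun σ => ?_
  have h : ((Equiv.Perm.sign π : ℤ) : ℂ) * ((Equiv.Perm.sign π : ℤ) : ℂ) = 1 := by
    rcases Int.units_eq_one_or (Equiv.Perm.sign π) with h | h <;> simp [h]
  simp only [Equiv.coe_mulRight, Equiv.Perm.sign_mul, Units.val_mul, Int.cast_mul,
    Equiv.Perm.coe_mul, Function.comp_assoc]
  linear_combination (-((Equiv.Perm.sign σ : ℤ) : ℂ) * F (v ∘ ⇑σ ∘ ⇑π)) * h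

lemma antisymm_alt {m : ℕ} (u : Alt n m) (v : Fin m → Cn n) :
    antisymm (fun w => u w) v = m.factorial * u v := by
  have h : ∀ σ : Equiv.Perm (Fin m), ((Equiv.Perm.sign σ : ℤ) : ℂ) * u (v ∘ σ) = u v := by
    intro σ
    have := u.toAlternatingMap.map_perm v σ
    change u (v ∘ σ) = _ at this
    rw [this]
    rcases Int.units_eq_one_or (Equiv.Perm.sign σ) with h | h <;> simp [h]
  simp [antisymm, h, Fintype.card_perm]

lemma antisymm_sum {V : Type*} {m : ℕ} {ι : Type*} [Fintype ι] (F : ι → (Fin m → V) → ℂ)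
    (v : Fin m → V) : antisymm (fun w => ∑ i, F i w) v = ∑ i, antisymm (F i) v := by
  simp only [antisymm, Finset.mul_sum]
  exact Finset.sum_comm

lemma antisymm_const_mul {V : Type*} {m : ℕ} (c : ℂ) (F : (Fin m → V) → ℂ)
    (v : Fin m → V) : antisymm (fun w => c * F w) v = c * antisymm F v := by
  simp only [antisymm, Finset.mul_sum]
  exact Finset.sum_congr rfl fun _ _ => by ring

lemma wedge_apply {p q m : ℕ} (h : p + q = m) (α : Alt n p) (β : Alt n q) (v : Fin m → Cn n) :
    wedge h α β v = ((p.factorial * q.factorial : ℂ))⁻¹ * antisymm (fun w =>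
      α (fun i => w (finCongr h (Fin.castAdd q i))) *
        β (fun j => w (finCongr h (Fin.natAdd p j)))) v := by
  subst h
  simp [wedge, antisymm, prodForm, ContinuousMultilinearMap.alternatization_apply_apply]
  left
  refine Finset.sum_congr rfl fun σ _ => ?_
  rw [Units.smul_def, zsmul_eq_mul]
  rfl

/-- The antisymmetrization over one slot differs from the full one by the factor `1 / p!`: every
permutation is a cycle moving one argument to the front followed by a permutation of the others. -/
lemma epsAlt_eq_antisymm (a : Idx n) {p : ℕ} (β : Alt n p) (v : Fin (p + 1) → Cn n) :
    epsAlt a β v = ((p.factorial : ℂ))⁻¹ *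
      antisymm (fun w => coord a (w 0) * β (fun j => w j.succ)) v := by
  have h1 := antisymm_alt (epsAlt a β) v
  have h2 : (fun w => epsAlt a β w) = fun w => ∑ i : Fin (p + 1), (-1) ^ i.val *
      ((fun w : Fin (p + 1) → Cn n => (coord a (w 0) : ℂ) * β (fun j => w j.succ))
        (w ∘ (i.cycleRange.symm : Equiv.Perm _))) := by
    funext w
    rw [epsAlt_apply]
    refine Finset.sum_congr rfl fun i _ => ?_
    simp only [Function.comp_apply, Fin.cycleRange_symm_zero, Fin.cycleRange_symm_succ]
    rfl
  rw [h2, antisymm_sum] at h1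
  simp_rw [antisymm_const_mul] at h1
  have h3 : ∀ i : Fin (p + 1), ((-1 : ℂ)) ^ i.val * antisymm (fun w =>
      ((fun w : Fin (p + 1) → Cn n => (coord a (w 0) : ℂ) * β (fun j => w j.succ))
        (w ∘ (i.cycleRange.symm : Equiv.Perm _)))) v =
      antisymm (fun w => (coord a (w 0) : ℂ) * β (fun j => w j.succ)) v := by
    intro i
    refine (congrArg _ (antisymm_comp_perm
      (fun w : Fin (p + 1) → Cn n => (coord a (w 0) : ℂ) * β (fun j => w j.succ))
      i.cycleRange.symm v)).trans ?_
    rw [Equiv.Perm.sign_symm, Fin.sign_cycleRange]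
    push_cast
    rw [← mul_assoc, ← mul_pow]
    simp
  simp_rw [h3] at h1
  rw [Finset.sum_const, Finset.card_univ, Fintype.card_fin, nsmul_eq_mul, Nat.factorial_succ] at h1
  have h4 : ((p + 1 : ℕ) : ℂ) ≠ 0 := by exact_mod_cast Nat.succ_ne_zero p
  have h5 : (p.factorial : ℂ) ≠ 0 := by exact_mod_cast Nat.factorial_ne_zero p
  push_cast at h1 h4
  field_simp
  apply mul_left_cancel₀ h4
  rw [h1]; ring

lemma wedge_epsAlt (a : Idx n) {p q m : ℕ} (h : p + q = m) (h' : p + 1 + q = m + 1)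
    (β : Alt n p) (γ : Alt n q) :
    wedge h' (epsAlt a β) γ = epsAlt a (wedge h β γ) := by
  subst h
  ext v
  -- the common value of both sides, up to the factor `1 / (p! q!)`
  let G : (Fin (p + q + 1) → Cn n) → ℂ := fun w => coord a (w 0) *
    (β (fun i => w (Fin.castAdd q i).succ) * γ (fun j => w (Fin.natAdd p j).succ))
  have hL : wedge h' (epsAlt a β) γ v
      = ((p.factorial * q.factorial : ℂ))⁻¹ * antisymm G v := by
    let e : Fin (p + 1) ⊕ Fin q ≃ Fin (p + q + 1) := finSumFinEquiv.trans (finCongr h')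
    let P : Equiv.Perm (Fin (p + 1)) → Equiv.Perm (Fin (p + q + 1)) := fun τ =>
      e.permCongr (Equiv.Perm.sumCongr τ 1)
    have hPs : ∀ τ, Equiv.Perm.sign (P τ) = Equiv.Perm.sign τ := by
      intro τ
      simp only [P, Equiv.Perm.sign_permCongr, Equiv.Perm.sign_sumCongr, Equiv.Perm.sign_one,
        mul_one]
    have hl : ∀ τ i, P τ (e (Sum.inl i)) = e (Sum.inl (τ i)) := by
      intro τ i; simp [P, Equiv.permCongr_apply]
    have hr : ∀ τ i, P τ (e (Sum.inr i)) = e (Sum.inr i) := by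
      intro τ i; simp [P, Equiv.permCongr_apply]
    have e0 : e (Sum.inl 0) = 0 := by ext; simp [e]
    have es : ∀ i : Fin p, e (Sum.inl i.succ) = (Fin.castAdd q i).succ := by
      intro i; ext; simp [e]
    have er : ∀ i : Fin q, e (Sum.inr i) = (Fin.natAdd p i).succ := by
      intro i; ext; simp [e]; omega
    have key : (fun w : Fin (p + q + 1) → Cn n =>
        epsAlt a β (fun i => w (finCongr h' (Fin.castAdd q i))) *
          γ (fun j => w (finCongr h' (Fin.natAdd (p + 1) j)))) =
        fun w => (p.factorial : ℂ)⁻¹ * ∑ τ : Equiv.Perm (Fin (p + 1)),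
          (Equiv.Perm.sign τ : ℤ) * G (w ∘ P τ) := by
      funext w
      rw [epsAlt_eq_antisymm, antisymm, mul_assoc, Finset.sum_mul]
      congr 1
      refine Finset.sum_congr rfl fun τ _ => ?_
      simp only [G, Function.comp_apply, ← e0, ← es, ← er, hl, hr]
      rw [mul_assoc, mul_assoc]
      rfl
    rw [wedge_apply, key, antisymm_const_mul, antisymm_sum]
    have : ∀ τ : Equiv.Perm (Fin (p + 1)), antisymm (fun w => ((Equiv.Perm.sign τ : ℤ) : ℂ) *
        G (w ∘ P τ)) v = antisymm G v := by
      intro τ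
      rw [antisymm_const_mul, antisymm_comp_perm, hPs]
      rcases Int.units_eq_one_or (Equiv.Perm.sign τ) with h | h <;> simp [h]
    simp_rw [this]
    rw [Finset.sum_const, Finset.card_univ, Fintype.card_perm, Fintype.card_fin, nsmul_eq_mul]
    have h1 : ((p + 1).factorial : ℂ) ≠ 0 := by exact_mod_cast Nat.factorial_ne_zero _
    field_simp
  have hR : epsAlt a (wedge rfl β γ) v
      = ((p.factorial * q.factorial : ℂ))⁻¹ * antisymm G v := by
    let P : Equiv.Perm (Fin (p + q)) → Equiv.Perm (Fin (p + q + 1)) := fun τ =>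
      Equiv.Perm.decomposeFin.symm (0, τ)
    have hPs : ∀ τ, Equiv.Perm.sign (P τ) = Equiv.Perm.sign τ := by
      intro τ; simp [P, Equiv.Perm.decomposeFin.symm_sign]
    have h0 : ∀ τ, P τ 0 = 0 := by intro τ; simp [P]
    have hs : ∀ τ i, P τ (Fin.succ i) = (τ i).succ := by intro τ i; simp [P]
    have key : (fun w : Fin (p + q + 1) → Cn n =>
        (coord a (w 0) : ℂ) * wedge rfl β γ (fun j => w j.succ)) =
        fun w => ((p.factorial * q.factorial : ℂ))⁻¹ * ∑ τ : Equiv.Perm (Fin (p + q)),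
          (Equiv.Perm.sign τ : ℤ) * G (w ∘ P τ) := by
      funext w
      rw [wedge_apply, antisymm, mul_left_comm, Finset.mul_sum]
      congr 1
      refine Finset.sum_congr rfl fun τ _ => ?_
      simp only [G, Function.comp_apply, h0, hs]
      rw [mul_left_comm]
      rfl
    rw [epsAlt_eq_antisymm, key, antisymm_const_mul, antisymm_sum]
    have : ∀ τ : Equiv.Perm (Fin (p + q)), antisymm (fun w => ((Equiv.Perm.sign τ : ℤ) : ℂ) *
        G (w ∘ P τ)) v = antisymm G v := by
      intro τ
      rw [antisymm_const_mul, antisymm_comp_perm, hPs]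
      rcases Int.units_eq_one_or (Equiv.Perm.sign τ) with h | h <;> simp [h]
    simp_rw [this]
    rw [Finset.sum_const, Finset.card_univ, Fintype.card_perm, Fintype.card_fin, nsmul_eq_mul]
    have h1 : ((p + q).factorial : ℂ) ≠ 0 := by exact_mod_cast Nat.factorial_ne_zero _
    field_simp
  rw [hL, hR]

lemma wedge_zero_left {q : ℕ} (h : 0 + q = q) (α : Alt n 0) (β : Alt n q) :
    wedge h α β = α ![] • β := by
  ext v
  rw [wedge_apply]
  have h1 : ∀ w : Fin q → Cn n, (fun i => w (finCongr h (Fin.castAdd q i))) = ![] :=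
    fun _ => Subsingleton.elim _ _
  have h2 : ∀ w : Fin q → Cn n, (fun j => w (finCongr h (Fin.natAdd 0 j))) = w := by
    intro w; funext j; congr 1; ext; simp
  simp_rw [h1, h2]
  rw [antisymm_const_mul, antisymm_alt]
  have h4 : (q.factorial : ℂ) ≠ 0 := by exact_mod_cast Nat.factorial_ne_zero _
  simp
  field_simp

lemma wedge_add_left {p q m : ℕ} (h : p + q = m) (α α' : Alt n p) (β : Alt n q) :
    wedge h (α + α') β = wedge h α β + wedge h α' β := by
  ext v
  simp [wedge_apply, antisymm, add_mul, mul_add, Finset.sum_add_distrib]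

lemma wedge_smul_left {p q m : ℕ} (h : p + q = m) (c : ℂ) (α : Alt n p) (β : Alt n q) :
    wedge h (c • α) β = c • wedge h α β := by
  ext v
  simp [wedge_apply, antisymm, Finset.mul_sum]
  refine Finset.sum_congr rfl fun _ _ => by ring

/-- `wedge` as a linear map in its first argument. -/
def wedgeLeft {p q m : ℕ} (h : p + q = m) (β : Alt n q) : Alt n p →ₗ[ℂ] Alt n m where
  toFun α := wedge h α β
  map_add' α α' := wedge_add_left h α α' β
  map_smul' c α := wedge_smul_left h c α β

/-- Exterior multiplication by a `p`-form with constant coefficients, as an operator on the fibre,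
defined through the expansion `η = (1/p) ∑ₐ eᵃ ∧ ι_a η`. -/
def extOp : {p : ℕ} → Alt n p → FibOp n
  | 0, η => η ![] • 1
  | p + 1, η => ((p : ℂ) + 1)⁻¹ • ∑ a, eps a * extOp (iotaAlt a η)

lemma extOp_apply_of_lt {p : ℕ} (η : Alt n p) (u : Fib n) {m : ℕ} (h : m < p) :
    extOp η u m = 0 := by
  induction p generalizing m with
  | zero => omega
  | succ p ih =>
    simp only [extOp, LinearMap.smul_apply, Pi.smul_apply, LinearMap.sum_apply, Finset.sum_apply,
      Module.End.mul_apply]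
    rw [Finset.sum_eq_zero, smul_zero]
    intro a _
    rcases m with _ | m
    · rfl
    · simp [ih (iotaAlt a η) (Nat.lt_of_succ_lt_succ h)]

lemma extOp_apply {p q m : ℕ} (h : p + q = m) (η : Alt n p) (u : Fib n) :
    extOp η u m = wedge h η (u q) := by
  induction p generalizing m with
  | zero =>
    obtain rfl : q = m := (zero_add q).symm.trans h
    rw [wedge_zero_left]
    rfl
  | succ p ih =>
    obtain ⟨m, rfl⟩ : ∃ m', m = m' + 1 := ⟨p + q, by omega⟩
    have h' : p + q = m := by omega
    simp only [extOp, LinearMap.smul_apply, Pi.smul_apply, LinearMap.sum_apply, Finset.sum_apply,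
      Module.End.mul_apply, eps_apply_succ, ih h']
    have h2 := congrArg (wedgeLeft h (u q)) (sum_epsAlt_iotaAlt η)
    rw [map_sum, map_smul] at h2
    simp only [wedgeLeft, LinearMap.coe_mk, AddHom.coe_mk, wedge_epsAlt _ h' h] at h2
    rw [h2, smul_smul, inv_mul_cancel₀ (Nat.cast_add_one_ne_zero p), one_smul]

/-- The value at `x` of a form of mixed degree. -/
def Form.at {X : Type*} (u : Form n X) (x : X) : Fib n := fun k => u k x

lemma extMul_at {X : Type*} {p : ℕ} (η : KForm n X p) (u : Form n X) (x : X) :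
    (extMul η u).at x = extOp (η x) (u.at x) := by
  ext1 m
  change extMul η u m x = _
  unfold extMul
  split_ifs with h
  · rw [extOp_apply (Nat.add_sub_of_le h)]; rfl
  · rw [extOp_apply_of_lt _ _ (not_le.mp h)]

lemma extOp_add {p : ℕ} (η η' : Alt n p) : extOp (η + η') = extOp η + extOp η' := by
  induction p with
  | zero => simp [extOp, add_smul]
  | succ p ih => simp [extOp, ih, mul_add, Finset.sum_add_distrib]

lemma extOp_smul {p : ℕ} (c : ℂ) (η : Alt n p) : extOp (c • η) = c • extOp η := by
  induction p with
  | zero => simp [extOp, mul_smul]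
  | succ p ih => simp [extOp, ih, Finset.smul_sum, smul_smul, mul_comm]

/-- `extOp` as a linear map. -/
def extOpL (p : ℕ) : Alt n p →ₗ[ℂ] FibOp n where
  toFun := extOp
  map_add' := extOp_add
  map_smul' := extOp_smul

/-- The associativity `(eᵃ ∧ η) ∧ u = eᵃ ∧ (η ∧ u)`. -/
lemma extOp_epsAlt (a : Idx n) {p : ℕ} (η : Alt n p) : extOp (epsAlt a η) = eps a * extOp η := by
  ext1 u; ext1 m
  by_cases h : p + 1 ≤ m
  · obtain ⟨m, rfl⟩ : ∃ m', m = m' + 1 := ⟨m - 1, by omega⟩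
    have h2 : p + (m - p) = m := by omega
    have h3 : p + 1 + (m - p) = m + 1 := by omega
    rw [extOp_apply h3, wedge_epsAlt a h2 h3, Module.End.mul_apply, eps_apply_succ,
      extOp_apply h2]
  · rw [extOp_apply_of_lt _ _ (not_le.mp h), Module.End.mul_apply]
    rcases m with _ | m
    · rfl
    · rw [eps_apply_succ, extOp_apply_of_lt _ _ (by omega), map_zero]

lemma eps_mul_extOp (a : Idx n) {p : ℕ} (η : Alt n p) :
    eps a * extOp η = (-1 : ℂ) ^ p • (extOp η * eps a) := by
  induction p with
  | zero => simp [extOp]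
  | succ p ih =>
    simp only [extOp, mul_smul_comm, smul_mul_assoc, Finset.mul_sum, Finset.sum_mul,
      ← mul_assoc (eps a), eps_mul_eps a]
    rw [smul_comm]
    congr 1
    rw [Finset.smul_sum]
    refine Finset.sum_congr rfl fun b _ => ?_
    rw [neg_mul, mul_assoc, ih, mul_smul_comm, pow_succ, mul_assoc]
    module

end HermitianForms
end

noncomputable section

namespace HermitianForms

/-! ### Commutators in the algebra of exterior multiplications and contractions -/

section CAR

variable {A I : Type*} [Ring A] [Algebra ℂ A] [Fintype I]

/-- The quadratic expression `∑ M_{ab} x_a y_b`. -/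
def quad (M : Matrix I I ℂ) (x y : I → A) : A := ∑ a, ∑ b, M a b • (x a * y b)

/-- The family `∑_b M_{ab} x_b`. -/
def lin (M : Matrix I I ℂ) (x : I → A) (a : I) : A := ∑ b, M a b • x b

lemma lin_neg_one [DecidableEq I] (x : I → A) : lin (-1 : Matrix I I ℂ) x = -x := by
  funext a; simp [lin, Matrix.one_apply]

lemma lin_lin (M N : Matrix I I ℂ) (x : I → A) : lin M (lin N x) = lin (M * N) x := by
  funext a
  simp only [lin, Matrix.mul_apply, Finset.smul_sum, Finset.sum_smul, smul_smul]
  exact Finset.sum_comm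

lemma quad_lin_left (M N : Matrix I I ℂ) (x y : I → A) :
    quad M (lin N x) y = quad (N.transpose * M) x y := by
  simp only [quad, lin, Matrix.mul_apply, Finset.smul_sum, Finset.sum_smul, Finset.sum_mul,
    smul_mul_assoc, smul_smul, Matrix.transpose_apply]
  calc _ = ∑ b, ∑ a, ∑ c, (M a b * N a c) • (x c * y b) := Finset.sum_comm
    _ = ∑ b, ∑ c, ∑ a, (M a b * N a c) • (x c * y b) := by
        exact Finset.sum_congr rfl fun b _ => Finset.sum_comm
    _ = ∑ c, ∑ b, ∑ a, (M a b * N a c) • (x c * y b) := Finset.sum_comm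
    _ = _ := by simp only [mul_comm]

lemma quad_lin_right (M N : Matrix I I ℂ) (x y : I → A) :
    quad M x (lin N y) = quad (M * N) x y := by
  simp only [quad, lin, Matrix.mul_apply, Finset.smul_sum, Finset.sum_smul, Finset.mul_sum,
    mul_smul_comm, smul_smul]
  exact Finset.sum_congr rfl fun a _ => Finset.sum_comm

lemma quad_neg (M : Matrix I I ℂ) (x y : I → A) : quad (-M) x y = - quad M x y := by
  simp [quad]

lemma quad_neg_left (M : Matrix I I ℂ) (x y : I → A) : quad M (-x) y = - quad M x y := by
  simp [quad]

lemma quad_neg_right (M : Matrix I I ℂ) (x y : I → A) : quad M x (-y) = - quad M x y := by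
  simp [quad]

/-- If `c` satisfies the Leibniz rule with respect to the derivations `[c, x_a] = x'_a` and
`[c, y_a] = y'_a`, then `[c, ∑ M x y] = ∑ M x' y + ∑ M x y'`. -/
lemma comm_quad (M : Matrix I I ℂ) (c : A) {x y x' y' : I → A}
    (hx : ∀ a, c * x a - x a * c = x' a) (hy : ∀ a, c * y a - y a * c = y' a) :
    c * quad M x y - quad M x y * c = quad M x' y + quad M x y' := by
  simp only [quad, Finset.mul_sum, Finset.sum_mul, ← Finset.sum_sub_distrib,
    ← Finset.sum_add_distrib, mul_smul_comm, smul_mul_assoc, ← smul_sub, ← smul_add]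
  refine Finset.sum_congr rfl fun a _ => Finset.sum_congr rfl fun b _ => ?_
  rw [← hx, ← hy]; congr 1; noncomm_ring


lemma quad_self_mul_comm_of_anticomm (M : Matrix I I ℂ) {x : I → A} {c : A}
    (h : ∀ a, c * x a = - (x a * c)) : c * quad M x x = quad M x x * c := by
  simp only [quad, Finset.mul_sum, Finset.sum_mul, mul_smul_comm, smul_mul_assoc]
  refine Finset.sum_congr rfl fun a _ => Finset.sum_congr rfl fun b _ => ?_
  congr 1
  rw [← mul_assoc, h, neg_mul, mul_assoc, h]; noncomm_ring

lemma quad_comm_quad_of_anticomm (M N : Matrix I I ℂ) {x : I → A}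
    (h : ∀ a b, x a * x b = - (x b * x a)) :
    quad M x x * quad N x x = quad N x x * quad M x x := by
  have h0 : ∀ a, quad N x x * x a - x a * quad N x x = (0 : I → A) a := fun a => by
    rw [quad_self_mul_comm_of_anticomm N (h a), sub_self, Pi.zero_apply]
  have := comm_quad M (quad N x x) h0 h0
  rw [eq_comm, ← sub_eq_zero, this]
  simp [quad]

lemma lin_comm_left (J : Matrix I I ℂ) {x y : I → A} {c : A}
    (h : ∀ a, c * x a - x a * c = y a) (a : I) :
    c * lin J x a - lin J x a * c = lin J y a := by
  simp only [lin, Finset.mul_sum, Finset.sum_mul, mul_smul_comm, smul_mul_assoc,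
    ← Finset.sum_sub_distrib, ← smul_sub, h]

variable [DecidableEq I] {ε s : I → A} {G : Matrix I I ℂ}

/-- The relations satisfied by exterior multiplications `ε_a` and their adjoints `s_a` in a
basis of covectors whose Gram matrix is `G`, together with a compatible complex structure. The
matrix `W0` is that of the fundamental form. -/
structure CARData (ε s : I → A) (G J W0 : Matrix I I ℂ) : Prop where
  ee : ∀ a b, ε a * ε b = - (ε b * ε a)
  ss : ∀ a b, s a * s b = - (s b * s a)
  se : ∀ a b, s a * ε b = G a b • 1 - ε b * s a
  symm : G.transpose = G
  JJ : J * J = -1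
  skew : W0.transpose = -W0
  GW : G * W0 = -J

namespace CARData

variable {J W0 : Matrix I I ℂ}

lemma WG (D : CARData ε s G J W0) : W0 * G = J.transpose := by
  have := congrArg Matrix.transpose D.GW
  rw [Matrix.transpose_mul, D.skew, D.symm, Matrix.transpose_neg, Matrix.neg_mul] at this
  exact neg_injective this

lemma s_comm_quad (D : CARData ε s G J W0) (M : Matrix I I ℂ) (hM : M.transpose = -M) (c : I) :
    s c * quad M ε ε - quad M ε ε * s c = (2 : ℂ) • lin (G * M) ε c := by
  have h : ∀ a b, s c * (ε a * ε b) - ε a * ε b * s c = G c a • ε b - G c b • ε a := by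
    intro a b
    rw [← mul_assoc, D.se, sub_mul, mul_assoc (ε a), D.se]
    simp only [mul_sub, smul_mul_assoc, one_mul, mul_smul_comm, mul_one]
    noncomm_ring
  have hM' : ∀ a b, M b a = - M a b := fun a b => congrFun (congrFun hM a) b
  simp only [quad, Finset.mul_sum, Finset.sum_mul, ← Finset.sum_sub_distrib, mul_smul_comm,
    smul_mul_assoc, ← smul_sub, h]
  simp only [smul_sub, Finset.sum_sub_distrib, lin, Matrix.mul_apply, Finset.sum_smul, smul_smul,
    two_smul]
  rw [sub_eq_add_neg]
  congr 1
  · rw [Finset.sum_comm]; simp only [mul_comm]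
  · rw [← Finset.sum_neg_distrib]
    refine Finset.sum_congr rfl fun a _ => ?_
    rw [← Finset.sum_neg_distrib]
    refine Finset.sum_congr rfl fun b _ => ?_
    rw [hM' a b, mul_neg, neg_smul, mul_comm]

lemma quad_comm_e (D : CARData ε s G J W0) (M : Matrix I I ℂ) (hM : M.transpose = -M) (c : I) :
    quad M s s * ε c - ε c * quad M s s = (2 : ℂ) • lin ((M * G).transpose) s c := by
  have h : ∀ a b, s a * s b * ε c - ε c * (s a * s b) = G b c • s a - G a c • s b := by
    intro a b
    rw [mul_assoc, D.se, mul_sub, ← mul_assoc, D.se]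
    simp only [sub_mul, smul_mul_assoc, one_mul, mul_smul_comm, mul_one]
    noncomm_ring
  have hM' : ∀ a b, M b a = - M a b := fun a b => congrFun (congrFun hM a) b
  simp only [quad, Finset.mul_sum, Finset.sum_mul, ← Finset.sum_sub_distrib, mul_smul_comm,
    smul_mul_assoc, ← smul_sub, h]
  simp only [smul_sub, Finset.sum_sub_distrib, lin, Matrix.mul_apply, Finset.sum_smul, smul_smul,
    two_smul, Matrix.transpose_apply]
  rw [sub_eq_add_neg]
  congr 1
  rw [← Finset.sum_neg_distrib]
  conv_rhs => rw [Finset.sum_comm]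
  refine Finset.sum_congr rfl fun a _ => ?_
  rw [← Finset.sum_neg_distrib]
  refine Finset.sum_congr rfl fun b _ => ?_
  rw [hM' a b, neg_mul, neg_smul]

/-- `[s_c, L] = -(Jε)_c`. -/
lemma s_comm_L (D : CARData ε s G J W0) (c : I) :
    s c * ((1 / 2 : ℂ) • quad W0 ε ε) - ((1 / 2 : ℂ) • quad W0 ε ε) * s c = - lin J ε c := by
  rw [mul_smul_comm, smul_mul_assoc, ← smul_sub, D.s_comm_quad W0 D.skew, D.GW, smul_smul]
  simp [lin]

/-- `[Λ, ε_c] = -(Js)_c`. -/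
lemma Lam_comm_e (D : CARData ε s G J W0) (c : I) :
    ((-1 / 2 : ℂ) • quad W0 s s) * ε c - ε c * ((-1 / 2 : ℂ) • quad W0 s s) = - lin J s c := by
  rw [mul_smul_comm, smul_mul_assoc, ← smul_sub, D.quad_comm_e W0 D.skew, D.WG, smul_smul,
    Matrix.transpose_transpose]
  norm_num

end CARData

/-- The operators attached to a first order jet of a Hermitian metric in one real direction:
`L` and `Λ` for the metric, `e` and `e'` the exterior multiplications by the `(0,1)` and `(1,0)`
parts of a covector, `s` and `s'` their adjoints, `Lp` the exterior multiplication by the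
derivative of the fundamental form, `M` its adjoint, and `E = [Λ, Lp]`, with their commutators. -/
structure JetOps (L Lam e e' s s' Lp M E : A) : Prop where
  Lam_e : Lam * e - e * Lam = Complex.I • s'
  Lam_e' : Lam * e' - e' * Lam = -(Complex.I • s)
  s_L : s * L - L * s = -(Complex.I • e')
  s'_L : s' * L - L * s' = Complex.I • e
  Lam_s' : Lam * s' = s' * Lam
  L_e : L * e = e * L
  L_Lp : L * Lp = Lp * L
  s_M : s * M = M * s
  s'_M : s' * M = M * s'
  E_eq : E = Lam * Lp - Lp * Lam
  E_eq' : E = M * L - L * M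
  Lam_E : Lam * E - E * Lam = -(2 * M)
  L_E : L * E - E * L = 2 * Lp

namespace JetOps

variable {L Lam e e' s s' Lp M E : A}

/-- The contribution of one direction to the identity `[Λ, τ̄] = 2 i τ*`. -/
lemma Lam_comm_torsion (h : JetOps L Lam e e' s s' Lp M E) :
    Lam * (Lam * (e * Lp) - e * Lp * Lam) - (Lam * (e * Lp) - e * Lp * Lam) * Lam
      = (2 * Complex.I) • (M * s' * L - L * (M * s')) := by
  set t := Complex.I • s' with ht
  have h1 : Lam * e - e * Lam = t := h.Lam_e
  have h2 : Lam * t = t * Lam := by simp [ht, h.Lam_s']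
  have h3 : t * L - L * t = -e := by
    rw [ht, smul_mul_assoc, mul_smul_comm, ← smul_sub, h.s'_L, smul_smul, Complex.I_mul_I]; simp
  have h4 : t * M = M * t := by simp [ht, h.s'_M]
  have h5 := h.E_eq
  have h6 := h.E_eq'
  have h7 := h.Lam_E
  have hr : (2 * Complex.I) • (M * s' * L - L * (M * s')) = 2 * (M * t * L - L * (M * t)) := by
    rw [ht, mul_smul]
    simp only [mul_smul_comm, smul_mul_assoc, ← smul_sub, two_mul, two_smul, smul_add]
  rw [hr]
  -- both sides are equal to `2 (t E - e M)`
  have hl : Lam * (Lam * (e * Lp) - e * Lp * Lam) - (Lam * (e * Lp) - e * Lp * Lam) * Lam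
      = (Lam * (Lam * e - e * Lam) - (Lam * e - e * Lam) * Lam) * Lp
        + 2 * ((Lam * e - e * Lam) * (Lam * Lp - Lp * Lam))
        + e * (Lam * (Lam * Lp - Lp * Lam) - (Lam * Lp - Lp * Lam) * Lam) := by noncomm_ring
  rw [hl, h1, ← h5, h7, h2, sub_self, zero_mul, zero_add]
  have hr2 : 2 * (M * t * L - L * (M * t)) = 2 * (M * (t * L - L * t) + (M * L - L * M) * t) := by
    noncomm_ring
  have h8 : t * E = E * t + (M * (t * L - L * t) - (t * L - L * t) * M) := by
    have : t * E - E * t - (M * (t * L - L * t) - (t * L - L * t) * M)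
        = (t * M - M * t) * L - L * (t * M - M * t) := by rw [h6]; noncomm_ring
    rw [h4] at this
    rw [sub_self, zero_mul, mul_zero, sub_zero, sub_sub, sub_eq_zero] at this
    exact this
  rw [hr2, ← h6, h8, h3]
  noncomm_ring

/-- The contribution of one direction to the identity `[L, τ̄] = 3 ∂̄ω`. -/
lemma L_comm_torsion (h : JetOps L Lam e e' s s' Lp M E) :
    L * (Lam * (e * Lp) - e * Lp * Lam) - (Lam * (e * Lp) - e * Lp * Lam) * L = 3 * (e * Lp) := by
  set t := Complex.I • s' with ht
  have h1 : Lam * e - e * Lam = t := h.Lam_e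
  have h3 : t * L - L * t = -e := by
    rw [ht, smul_mul_assoc, mul_smul_comm, ← smul_sub, h.s'_L, smul_smul, Complex.I_mul_I]; simp
  have h5 := h.E_eq
  have h7 := h.L_E
  have hl : Lam * (e * Lp) - e * Lp * Lam = t * Lp + e * E := by
    rw [← h1, h5]; noncomm_ring
  have h3' : L * t = t * L + e := by rw [← sub_eq_iff_eq_add', ← neg_sub, h3, neg_neg]
  have h7' : L * E = E * L + 2 * Lp := by rw [← sub_eq_iff_eq_add', h7]
  rw [hl, mul_add, ← mul_assoc, ← mul_assoc, h3', h.L_e, add_mul, add_mul, mul_assoc e L, h7',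
    mul_assoc t L, h.L_Lp]
  noncomm_ring

/-- The contribution of one direction to the zeroth order part of
`∂̄* = -i [Λ, ∂] - τ̄*`. -/
lemma s_mul_E (h : JetOps L Lam e e' s s' Lp M E) :
    s * E = Complex.I • (e' * M) + (M * s * L - L * (M * s)) := by
  set f := Complex.I • e' with hf
  have h3 : s * L - L * s = -f := h.s_L
  have h4 := h.s_M
  have h6 := h.E_eq'
  have h8 : s * E = E * s + (M * (s * L - L * s) - (s * L - L * s) * M) := by
    have : s * E - E * s - (M * (s * L - L * s) - (s * L - L * s) * M)
        = (s * M - M * s) * L - L * (s * M - M * s) := by rw [h6]; noncomm_ring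
    rw [h4] at this
    rw [sub_self, zero_mul, mul_zero, sub_zero, sub_sub, sub_eq_zero] at this
    exact this
  have hr2 : M * s * L - L * (M * s) = M * (s * L - L * s) + (M * L - L * M) * s := by
    noncomm_ring
  rw [hr2, ← h6, h8, h3, ← smul_mul_assoc, ← hf]
  noncomm_ring

end JetOps

/-- The `(1,0)` part `½ (x_a - i (Jx)_a)` for exterior multiplications. -/
def part10 (J : Matrix I I ℂ) (x : I → A) (a : I) : A :=
  (1 / 2 : ℂ) • (x a - Complex.I • lin J x a)

/-- The `(0,1)` part `½ (x_a + i (Jx)_a)` for exterior multiplications. -/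
def part01 (J : Matrix I I ℂ) (x : I → A) (a : I) : A :=
  (1 / 2 : ℂ) • (x a + Complex.I • lin J x a)

lemma part10_comm_left (J : Matrix I I ℂ) {x y : I → A} {c : A}
    (h : ∀ a, c * x a - x a * c = y a) (a : I) :
    c * part10 J x a - part10 J x a * c = part10 J y a := by
  have h2 := lin_comm_left J h a
  simp only [part10, mul_smul_comm, smul_mul_assoc, ← smul_sub, mul_sub, sub_mul, ← h, ← h2]
  module

lemma part01_comm_left (J : Matrix I I ℂ) {x y : I → A} {c : A}
    (h : ∀ a, c * x a - x a * c = y a) (a : I) :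
    c * part01 J x a - part01 J x a * c = part01 J y a := by
  have h2 := lin_comm_left J h a
  simp only [part01, mul_smul_comm, smul_mul_assoc, ← smul_sub, mul_add, add_mul, ← h, ← h2]
  module

lemma part10_neg_lin {J : Matrix I I ℂ} (hJ : J * J = -1) (x : I → A) (a : I) :
    part10 J (-lin J x) a = -(Complex.I • part10 J x a) := by
  have h1 : lin J (-lin J x) a = x a := by
    have : lin J (-lin J x) = - lin J (lin J x) := by funext a; simp [lin]
    rw [this, lin_lin, hJ, lin_neg_one]; simp
  rw [part10, part10, h1, Pi.neg_apply]
  simp only [smul_sub, smul_smul, smul_neg]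
  have : Complex.I * (1 / 2 * Complex.I) = -(1 / 2) := by linear_combination (1/2) * Complex.I_mul_I
  rw [this]
  module

lemma part01_neg_lin {J : Matrix I I ℂ} (hJ : J * J = -1) (x : I → A) (a : I) :
    part01 J (-lin J x) a = Complex.I • part01 J x a := by
  have h1 : lin J (-lin J x) a = x a := by
    have : lin J (-lin J x) = - lin J (lin J x) := by funext a; simp [lin]
    rw [this, lin_lin, hJ, lin_neg_one]; simp
  rw [part01, part01, h1, Pi.neg_apply]
  simp only [smul_add, smul_smul, smul_neg]
  have : Complex.I * (1 / 2 * Complex.I) = -(1 / 2) := by linear_combination (1/2) * Complex.I_mul_I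
  rw [this]
  module

namespace CARData

/-- A skew matrix `W` invariant under `J` is the matrix of a real `(1,1)`-form: it yields the
relations of `JetOps` in every direction `a`. As `J` acts on covectors, the adjoint of the `(0,1)`
part of `ε_a` is the `(1,0)`-combination of the `s_a` and vice versa. -/
lemma jetOps {J W0 : Matrix I I ℂ} (D : CARData ε s G J W0) {W : Matrix I I ℂ}
    (hWJ : J.transpose * W * J = W) (a : I) :
    JetOps ((1 / 2 : ℂ) • quad W0 ε ε) ((-1 / 2 : ℂ) • quad W0 s s)
      (part01 J ε a) (part10 J ε a) (part10 J s a) (part01 J s a)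
      ((1 / 2 : ℂ) • quad W ε ε) ((-1 / 2 : ℂ) • quad W s s)
      ((1 / 2 : ℂ) • (quad (W * J) s ε - quad (W * J) ε s)) := by
  have hJW : J.transpose * W = - (W * J) := by
    have : J.transpose * W * (J * J) = W * J := by rw [← mul_assoc, hWJ]
    rw [D.JJ, mul_neg, mul_one] at this
    rw [← this, neg_neg]
  have hPJ : W * J * J = -W := by rw [mul_assoc, D.JJ, mul_neg, mul_one]
  have hJP : J.transpose * (W * J) = W := by rw [← mul_assoc, hWJ]
  have he : ∀ a, ((-1 / 2 : ℂ) • quad W0 s s) * ε a - ε a * ((-1 / 2 : ℂ) • quad W0 s s)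
      = (-lin J s) a := D.Lam_comm_e
  have hs : ∀ a, ((1 / 2 : ℂ) • quad W0 ε ε) * s a - s a * ((1 / 2 : ℂ) • quad W0 ε ε)
      = lin J ε a := by
    intro a; rw [← neg_sub, D.s_comm_L, neg_neg]
  have hss : ∀ (N : Matrix I I ℂ) (c : ℂ) a, (c • quad N s s) * s a - s a * (c • quad N s s)
      = (0 : I → A) a := by
    intro N c a
    rw [mul_smul_comm, smul_mul_assoc, quad_self_mul_comm_of_anticomm N (D.ss a), sub_self,
      Pi.zero_apply]
  have hee : ∀ (N : Matrix I I ℂ) (c : ℂ) a, (c • quad N ε ε) * ε a - ε a * (c • quad N ε ε)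
      = (0 : I → A) a := by
    intro N c a
    rw [mul_smul_comm, smul_mul_assoc, quad_self_mul_comm_of_anticomm N (D.ee a), sub_self,
      Pi.zero_apply]
  have z10 : ∀ a, part10 J (0 : I → A) a = 0 := by intro a; simp [part10, lin]
  have z01 : ∀ a, part01 J (0 : I → A) a = 0 := by intro a; simp [part01, lin]
  have hneg : ∀ a, s a * ((1 / 2 : ℂ) • quad W0 ε ε) - ((1 / 2 : ℂ) • quad W0 ε ε) * s a
      = (-lin J ε) a := D.s_comm_L
  have hneg' : ∀ a, ((1 / 2 : ℂ) • quad W0 ε ε) * s a - s a * ((1 / 2 : ℂ) • quad W0 ε ε)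
      = (- (-lin J ε)) a := by
    intro a; rw [Pi.neg_apply, ← hneg, neg_sub]
  have lneg : ∀ x : I → A, lin J (-x) = - lin J x := by intro x; funext a; simp [lin]
  have p10neg : ∀ (x : I → A) a, part10 J (-x) a = - part10 J x a := by
    intro x a; simp only [part10, lneg, Pi.neg_apply]; module
  have p01neg : ∀ (x : I → A) a, part01 J (-x) a = - part01 J x a := by
    intro x a; simp only [part01, lneg, Pi.neg_apply]; module
  refine ⟨?_, ?_, ?_, ?_, ?_, ?_, ?_, ?_, ?_, ?_, ?_, ?_, ?_⟩
  · rw [part01_comm_left J he, part01_neg_lin D.JJ]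
  · rw [part10_comm_left J he, part10_neg_lin D.JJ]
  · rw [← neg_sub, part10_comm_left J hneg', p10neg, part10_neg_lin D.JJ, neg_neg]
  · rw [← neg_sub, part01_comm_left J hneg', p01neg, part01_neg_lin D.JJ, neg_neg]
  · rw [← sub_eq_zero, part01_comm_left J (hss _ _), z01]
  · rw [← sub_eq_zero, part01_comm_left J (hee _ _), z01]
  · rw [smul_mul_smul_comm, smul_mul_smul_comm, quad_comm_quad_of_anticomm W0 W D.ee]
  · rw [eq_comm, ← sub_eq_zero, part10_comm_left J (hss _ _), z10]
  · rw [eq_comm, ← sub_eq_zero, part01_comm_left J (hss _ _), z01]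
  · rw [mul_smul_comm, smul_mul_assoc _ (quad W ε ε), ← smul_sub, comm_quad W _ he he,
      quad_neg_left, quad_neg_right, quad_lin_left, quad_lin_right, hJW, quad_neg]
    congr 1; abel
  · have := comm_quad W ((1 / 2 : ℂ) • quad W0 ε ε) hs hs
    rw [quad_lin_left, quad_lin_right, hJW, quad_neg] at this
    rw [smul_mul_assoc (-1 / 2 : ℂ), mul_smul_comm (-1 / 2 : ℂ), ← smul_sub,
      ← neg_sub (((1 / 2 : ℂ) • quad W0 ε ε) * quad W s s), this]
    module
  · rw [mul_smul_comm (1 / 2 : ℂ) _ (_ - _), smul_mul_assoc (1 / 2 : ℂ), ← smul_sub]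
    have h1 := comm_quad (W * J) ((-1 / 2 : ℂ) • quad W0 s s) (hss W0 (-1 / 2)) he
    have h2 := comm_quad (W * J) ((-1 / 2 : ℂ) • quad W0 s s) he (hss W0 (-1 / 2))
    have q0 : ∀ (N : Matrix I I ℂ) (x : I → A), quad N 0 x = 0 := by intro N x; simp [quad]
    have q0' : ∀ (N : Matrix I I ℂ) (x : I → A), quad N x 0 = 0 := by intro N x; simp [quad]
    rw [q0, quad_neg_right, quad_lin_right, hPJ, quad_neg] at h1
    rw [q0', quad_neg_left, quad_lin_left, hJP] at h2
    rw [mul_sub, sub_mul, sub_sub_sub_comm, h1, h2, two_mul]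
    module
  · rw [mul_smul_comm (1 / 2 : ℂ) _ (_ - _), smul_mul_assoc (1 / 2 : ℂ) (_ - _), ← smul_sub]
    have h1 := comm_quad (W * J) ((1 / 2 : ℂ) • quad W0 ε ε) hs (hee W0 (1 / 2))
    have h2 := comm_quad (W * J) ((1 / 2 : ℂ) • quad W0 ε ε) (hee W0 (1 / 2)) hs
    have q0 : ∀ (N : Matrix I I ℂ) (x : I → A), quad N 0 x = 0 := by intro N x; simp [quad]
    have q0' : ∀ (N : Matrix I I ℂ) (x : I → A), quad N x 0 = 0 := by intro N x; simp [quad]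
    rw [q0', quad_lin_left, hJP] at h1
    rw [q0, quad_lin_right, hPJ, quad_neg] at h2
    rw [mul_sub, sub_mul, sub_sub_sub_comm, h1, h2, two_mul]
    module

end CARData

end CAR

end HermitianForms
end

noncomputable section

namespace HermitianForms

variable {n : ℕ}

/-! ### The Hermitian inner product on the fibre -/

/-- The inner product of `k`-forms on `ℂⁿ` for which the coordinate covectors have the Gram
matrix `G`. -/
def altInner (G : Matrix (Idx n) (Idx n) ℝ) {k : ℕ} (α β : Alt n k) : ℂ :=
  ((k.factorial : ℂ)⁻¹) * ∑ a : Fin k → Idx n, ∑ b : Fin k → Idx n,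
    ((∏ s, G (a s) (b s) : ℝ) : ℂ) *
      (α (realBasis n ∘ a) * (starRingEnd ℂ) (β (realBasis n ∘ b)))

lemma altInner_zero_degree (G : Matrix (Idx n) (Idx n) ℝ) (α β : Alt n 0) :
    altInner G α β = α ![] * (starRingEnd ℂ) (β ![]) := by
  have h : ∀ a : Fin 0 → Idx n, realBasis n ∘ a = ![] := fun _ => Subsingleton.elim _ _
  simp [altInner, h]

lemma realBasis_comp_cons {k : ℕ} (c : Idx n) (a : Fin k → Idx n) :
    realBasis n ∘ (Fin.cons c a : Fin (k + 1) → Idx n)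
      = Matrix.vecCons (realBasis n c) (realBasis n ∘ a) := by
  funext i
  refine Fin.cases ?_ (fun i => ?_) i <;> simp

/-- Expansion of the inner product along the first argument of the forms. -/
lemma altInner_succ (G : Matrix (Idx n) (Idx n) ℝ) {k : ℕ} (α β : Alt n (k + 1)) :
    altInner G α β = ((k : ℂ) + 1)⁻¹ *
      ∑ c, ∑ d, (G c d : ℂ) * altInner G (iotaAlt c α) (iotaAlt d β) := by
  have e : ∀ f : (Fin (k + 1) → Idx n) → ℂ, ∑ a, f a = ∑ c, ∑ a : Fin k → Idx n,
      f (Fin.cons c a) := by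
    intro f
    rw [← Fintype.sum_prod_type']
    exact (Fintype.sum_equiv (Fin.consEquiv fun _ => Idx n) _ _ fun _ => rfl).symm
  unfold altInner
  rw [e]
  simp_rw [e, realBasis_comp_cons, Fin.prod_univ_succ, Fin.cons_zero, Fin.cons_succ,
    iotaAlt_apply]
  rw [Nat.factorial_succ]
  push_cast
  rw [mul_inv, mul_assoc]
  congr 1
  rw [Finset.mul_sum]
  refine Finset.sum_congr rfl fun c _ => ?_
  rw [Finset.sum_comm, Finset.mul_sum]
  refine Finset.sum_congr rfl fun d _ => ?_
  rw [Finset.mul_sum, Finset.mul_sum, Finset.mul_sum]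
  refine Finset.sum_congr rfl fun a _ => ?_
  rw [Finset.mul_sum, Finset.mul_sum, Finset.mul_sum]
  refine Finset.sum_congr rfl fun b _ => ?_
  ring

section sesquilinear

variable (G : Matrix (Idx n) (Idx n) ℝ) {k : ℕ}

lemma altInner_add_left (α α' β : Alt n k) :
    altInner G (α + α') β = altInner G α β + altInner G α' β := by
  simp only [altInner, ← mul_add, ← Finset.sum_add_distrib, ContinuousAlternatingMap.add_apply]
  congr 1
  exact Finset.sum_congr rfl fun _ _ => Finset.sum_congr rfl fun _ _ => by ring

lemma altInner_add_right (α β β' : Alt n k) :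
    altInner G α (β + β') = altInner G α β + altInner G α β' := by
  simp only [altInner, ← mul_add, ← Finset.sum_add_distrib, ContinuousAlternatingMap.add_apply,
    map_add]

lemma altInner_smul_left (c : ℂ) (α β : Alt n k) :
    altInner G (c • α) β = c * altInner G α β := by
  simp only [altInner, Finset.mul_sum, ContinuousAlternatingMap.smul_apply, smul_eq_mul]
  exact Finset.sum_congr rfl fun _ _ => Finset.sum_congr rfl fun _ _ => by ring

lemma altInner_smul_right (c : ℂ) (α β : Alt n k) :
    altInner G α (c • β) = (starRingEnd ℂ) c * altInner G α β := by
  simp only [altInner, Finset.mul_sum, ContinuousAlternatingMap.smul_apply, smul_eq_mul, map_mul]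
  exact Finset.sum_congr rfl fun _ _ => Finset.sum_congr rfl fun _ _ => by ring

lemma altInner_conj_symm (hG : G.transpose = G) (α β : Alt n k) :
    (starRingEnd ℂ) (altInner G α β) = altInner G β α := by
  have hG' : ∀ a b, G a b = G b a := fun a b => congrFun (congrFun hG b) a
  simp only [altInner, map_mul, map_sum, map_inv₀, map_natCast, Complex.conj_ofReal,
    Complex.conj_conj]
  rw [Finset.sum_comm]
  congr 1
  refine Finset.sum_congr rfl fun a _ => Finset.sum_congr rfl fun b _ => ?_
  rw [mul_comm ((starRingEnd ℂ) _)]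
  simp_rw [hG' (b _)]

end sesquilinear

/-- The inner product on `k`-forms as a sesquilinear map, linear in the first variable. -/
def altInnerL (G : Matrix (Idx n) (Idx n) ℝ) (k : ℕ) :
    Alt n k →ₗ[ℂ] Alt n k →ₛₗ[starRingEnd ℂ] ℂ :=
  LinearMap.mk₂'ₛₗ (RingHom.id ℂ) (starRingEnd ℂ) (fun α β => altInner G α β)
    (altInner_add_left G) (altInner_smul_left G) (altInner_add_right G) (altInner_smul_right G)

/-- The Hermitian inner product on the fibre, linear in the first variable. -/
def fibInner (G : Matrix (Idx n) (Idx n) ℝ) : Fib n →ₗ[ℂ] Fib n →ₛₗ[starRingEnd ℂ] ℂ :=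
  ∑ k ∈ Finset.range (2 * n + 1),
    ((altInnerL G k).compl₂ (LinearMap.proj k)).comp (LinearMap.proj k)

lemma fibInner_apply (G : Matrix (Idx n) (Idx n) ℝ) (u v : Fib n) :
    fibInner G u v = ∑ k ∈ Finset.range (2 * n + 1), altInner G (u k) (v k) := by
  simp only [fibInner, LinearMap.sum_apply]
  rfl

lemma fibInner_conj_symm {G : Matrix (Idx n) (Idx n) ℝ} (hG : G.transpose = G) (u v : Fib n) :
    (starRingEnd ℂ) (fibInner G u v) = fibInner G v u := by
  simp only [fibInner_apply, map_sum, altInner_conj_symm G hG]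

/-- Forms of degree greater than the real dimension `2n` vanish. -/
instance alt_subsingleton {k : ℕ} : Subsingleton (Alt n (k + (2 * n + 1))) := by
  refine ⟨fun α β => ?_⟩
  have h0 : ∀ α : Alt n (k + (2 * n + 1)), α = 0 := by
    intro α
    ext v
    refine α.toAlternatingMap.map_linearDependent v fun h => ?_
    have h1 := h.fintype_card_le_finrank
    have h2 : Module.finrank ℝ (Cn n) = 2 * n := by
      rw [finrank_real_of_complex, finrank_euclideanSpace, Fintype.card_fin]
    rw [h2, Fintype.card_fin] at h1
    omega
  rw [h0 α, h0 β]

lemma fib_eq_zero_of_lt (u : Fib n) {k : ℕ} (h : 2 * n < k) : u k = 0 := by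
  obtain ⟨j, rfl⟩ : ∃ j, k = j + (2 * n + 1) := ⟨k - (2 * n + 1), by omega⟩
  exact Subsingleton.elim _ _

section positive

open scoped MatrixOrder Matrix.Norms.L2Operator in
lemma exists_eq_transpose_mul_self {I : Type*} [Fintype I] [DecidableEq I] {G : Matrix I I ℝ}
    (hG : G.PosDef) : ∃ B : Matrix I I ℝ, G = B.transpose * B := by
  obtain ⟨B, hB⟩ := CStarAlgebra.nonneg_iff_eq_star_mul_self.mp hG.posSemidef.nonneg
  exact ⟨B, by rw [hB, Matrix.star_eq_conjTranspose, Matrix.conjTranspose_eq_transpose_of_trivial]⟩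

lemma sum_gram_mul_eq_sum_self {I V : Type*} [Fintype I] [AddCommGroup V] [Module ℂ V]
    (f : V →ₗ[ℂ] V →ₛₗ[starRingEnd ℂ] ℂ) (B : Matrix I I ℝ) (x : I → V) :
    ∑ c, ∑ d, (((B.transpose * B) c d : ℝ) : ℂ) * f (x c) (x d)
      = ∑ e, f (∑ c, (B e c : ℂ) • x c) (∑ c, (B e c : ℂ) • x c) := by
  simp only [map_sum, LinearMap.sum_apply, map_smul, LinearMap.smul_apply,
    LinearMap.map_smulₛₗ, Complex.conj_ofReal, smul_eq_mul]
  simp only [Matrix.mul_apply, Matrix.transpose_apply, Complex.ofReal_sum,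
    Complex.ofReal_mul, Finset.sum_mul, Finset.mul_sum]
  conv_rhs => rw [Finset.sum_comm]
  conv_lhs => rw [Finset.sum_comm]
  refine Finset.sum_congr rfl fun d _ => ?_
  rw [Finset.sum_comm]
  exact Finset.sum_congr rfl fun e _ => Finset.sum_congr rfl fun c _ => by ring

variable {G : Matrix (Idx n) (Idx n) ℝ}

open ComplexOrder in
lemma altInner_self_nonneg (hG : G.PosDef) {k : ℕ} (α : Alt n k) :
    0 ≤ altInner G α α ∧ (altInner G α α = 0 → α = 0) := by
  obtain ⟨B, hB⟩ := exists_eq_transpose_mul_self hG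
  have hdet : IsUnit B.det := by
    have := hG.det_pos
    rw [hB, Matrix.det_mul, Matrix.det_transpose] at this
    exact isUnit_iff_ne_zero.mpr fun h => by simp [h] at this
  induction k with
  | zero =>
    rw [altInner_zero_degree, Complex.mul_conj]
    refine ⟨by exact_mod_cast Complex.normSq_nonneg _, fun h => ?_⟩
    have h1 : α ![] = 0 := Complex.normSq_eq_zero.mp (by exact_mod_cast h)
    ext v
    rw [Subsingleton.elim v ![], h1]; rfl
  | succ k ih =>
    let γ : Idx n → Alt n k := fun e => ∑ c, (B e c : ℂ) • iotaAlt c α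
    have key : ∑ c, ∑ d, (G c d : ℂ) * altInner G (iotaAlt c α) (iotaAlt d α)
        = ∑ e, altInner G (γ e) (γ e) := by
      rw [hB]
      exact sum_gram_mul_eq_sum_self (altInnerL (B.transpose * B) k) B fun c => iotaAlt c α
    have hk : (0 : ℂ) < ((k : ℂ) + 1)⁻¹ := by
      have : (0 : ℝ) < ((k : ℝ) + 1)⁻¹ := by positivity
      have h2 : ((k : ℂ) + 1)⁻¹ = (((k : ℝ) + 1)⁻¹ : ℝ) := by push_cast; rfl
      rw [h2]
      exact Complex.zero_lt_real.mpr this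
    rw [altInner_succ, key]
    have hs : 0 ≤ ∑ e, altInner G (γ e) (γ e) := Finset.sum_nonneg fun e _ => (ih (γ e)).1
    refine ⟨mul_nonneg hk.le hs, fun h => ?_⟩
    have h1 : ∑ e, altInner G (γ e) (γ e) = 0 := (mul_eq_zero.mp h).resolve_left hk.ne'
    have h2 : ∀ e, γ e = 0 := fun e => (ih (γ e)).2
      ((Finset.sum_eq_zero_iff_of_nonneg fun e _ => (ih (γ e)).1).mp h1 e (Finset.mem_univ e))
    refine alt_ext_iota fun c => ?_
    rw [map_zero]
    have h3 : ∑ e, ((B⁻¹ c e : ℝ) : ℂ) • γ e = iotaAlt c α := by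
      simp only [γ, Finset.smul_sum, smul_smul]
      rw [Finset.sum_comm]
      simp only [← Finset.sum_smul, ← Complex.ofReal_mul, ← Complex.ofReal_sum,
        ← Matrix.mul_apply, Matrix.nonsing_inv_mul B hdet, Matrix.one_apply]
      simp
    rw [← h3]
    exact Finset.sum_eq_zero fun e _ => by
      rw [h2]; exact smul_zero (M := ℂ) (A := Alt n k) _

open ComplexOrder in
lemma fibInner_self_nonneg (hG : G.PosDef) (u : Fib n) : 0 ≤ fibInner G u u := by
  rw [fibInner_apply]
  exact Finset.sum_nonneg fun k _ => (altInner_self_nonneg hG (u k)).1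

open ComplexOrder in
lemma eq_zero_of_fibInner_self (hG : G.PosDef) {u : Fib n} (h : fibInner G u u = 0) : u = 0 := by
  rw [fibInner_apply,
    Finset.sum_eq_zero_iff_of_nonneg fun k _ => (altInner_self_nonneg hG (u k)).1] at h
  ext1 k
  by_cases hk : k < 2 * n + 1
  · exact (altInner_self_nonneg hG (u k)).2 (h k (Finset.mem_range.mpr hk))
  · exact fib_eq_zero_of_lt u (by omega)

lemma eq_of_fibInner_eq (hG : G.PosDef) {u v : Fib n}
    (h : ∀ w, fibInner G w u = fibInner G w v) : u = v := by
  rw [← sub_eq_zero]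
  refine eq_zero_of_fibInner_self hG ?_
  rw [map_sub, h, sub_self]

end positive

/-! ### Adjoints on the fibre -/

/-- `S` is the adjoint of `T` for the inner product on the fibre. -/
def IsFibAdj (G : Matrix (Idx n) (Idx n) ℝ) (T S : FibOp n) : Prop :=
  ∀ u v, fibInner G (T u) v = fibInner G u (S v)

namespace IsFibAdj

variable {G : Matrix (Idx n) (Idx n) ℝ} {T S T' S' : FibOp n}

lemma add (h : IsFibAdj G T S) (h' : IsFibAdj G T' S') : IsFibAdj G (T + T') (S + S') := by
  intro u v; simp [h u v, h' u v]

lemma sub (h : IsFibAdj G T S) (h' : IsFibAdj G T' S') : IsFibAdj G (T - T') (S - S') := by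
  intro u v
  rw [LinearMap.sub_apply, map_sub, LinearMap.sub_apply, LinearMap.sub_apply, map_sub, h u v,
    h' u v]

lemma smul (c : ℂ) (h : IsFibAdj G T S) : IsFibAdj G (c • T) ((starRingEnd ℂ) c • S) := by
  intro u v; simp [h u v]

lemma mul (h : IsFibAdj G T S) (h' : IsFibAdj G T' S') : IsFibAdj G (T * T') (S' * S) := by
  intro u v; simp [h _ _, h' _ _]

lemma one : IsFibAdj G 1 1 := fun _ _ => rfl

lemma sum {ι : Type*} {s : Finset ι} {T S : ι → FibOp n} (h : ∀ i ∈ s, IsFibAdj G (T i) (S i)) :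
    IsFibAdj G (∑ i ∈ s, T i) (∑ i ∈ s, S i) := by
  intro u v
  simp only [LinearMap.sum_apply, map_sum]
  exact Finset.sum_congr rfl fun i hi => h i hi u v

lemma unique (hG : G.PosDef) (h : IsFibAdj G T S) (h' : IsFibAdj G T S') : S = S' := by
  ext1 v
  exact eq_of_fibInner_eq hG fun w => by rw [← h, ← h']

lemma symm (hG : G.transpose = G) (h : IsFibAdj G T S) : IsFibAdj G S T := by
  intro u v
  rw [← fibInner_conj_symm hG, ← h, fibInner_conj_symm hG]

end IsFibAdj

/-- The adjoint of `eps a`: the contraction with the vector dual to the covector `coord a`. -/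
def epsAdj (G : Matrix (Idx n) (Idx n) ℝ) (a : Idx n) : FibOp n := ∑ d, (G a d : ℂ) • iota d

lemma altInner_epsAlt (G : Matrix (Idx n) (Idx n) ℝ) (a : Idx n) {k : ℕ} (u : Alt n k)
    (v : Alt n (k + 1)) :
    altInner G (epsAlt a u) v = altInner G u (∑ d, (G a d : ℂ) • iotaAlt d v) := by
  have hrt : ∀ {k : ℕ} (u : Alt n k) (w : Idx n → Alt n k),
      altInner G u (∑ d, (G a d : ℂ) • w d) = ∑ d, (G a d : ℂ) * altInner G u (w d) := by
    intro k u w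
    change altInnerL G k u _ = ∑ d, (G a d : ℂ) * altInnerL G k u (w d)
    simp [map_sum]
  induction k with
  | zero =>
    rw [altInner_succ, hrt]
    simp only [iotaAlt_epsAlt_zero, altInner_smul_left]
    simp
  | succ k ih =>
    have hk : ((k : ℂ) + 1 + 1) ≠ 0 := by exact_mod_cast Nat.succ_ne_zero (k + 1)
    have hk' : ((k : ℂ) + 1) ≠ 0 := by exact_mod_cast Nat.succ_ne_zero k
    have hsub : ∀ x y z : Alt n (k + 1), altInner G (x - y) z = altInner G x z - altInner G y z :=
      fun x y z => by
        change altInnerL G _ (x - y) z = altInnerL G _ x z - altInnerL G _ y z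
        simp
    have hs : ∀ d, ∑ e, (G a e : ℂ) • iotaAlt e (iotaAlt d v)
        = - iotaAlt d (∑ e, (G a e : ℂ) • iotaAlt e v) := by
      intro d
      simp only [map_sum, map_smul, ← Finset.sum_neg_distrib, iotaAlt_iotaAlt d, smul_neg,
        neg_neg]
    have hneg : ∀ x y : Alt n k, altInner G x (-y) = - altInner G x y := fun x y => by
      change altInnerL G _ x (-y) = - altInnerL G _ x y
      simp
    rw [altInner_succ]
    simp only [iotaAlt_epsAlt, hsub, altInner_smul_left, ih, hs, hneg]
    have h1 : ∑ c, ∑ d, (G c d : ℂ) * altInner G (iotaAlt c u)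
        (iotaAlt d (∑ e, (G a e : ℂ) • iotaAlt e v))
        = ((k : ℂ) + 1) * altInner G u (∑ e, (G a e : ℂ) • iotaAlt e v) := by
      rw [altInner_succ, ← mul_assoc, mul_inv_cancel₀ hk', one_mul]
    have h2 : ∑ c, ∑ d, (G c d : ℂ) * ((if a = c then 1 else 0) * altInner G u (iotaAlt d v))
        = altInner G u (∑ e, (G a e : ℂ) • iotaAlt e v) := by
      rw [hrt]
      simp
    simp only [sub_neg_eq_add, mul_add, Finset.sum_add_distrib]
    rw [h1, h2]
    push_cast
    field_simp
    ring

lemma isFibAdj_eps (G : Matrix (Idx n) (Idx n) ℝ) (a : Idx n) :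
    IsFibAdj G (eps a) (epsAdj G a) := by
  intro u v
  -- the degrees `0` on one side and `2n` on the other, not matched by the shift, do not contribute
  have h0 : (epsAdj G a v) (2 * n) = 0 := by
    simp only [epsAdj, LinearMap.sum_apply, Finset.sum_apply, LinearMap.smul_apply, Pi.smul_apply,
      iota_apply, fib_eq_zero_of_lt v (Nat.lt_succ_self (2 * n)), map_zero, smul_zero,
      Finset.sum_const_zero]
  rw [fibInner_apply, fibInner_apply, Finset.sum_range_succ', Finset.sum_range_succ, h0]
  congr 1
  · refine Finset.sum_congr rfl fun k _ => ?_
    rw [eps_apply_succ, altInner_epsAlt]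
    congr 1
    simp only [epsAdj, LinearMap.sum_apply, Finset.sum_apply, LinearMap.smul_apply, Pi.smul_apply,
      iota_apply]
  · rw [eps_apply_zero]
    have h1 : altInner G (0 : Alt n 0) (v 0) = 0 := by
      change altInnerL G _ 0 _ = 0; simp
    have h2 : altInner G (u (2 * n)) 0 = 0 := by
      change altInnerL G _ _ 0 = 0; simp
    rw [h1, h2]

/-- The adjoint of the exterior multiplication by a `p`-form, built along the recursive definition
of `extOp`. -/
def contrOp (G : Matrix (Idx n) (Idx n) ℝ) : {p : ℕ} → Alt n p → FibOp n
  | 0, η => (starRingEnd ℂ) (η ![]) • 1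
  | p + 1, η => ((p : ℂ) + 1)⁻¹ • ∑ a, contrOp G (iotaAlt a η) * epsAdj G a

lemma isFibAdj_extOp (G : Matrix (Idx n) (Idx n) ℝ) {p : ℕ} (η : Alt n p) :
    IsFibAdj G (extOp η) (contrOp G η) := by
  induction p with
  | zero => exact IsFibAdj.one.smul _
  | succ p ih =>
    have := (IsFibAdj.sum (s := Finset.univ)
      fun a _ => (isFibAdj_eps G a).mul (ih (iotaAlt a η))).smul ((p : ℂ) + 1)⁻¹
    simpa [extOp, contrOp] using this

end HermitianForms
end

noncomputable section

namespace HermitianForms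

open ContinuousAlternatingMap (alternatizeUncurryFin alternatizeUncurryFinCLM
  alternatizeUncurryFin_add alternatizeUncurryFin_smul alternatizeUncurryFin_apply
  alternatizeUncurryFin_curryLeft alternatizeUncurryFinCLM_apply)

variable {n : ℕ}

/-! ### Real `(1,1)`-forms and Hermitian metrics on `ℂⁿ` -/

/-- Real forms of type `(1,1)` with constant coefficients. -/
structure IsReal11 (η : Alt n 2) : Prop where
  real : ∀ v w, (η ![v, w]).im = 0
  type_one_one : ∀ v w, η ![mulI n v, mulI n w] = η ![v, w]

/-- Fundamental forms of Hermitian metrics on `ℂⁿ`. -/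
structure IsHerm (η : Alt n 2) : Prop extends IsReal11 η where
  pos : ∀ v, v ≠ 0 → 0 < (η ![v, mulI n v]).re

/-- The matrix of the real part of a `2`-form in the real basis. -/
def mat (η : Alt n 2) : Matrix (Idx n) (Idx n) ℝ :=
  Matrix.of fun a b => (η ![realBasis n a, realBasis n b]).re

/-- The matrix of the complex structure of `ℂⁿ`. -/
abbrev matJ (n : ℕ) : Matrix (Idx n) (Idx n) ℝ := Matrix.J (Fin n) ℝ

/-- Complexification of a real matrix. -/
abbrev cplx {I : Type*} (M : Matrix I I ℝ) : Matrix I I ℂ := M.map Complex.ofRealHom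

lemma matJ_mul_matJ : matJ n * matJ n = -1 := Matrix.J_squared _ _

lemma alt_two_eq_iota (η : Alt n 2) (v w : Cn n) :
    η ![v, w] = (η.curryLeft v).curryLeft w ![] := rfl

lemma alt_two_sum_right {ι : Type*} (s : Finset ι) (η : Alt n 2) (v : Cn n) (c : ι → ℝ)
    (w : ι → Cn n) : η ![v, ∑ i ∈ s, c i • w i] = ∑ i ∈ s, (c i : ℂ) * η ![v, w i] := by
  simp only [alt_two_eq_iota, map_sum, map_smul]
  simp [ContinuousAlternatingMap.sum_apply]

lemma alt_two_swap (η : Alt n 2) (v w : Cn n) : η ![w, v] = - η ![v, w] := by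
  have := η.toAlternatingMap.map_swap ![v, w] (i := 0) (j := 1) (by decide)
  have h2 : ![v, w] ∘ (Equiv.swap (0 : Fin 2) 1) = ![w, v] := by
    funext i; fin_cases i <;> simp
  rw [h2] at this
  exact this

lemma alt_two_sum_left {ι : Type*} (s : Finset ι) (η : Alt n 2) (v : Cn n) (c : ι → ℝ)
    (w : ι → Cn n) : η ![∑ i ∈ s, c i • w i, v] = ∑ i ∈ s, (c i : ℂ) * η ![w i, v] := by
  rw [alt_two_swap, alt_two_sum_right, ← Finset.sum_neg_distrib]
  exact Finset.sum_congr rfl fun i _ => by rw [alt_two_swap η (w i) v, mul_neg, neg_neg]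

lemma gram_eq (η : Alt n 2) : gram η = mat η * matJ n := by
  ext a b
  simp only [gram, mat, Matrix.mul_apply, Matrix.of_apply, mulI_realBasis, alt_two_sum_right,
    Complex.re_sum, Complex.re_ofReal_mul]
  exact Finset.sum_congr rfl fun c _ => mul_comm _ _

lemma mat_transpose (η : Alt n 2) : (mat η).transpose = - mat η := by
  ext a b
  simp only [mat, Matrix.transpose_apply, Matrix.of_apply, Matrix.neg_apply]
  rw [alt_two_swap, Complex.neg_re]

lemma IsReal11.matJ_mat_matJ {η : Alt n 2} (h : IsReal11 η) :
    (matJ n).transpose * mat η * matJ n = mat η := by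
  ext a b
  have := congrArg Complex.re (h.type_one_one (realBasis n a) (realBasis n b))
  rw [mulI_realBasis, mulI_realBasis, alt_two_sum_right] at this
  simp only [alt_two_sum_left, Complex.re_sum, Complex.re_ofReal_mul] at this
  simp only [mat, Matrix.mul_apply, Matrix.of_apply, Matrix.transpose_apply]
  rw [← this]
  refine Finset.sum_congr rfl fun c _ => ?_
  rw [mul_comm]

lemma IsReal11.gram_transpose {η : Alt n 2} (h : IsReal11 η) : (gram η).transpose = gram η := by
  rw [gram_eq, Matrix.transpose_mul, mat_transpose, Matrix.mul_neg]
  have h1 : (matJ n).transpose * mat η * matJ n * matJ n = mat η * matJ n :=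
    congrArg (· * matJ n) h.matJ_mat_matJ
  rw [Matrix.mul_assoc _ (matJ n), matJ_mul_matJ, Matrix.mul_neg, Matrix.mul_one] at h1
  exact h1

lemma IsReal11.coe_mat {η : Alt n 2} (h : IsReal11 η) (a b : Idx n) :
    ((mat η a b : ℝ) : ℂ) = η ![realBasis n a, realBasis n b] := by
  apply Complex.ext <;> simp [mat, h.real]

lemma IsHerm.posDef {η : Alt n 2} (h : IsHerm η) : (gram η).PosDef := by
  refine Matrix.PosDef.of_dotProduct_mulVec_pos ?_ fun x hx => ?_
  · rw [Matrix.IsHermitian, Matrix.conjTranspose_eq_transpose_of_trivial,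
      h.toIsReal11.gram_transpose]
  · have hv : ∑ a, x a • realBasis n a ≠ 0 := by
      intro h0
      apply hx
      funext a
      have := congrArg (coord a) h0
      simpa [coord_realBasis, -Fintype.sum_sum_type] using this
    have := h.pos _ hv
    rw [alt_two_sum_left] at this
    simp only [map_sum, map_smul, alt_two_sum_right, Complex.re_sum, Complex.re_ofReal_mul] at this
    simpa only [dotProduct, Matrix.mulVec, gram, Matrix.of_apply, Pi.star_apply, star_trivial,
      mul_comm] using this

/-- The Gram matrix of the coordinate covectors. -/
abbrev gramInv (η : Alt n 2) : Matrix (Idx n) (Idx n) ℝ := (gram η)⁻¹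

lemma IsHerm.isUnit_det {η : Alt n 2} (h : IsHerm η) : IsUnit (gram η).det :=
  isUnit_iff_ne_zero.mpr h.posDef.det_pos.ne'

lemma IsHerm.posDef_inv {η : Alt n 2} (h : IsHerm η) : (gramInv η).PosDef := h.posDef.inv

lemma IsHerm.gramInv_transpose {η : Alt n 2} (h : IsHerm η) :
    (gramInv η).transpose = gramInv η := by
  rw [gramInv, Matrix.transpose_nonsing_inv, h.toIsReal11.gram_transpose]

lemma IsHerm.gramInv_mul_mat {η : Alt n 2} (h : IsHerm η) : gramInv η * mat η = - matJ n := by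
  have h1 : gramInv η * gram η = 1 := Matrix.nonsing_inv_mul _ h.isUnit_det
  rw [gram_eq, ← Matrix.mul_assoc] at h1
  have h2 : gramInv η * mat η * matJ n * matJ n = 1 * matJ n := congrArg (· * matJ n) h1
  rw [Matrix.mul_assoc _ (matJ n), matJ_mul_matJ, Matrix.mul_neg, Matrix.mul_one,
    Matrix.one_mul] at h2
  rw [← h2, neg_neg]

lemma extOp_two {η : Alt n 2} (h : IsReal11 η) :
    extOp η = (1 / 2 : ℂ) • quad (cplx (mat η)) eps eps := by
  have h1 : ∀ a b, iotaAlt b (iotaAlt a η) ![] = ((mat η a b : ℝ) : ℂ) := fun a b =>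
    (h.coe_mat a b).symm
  have h2 : ((1 : ℕ) : ℂ) + 1 = 2 := by norm_num
  simp only [extOp, quad, h1, h2, Nat.cast_zero, zero_add, inv_one, one_smul, mul_smul_comm,
    mul_one, Finset.mul_sum, one_div]
  rfl

lemma contrOp_two {η : Alt n 2} (h : IsReal11 η) (G : Matrix (Idx n) (Idx n) ℝ) :
    contrOp G η = (-1 / 2 : ℂ) • quad (cplx (mat η)) (epsAdj G) (epsAdj G) := by
  have h1 : ∀ a b, iotaAlt b (iotaAlt a η) ![] = ((mat η a b : ℝ) : ℂ) := fun a b =>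
    (h.coe_mat a b).symm
  have h2 : ((1 : ℕ) : ℂ) + 1 = 2 := by norm_num
  have h3 : ∀ a b, (mat η b a : ℝ) = - mat η a b := fun a b =>
    congrFun (congrFun (mat_transpose η) a) b
  simp only [contrOp, quad, h1, h2, Nat.cast_zero, zero_add, inv_one, one_smul, smul_mul_assoc,
    one_mul, Finset.sum_mul, Complex.conj_ofReal]
  rw [neg_div, neg_smul, ← smul_neg, Finset.sum_comm, ← Finset.sum_neg_distrib, one_div]
  congr 1
  refine Finset.sum_congr rfl fun a _ => ?_
  rw [← Finset.sum_neg_distrib]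
  refine Finset.sum_congr rfl fun b _ => ?_
  rw [h3 a b]
  push_cast
  simp

lemma iota_mul_epsAdj (G : Matrix (Idx n) (Idx n) ℝ) (a b : Idx n) :
    epsAdj G a * epsAdj G b = - (epsAdj G b * epsAdj G a) := by
  have h : ∀ d, epsAdj G a * iota d = - (iota d * epsAdj G a) := fun d => by
    simp only [epsAdj, Finset.sum_mul, Finset.mul_sum, smul_mul_assoc, mul_smul_comm,
      iota_mul_iota _ d, smul_neg, Finset.sum_neg_distrib]
  conv_lhs => rw [epsAdj.eq_def G b]
  conv_rhs => rw [epsAdj.eq_def G b]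
  simp only [Finset.sum_mul, Finset.mul_sum, smul_mul_assoc, mul_smul_comm, h, smul_neg,
    Finset.sum_neg_distrib]

lemma epsAdj_mul_eps (G : Matrix (Idx n) (Idx n) ℝ) (a b : Idx n) :
    epsAdj G a * eps b = (G a b : ℂ) • 1 - eps b * epsAdj G a := by
  simp only [epsAdj, Finset.sum_mul, Finset.mul_sum, smul_mul_assoc, mul_smul_comm, iota_mul_eps,
    smul_sub, Finset.sum_sub_distrib, smul_smul]
  congr 1
  simp [-Fintype.sum_sum_type]

lemma IsHerm.carData {η : Alt n 2} (h : IsHerm η) :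
    CARData (A := FibOp n) eps (epsAdj (gramInv η)) (cplx (gramInv η)) (cplx (matJ n))
      (cplx (mat η)) where
  ee := eps_mul_eps
  ss := iota_mul_epsAdj _
  se a b := epsAdj_mul_eps _ a b
  symm := by rw [← Matrix.transpose_map, h.gramInv_transpose]
  JJ := by
    rw [← Matrix.map_mul, matJ_mul_matJ]
    ext i j; simp [Matrix.one_apply]; split_ifs <;> simp
  skew := by
    rw [← Matrix.transpose_map, mat_transpose]
    ext i j; simp
  GW := by
    rw [← Matrix.map_mul, h.gramInv_mul_mat]
    ext i j
    simp only [Matrix.map_apply, Matrix.neg_apply, map_neg]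

/-- The derivative, in a direction along which `ω` has derivative `η`, of the volume-weighted inner
product is given by this operator. It is equal to `[Λ, η ∧ ·]`. -/
def varOp (G : Matrix (Idx n) (Idx n) ℝ) (η : Alt n 2) : FibOp n :=
  (1 / 2 : ℂ) • (quad (cplx (mat η) * cplx (matJ n)) (epsAdj G) eps
    - quad (cplx (mat η) * cplx (matJ n)) eps (epsAdj G))

lemma IsHerm.jetOps {η η' : Alt n 2} (h : IsHerm η) (h' : IsReal11 η') (a : Idx n) :
    JetOps (A := FibOp n) (extOp η) (contrOp (gramInv η) η) (part01 (cplx (matJ n)) eps a)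
      (part10 (cplx (matJ n)) eps a)
      (part10 (cplx (matJ n)) (epsAdj (gramInv η)) a)
      (part01 (cplx (matJ n)) (epsAdj (gramInv η)) a)
      (extOp η') (contrOp (gramInv η) η') (varOp (gramInv η) η') := by
  have hWJ : (cplx (matJ n)).transpose * cplx (mat η') * cplx (matJ n) = cplx (mat η') := by
    rw [← Matrix.transpose_map, ← Matrix.map_mul, ← Matrix.map_mul, h'.matJ_mat_matJ]
  have := h.carData.jetOps hWJ a
  rwa [extOp_two h.toIsReal11, contrOp_two h.toIsReal11, extOp_two h', contrOp_two h']

lemma isFibAdj_lin {G : Matrix (Idx n) (Idx n) ℝ} (M : Matrix (Idx n) (Idx n) ℝ)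
    {x y : Idx n → FibOp n} (h : ∀ a, IsFibAdj G (x a) (y a)) (a : Idx n) :
    IsFibAdj G (lin (cplx M) x a) (lin (cplx M) y a) := by
  refine IsFibAdj.sum fun b _ => ?_
  have := (h b).smul (cplx M a b)
  simpa using this

lemma conj_one_half : (starRingEnd ℂ) (1 / 2) = 1 / 2 := by
  rw [show (1 / 2 : ℂ) = ((1 / 2 : ℝ) : ℂ) by push_cast; rfl, Complex.conj_ofReal]

lemma isFibAdj_part10 {G : Matrix (Idx n) (Idx n) ℝ} (M : Matrix (Idx n) (Idx n) ℝ)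
    {x y : Idx n → FibOp n} (h : ∀ a, IsFibAdj G (x a) (y a)) (a : Idx n) :
    IsFibAdj G (part10 (cplx M) x a) (part01 (cplx M) y a) := by
  have := ((h a).sub ((isFibAdj_lin M h a).smul Complex.I)).smul (1 / 2 : ℂ)
  rw [conj_one_half] at this
  simpa [part10, part01] using this

lemma isFibAdj_part01 {G : Matrix (Idx n) (Idx n) ℝ} (M : Matrix (Idx n) (Idx n) ℝ)
    {x y : Idx n → FibOp n} (h : ∀ a, IsFibAdj G (x a) (y a)) (a : Idx n) :
    IsFibAdj G (part01 (cplx M) x a) (part10 (cplx M) y a) := by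
  have := ((h a).add ((isFibAdj_lin M h a).smul Complex.I)).smul (1 / 2 : ℂ)
  rw [conj_one_half] at this
  simpa [part10, part01, sub_eq_add_neg] using this

/-! ### Exterior multiplication by `∂η` and `∂̄η` -/

/-- The value at a point of `∂u`, given the derivatives `D k` of the components of `u`. -/
def jetDel (D : (k : ℕ) → Cn n →L[ℝ] Alt n k) : Fib n
  | 0 => 0
  | k + 1 => alternatizeUncurryFin (linPart (D k))

/-- The value at a point of `∂̄u`, given the derivatives `D k` of the components of `u`. -/
def jetDelbar (D : (k : ℕ) → Cn n →L[ℝ] Alt n k) : Fib n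
  | 0 => 0
  | k + 1 => alternatizeUncurryFin (antiPart (D k))

lemma sum_part {V : Type*} [AddCommGroup V] [Module ℂ V] (x : Idx n → Module.End ℂ V)
    (w : Idx n → V) (z : ℂ) :
    ∑ a, x a ((1 / 2 : ℂ) • (w a + z • ∑ c, ((matJ n c a : ℝ) : ℂ) • w c)) =
      ∑ a, ((1 / 2 : ℂ) • (x a + z • lin (cplx (matJ n)) x a)) (w a) := by
  simp only [LinearMap.smul_apply, LinearMap.add_apply, lin, LinearMap.sum_apply, map_smul, map_add,
    map_sum, ← Finset.smul_sum, Finset.sum_add_distrib]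
  congr 3
  rw [Finset.sum_comm]
  rfl

lemma antiPart_realBasis {k : ℕ} (D : Cn n →L[ℝ] Alt n k) (a : Idx n) :
    antiPart D (realBasis n a) = (1 / 2 : ℂ) • (D (realBasis n a) +
      Complex.I • ∑ c, ((matJ n c a : ℝ) : ℂ) • D (realBasis n c)) := by
  have : D (mulI n (realBasis n a)) = ∑ c, ((matJ n c a : ℝ) : ℂ) • D (realBasis n c) := by
    rw [mulI_realBasis, map_sum]
    exact Finset.sum_congr rfl fun c _ => by rw [map_smul]; rfl
  rw [← this]; rfl

lemma linPart_realBasis {k : ℕ} (D : Cn n →L[ℝ] Alt n k) (a : Idx n) :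
    linPart D (realBasis n a) = (1 / 2 : ℂ) • (D (realBasis n a) +
      (-Complex.I) • ∑ c, ((matJ n c a : ℝ) : ℂ) • D (realBasis n c)) := by
  have : D (mulI n (realBasis n a)) = ∑ c, ((matJ n c a : ℝ) : ℂ) • D (realBasis n c) := by
    rw [mulI_realBasis, map_sum]
    exact Finset.sum_congr rfl fun c _ => by rw [map_smul]; rfl
  rw [← this]
  change (1 / 2 : ℂ) • (_ - Complex.I • D (mulI n (realBasis n a))) = _
  rw [sub_eq_add_neg]
  congr 2
  exact (neg_smul _ _).symm

lemma part10_eq {A I : Type*} [Ring A] [Algebra ℂ A] [Fintype I] (J : Matrix I I ℂ) (x : I → A)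
    (a : I) : part10 J x a = (1 / 2 : ℂ) • (x a + (-Complex.I) • lin J x a) := by
  rw [part10, neg_smul, ← sub_eq_add_neg]

lemma jet_aux (D : (k : ℕ) → Cn n →L[ℝ] Alt n k) (z : ℂ) (a : Idx n) :
    (fun k => (1 / 2 : ℂ) • (D k (realBasis n a) +
      z • ∑ c, ((matJ n c a : ℝ) : ℂ) • D k (realBasis n c))) = (1 / 2 : ℂ) •
        ((fun k => D k (realBasis n a) : Fib n) + z • ∑ c, ((matJ n c a : ℝ) : ℂ) •
          (fun k => D k (realBasis n c) : Fib n)) := by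
  funext k
  simp only [Pi.smul_apply, Pi.add_apply, Finset.sum_apply]

lemma jetDelbar_eq (D : (k : ℕ) → Cn n →L[ℝ] Alt n k) :
    jetDelbar D = ∑ a, part01 (cplx (matJ n)) eps a (fun k => D k (realBasis n a)) := by
  unfold part01
  rw [← sum_part]
  simp only [← jet_aux]
  funext k
  rw [Finset.sum_apply]
  rcases k with _ | k
  · simp [jetDelbar]
  · simp only [jetDelbar, eps_apply_succ]
    rw [alternatizeUncurryFin_eq_sum]
    exact Finset.sum_congr rfl fun a _ => by rw [antiPart_realBasis]

lemma jetDel_eq (D : (k : ℕ) → Cn n →L[ℝ] Alt n k) :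
    jetDel D = ∑ a, part10 (cplx (matJ n)) eps a (fun k => D k (realBasis n a)) := by
  simp only [part10_eq]
  rw [← sum_part]
  simp only [← jet_aux]
  funext k
  rw [Finset.sum_apply]
  rcases k with _ | k
  · simp [jetDel]
  · simp only [jetDel, eps_apply_succ]
    rw [alternatizeUncurryFin_eq_sum]
    exact Finset.sum_congr rfl fun a _ => by rw [linPart_realBasis]

lemma extOp_antiPart {p : ℕ} (D : Cn n →L[ℝ] Alt n p) :
    extOp (alternatizeUncurryFin (antiPart D)) =
      ∑ a, part01 (cplx (matJ n)) eps a * extOp (D (realBasis n a)) := by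
  have h1 := sum_part (fun a => LinearMap.mulLeft ℂ (eps (n := n) a))
    (fun a => extOp (D (realBasis n a))) Complex.I
  change _ = ∑ a, ((1 / 2 : ℂ) • (eps a + Complex.I • lin (cplx (matJ n)) eps a)) * _
  rw [alternatizeUncurryFin_eq_sum]
  change extOpL (p + 1) _ = _
  rw [map_sum]
  change ∑ a, extOp (epsAlt a _) = _
  simp only [extOp_epsAlt, antiPart_realBasis]
  have h2 : ∀ a, extOp ((1 / 2 : ℂ) • (D (realBasis n a) +
      Complex.I • ∑ c, ((matJ n c a : ℝ) : ℂ) • D (realBasis n c))) = (1 / 2 : ℂ) •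
      (extOp (D (realBasis n a)) + Complex.I • ∑ c, ((matJ n c a : ℝ) : ℂ) •
        extOp (D (realBasis n c))) := by
    intro a
    change extOpL p _ = (1 / 2 : ℂ) • (extOpL p _ + Complex.I • ∑ c, ((matJ n c a : ℝ) : ℂ) •
        extOpL p _)
    simp only [map_smul, map_add, map_sum]
  simp only [h2]
  refine h1.trans (Finset.sum_congr rfl fun a _ => ?_)
  simp only [lin, LinearMap.smul_apply, LinearMap.add_apply, LinearMap.sum_apply,
    LinearMap.mulLeft_apply, smul_mul_assoc, add_mul, Finset.sum_mul]

lemma extOp_linPart {p : ℕ} (D : Cn n →L[ℝ] Alt n p) :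
    extOp (alternatizeUncurryFin (linPart D)) =
      ∑ a, part10 (cplx (matJ n)) eps a * extOp (D (realBasis n a)) := by
  have h1 := sum_part (fun a => LinearMap.mulLeft ℂ (eps (n := n) a))
    (fun a => extOp (D (realBasis n a))) (-Complex.I)
  simp only [part10_eq]
  rw [alternatizeUncurryFin_eq_sum]
  change extOpL (p + 1) _ = _
  rw [map_sum]
  change ∑ a, extOp (epsAlt a _) = _
  simp only [extOp_epsAlt, linPart_realBasis]
  have h2 : ∀ a, extOp ((1 / 2 : ℂ) • (D (realBasis n a) +
      (-Complex.I) • ∑ c, ((matJ n c a : ℝ) : ℂ) • D (realBasis n c))) = (1 / 2 : ℂ) •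
      (extOp (D (realBasis n a)) + (-Complex.I) • ∑ c, ((matJ n c a : ℝ) : ℂ) •
        extOp (D (realBasis n c))) := by
    intro a
    change extOpL p _ = (1 / 2 : ℂ) • (extOpL p _ + (-Complex.I) • ∑ c, ((matJ n c a : ℝ) : ℂ) •
        extOpL p _)
    simp only [map_smul, map_add, map_sum]
  simp only [h2]
  refine h1.trans (Finset.sum_congr rfl fun a _ => ?_)
  simp only [lin, LinearMap.smul_apply, LinearMap.add_apply, LinearMap.sum_apply,
    LinearMap.mulLeft_apply, smul_mul_assoc, add_mul, Finset.sum_mul]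

section torsion

variable {η : Alt n 2} {D : Cn n →L[ℝ] Alt n 2}

/-- The adjoint of the exterior multiplication by `∂̄ω`, in terms of the first order jet. -/
lemma contrOp_antiPart (h : IsHerm η) :
    contrOp (gramInv η) (alternatizeUncurryFin (antiPart D)) =
      ∑ a, contrOp (gramInv η) (D (realBasis n a)) *
        part10 (cplx (matJ n)) (epsAdj (gramInv η)) a := by
  refine IsFibAdj.unique h.posDef_inv (isFibAdj_extOp _ _) ?_
  rw [extOp_antiPart]
  exact IsFibAdj.sum fun a _ => (isFibAdj_part01 (matJ n) (isFibAdj_eps _) a).mul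
    (isFibAdj_extOp _ _)

lemma contrOp_linPart (h : IsHerm η) :
    contrOp (gramInv η) (alternatizeUncurryFin (linPart D)) =
      ∑ a, contrOp (gramInv η) (D (realBasis n a)) *
        part01 (cplx (matJ n)) (epsAdj (gramInv η)) a := by
  refine IsFibAdj.unique h.posDef_inv (isFibAdj_extOp _ _) ?_
  rw [extOp_linPart]
  exact IsFibAdj.sum fun a _ => (isFibAdj_part10 (matJ n) (isFibAdj_eps _) a).mul
    (isFibAdj_extOp _ _)

/-- The identity `[Λ, τ̄] = 2 i τ*`. -/
lemma Lam_comm_torsion (h : IsHerm η) (hD : ∀ a, IsReal11 (D (realBasis n a))) :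
    let Lam := contrOp (gramInv η) η
    let L : FibOp n := extOp η
    let N : FibOp n := extOp (alternatizeUncurryFin (antiPart D))
    let S := contrOp (gramInv η) (alternatizeUncurryFin (linPart D))
    Lam * (Lam * N - N * Lam) - (Lam * N - N * Lam) * Lam
      = (2 * Complex.I) • (S * L - L * S) := by
  intro Lam L N S
  simp only [N, S]
  rw [extOp_antiPart, contrOp_linPart h]
  simp only [Finset.mul_sum, Finset.sum_mul, ← Finset.sum_sub_distrib, Finset.smul_sum]
  exact Finset.sum_congr rfl fun a _ => (h.jetOps (hD a) a).Lam_comm_torsion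

/-- The identity `[L, τ̄] = 3 ∂̄ω`. -/
lemma L_comm_torsion (h : IsHerm η) (hD : ∀ a, IsReal11 (D (realBasis n a))) :
    let Lam := contrOp (gramInv η) η
    let L : FibOp n := extOp η
    let N : FibOp n := extOp (alternatizeUncurryFin (antiPart D))
    L * (Lam * N - N * Lam) - (Lam * N - N * Lam) * L = 3 * N := by
  intro Lam L N
  simp only [N]
  rw [extOp_antiPart]
  simp only [Finset.mul_sum, Finset.sum_mul, ← Finset.sum_sub_distrib]
  exact Finset.sum_congr rfl fun a _ => (h.jetOps (hD a) a).L_comm_torsion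

end torsion

end HermitianForms
end

noncomputable section

namespace HermitianForms

variable {n : ℕ}

/-! ### Calculus of matrices and of the inner products -/

/-- Jacobi's formula for the derivative of a determinant. -/
lemma hasDerivAt_det {I : Type*} [Fintype I] [DecidableEq I] {A : ℝ → Matrix I I ℝ}
    {A' : Matrix I I ℝ} {t : ℝ} (h : ∀ a b, HasDerivAt (fun s => A s a b) (A' a b) t) :
    HasDerivAt (fun s => (A s).det) ((A t).adjugate * A').trace t := by
  simp only [Matrix.det_apply']
  have h1 : ∀ σ : Equiv.Perm I, HasDerivAt (fun s => ((Equiv.Perm.sign σ : ℤ) : ℝ) *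
      ∏ i, A s (σ i) i) (((Equiv.Perm.sign σ : ℤ) : ℝ) *
        ∑ i, (∏ j ∈ Finset.univ.erase i, A t (σ j) j) * A' (σ i) i) t := by
    intro σ
    refine HasDerivAt.const_mul _ ?_
    have := HasDerivAt.fun_finsetProd (u := Finset.univ) fun i _ => h (σ i) i
    simpa only [smul_eq_mul] using this
  refine (HasDerivAt.fun_sum fun σ _ => h1 σ).congr_deriv ?_
  have h2 : ((A t).adjugate * A').trace = ∑ i, ((A t).updateCol i (fun j => A' j i)).det := by
    simp only [Matrix.trace, Matrix.diag, Matrix.mul_apply]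
    refine Finset.sum_congr rfl fun i _ => ?_
    rw [← Matrix.cramer_apply, Matrix.cramer_eq_adjugate_mulVec]
    rfl
  rw [h2]
  simp only [Matrix.det_apply', Finset.mul_sum]
  rw [Finset.sum_comm]
  refine Finset.sum_congr rfl fun i _ => Finset.sum_congr rfl fun σ _ => ?_
  congr 1
  rw [← Finset.mul_prod_erase Finset.univ _ (Finset.mem_univ i), mul_comm]
  congr 1
  · simp
  · refine Finset.prod_congr rfl fun j hj => ?_
    rw [Matrix.updateCol_ne (Finset.ne_of_mem_erase hj)]

lemma contDiffOn_det {E I : Type*} [NormedAddCommGroup E] [NormedSpace ℝ E] [Fintype I]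
    [DecidableEq I] {A : E → Matrix I I ℝ} {U : Set E}
    (h : ∀ a b, ContDiffOn ℝ ∞ (fun y => A y a b) U) :
    ContDiffOn ℝ ∞ (fun y => (A y).det) U := by
  simp only [Matrix.det_apply']
  exact ContDiffOn.sum fun σ _ => contDiffOn_const.mul (contDiffOn_prod fun i _ => h _ _)

lemma contDiffOn_inv_apply {E I : Type*} [NormedAddCommGroup E] [NormedSpace ℝ E] [Fintype I]
    [DecidableEq I] {A : E → Matrix I I ℝ} {U : Set E}
    (h : ∀ a b, ContDiffOn ℝ ∞ (fun y => A y a b) U) (hdet : ∀ y ∈ U, (A y).det ≠ 0)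
    (a b : I) : ContDiffOn ℝ ∞ (fun y => (A y)⁻¹ a b) U := by
  simp only [Matrix.inv_def, Ring.inverse_eq_inv', Matrix.smul_apply, smul_eq_mul,
    Matrix.adjugate_apply]
  refine ((contDiffOn_det h).inv hdet).mul (contDiffOn_det fun c d => ?_)
  simp only [Matrix.updateRow_apply]
  split_ifs
  · exact contDiffOn_const
  · exact h c d

/-- The derivative of the inverse of a matrix, given its differentiability. -/
lemma deriv_inv_eq {I : Type*} [Fintype I] [DecidableEq I] {A : ℝ → Matrix I I ℝ}
    {A' B' : Matrix I I ℝ} {t : ℝ} (h : ∀ a b, HasDerivAt (fun s => A s a b) (A' a b) t)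
    (hB : ∀ a b, HasDerivAt (fun s => (A s)⁻¹ a b) (B' a b) t)
    (hdet : ∀ᶠ s in nhds t, (A s).det ≠ 0) :
    B' = -((A t)⁻¹ * A' * (A t)⁻¹) := by
  have h1 : B' * A t + (A t)⁻¹ * A' = 0 := by
    ext a b
    have h2 : HasDerivAt (fun s => ((A s)⁻¹ * A s) a b) ((B' * A t + (A t)⁻¹ * A') a b) t := by
      simp only [Matrix.mul_apply, Matrix.add_apply, ← Finset.sum_add_distrib]
      exact HasDerivAt.fun_sum fun c _ => (hB a c).mul (h c b)
    have h3 : (fun s => ((A s)⁻¹ * A s) a b) =ᶠ[nhds t] fun _ => (1 : Matrix I I ℝ) a b := by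
      filter_upwards [hdet] with s hs
      rw [Matrix.nonsing_inv_mul _ (isUnit_iff_ne_zero.mpr hs)]
    exact h2.unique ((hasDerivAt_const t _).congr_of_eventuallyEq h3)
  have h4 : A t * (A t)⁻¹ = 1 :=
    Matrix.mul_nonsing_inv _ (isUnit_iff_ne_zero.mpr hdet.self_of_nhds)
  have h5 : B' * A t * (A t)⁻¹ = -((A t)⁻¹ * A') * (A t)⁻¹ := by
    rw [eq_neg_of_add_eq_zero_left h1]
  rwa [Matrix.mul_assoc, h4, Matrix.mul_one, Matrix.neg_mul] at h5

/-- `iotaAlt` as a continuous linear map. -/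
def iotaCLM (a : Idx n) {k : ℕ} : Alt n (k + 1) →L[ℝ] Alt n k :=
  (ContinuousLinearMap.apply ℝ (Alt n k) (realBasis n a)) ∘L
    (ContinuousAlternatingMap.curryLeftLI (𝕜 := ℝ) (E := Cn n) (F := ℂ)).toContinuousLinearMap

/-- `epsAlt` as a continuous linear map. -/
def epsCLM (a : Idx n) {k : ℕ} : Alt n k →L[ℝ] Alt n (k + 1) :=
  (ContinuousAlternatingMap.alternatizeUncurryFinCLM ℝ (Cn n) ℂ) ∘L
    (ContinuousLinearMap.smulRightL ℝ (Cn n) (Alt n k) (coord a))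

/-- Evaluation of a form as a continuous linear map. -/
def evalCLM {k : ℕ} (v : Fin k → Cn n) : Alt n k →L[ℝ] ℂ :=
  ContinuousMultilinearMap.apply ℝ (fun _ : Fin k => Cn n) ℂ v ∘L
    ContinuousAlternatingMap.toContinuousMultilinearMapCLM ℝ

/-- The derivation of the exterior algebra with matrix `M`, on `k`-forms. -/
def derAlt (M : Matrix (Idx n) (Idx n) ℝ) : {k : ℕ} → Alt n k → Alt n k
  | 0, _ => 0
  | _ + 1, u => ∑ c, ∑ d, (M c d : ℂ) • epsAlt c (iotaAlt d u)

lemma iotaAlt_derAlt (M : Matrix (Idx n) (Idx n) ℝ) {k : ℕ} (u : Alt n (k + 1)) (c : Idx n) :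
    iotaAlt c (derAlt M u) = derAlt M (iotaAlt c u) + ∑ d, (M c d : ℂ) • iotaAlt d u := by
  have h0 : ∑ e, ∑ d, (M e d : ℂ) • (if e = c then (1 : ℂ) else 0) • iotaAlt d u
      = ∑ d, (M c d : ℂ) • iotaAlt d u := by
    rw [Finset.sum_eq_single c]
    · simp only [if_true, one_smul]
    · intro e _ he
      exact Finset.sum_eq_zero fun d _ => by
        rw [if_neg he, zero_smul ℂ (iotaAlt d u)]; exact smul_zero (M := ℂ) (A := Alt n k) _
    · simp
  rcases k with _ | k
  · simp only [derAlt, map_sum, map_smul, iotaAlt_epsAlt_zero]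
    exact h0.trans (zero_add _).symm
  · simp only [derAlt, map_sum, map_smul, iotaAlt_epsAlt, smul_sub, Finset.sum_sub_distrib]
    rw [h0]
    simp only [iotaAlt_iotaAlt c, map_neg, smul_neg, Finset.sum_neg_distrib, sub_neg_eq_add]
    exact add_comm _ _

/-- The derivative of the inner product of `k`-forms along a curve of metrics. -/
lemma hasDerivAt_altInner {G : ℝ → Matrix (Idx n) (Idx n) ℝ} {G' M : Matrix (Idx n) (Idx n) ℝ}
    {t : ℝ} (hG : ∀ a b, HasDerivAt (fun s => G s a b) (G' a b) t) (hM : M.transpose * G t = G')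
    {k : ℕ} {p q : ℝ → Alt n k} {p' q' : Alt n k} (hp : HasDerivAt p p' t)
    (hq : HasDerivAt q q' t) :
    HasDerivAt (fun s => altInner (G s) (p s) (q s))
      (altInner (G t) (derAlt M (p t)) (q t) + altInner (G t) p' (q t)
        + altInner (G t) (p t) q') t := by
  induction k with
  | zero =>
    simp only [altInner_zero_degree]
    have h1 : HasDerivAt (fun s => p s ![]) (p' ![]) t :=
      (evalCLM ![]).hasFDerivAt.comp_hasDerivAt t hp
    have h2 : HasDerivAt (fun s => (starRingEnd ℂ) (q s ![])) ((starRingEnd ℂ) (q' ![])) t :=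
      (Complex.conjCLE : ℂ →L[ℝ] ℂ).hasFDerivAt.comp_hasDerivAt t
        ((evalCLM ![]).hasFDerivAt.comp_hasDerivAt t hq)
    refine (h1.mul h2).congr_deriv ?_
    simp [derAlt]
  | succ k ih =>
    simp only [altInner_succ]
    have h1 : ∀ c d, HasDerivAt (fun s => ((G s c d : ℝ) : ℂ) *
        altInner (G s) (iotaAlt c (p s)) (iotaAlt d (q s)))
        (((G' c d : ℝ) : ℂ) * altInner (G t) (iotaAlt c (p t)) (iotaAlt d (q t)) +
          ((G t c d : ℝ) : ℂ) * (altInner (G t) (derAlt M (iotaAlt c (p t))) (iotaAlt d (q t)) +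
            altInner (G t) (iotaAlt c p') (iotaAlt d (q t)) +
            altInner (G t) (iotaAlt c (p t)) (iotaAlt d q'))) t := by
      intro c d
      exact (hG c d).ofReal_comp.mul (ih ((iotaCLM c).hasFDerivAt.comp_hasDerivAt t hp)
        ((iotaCLM d).hasFDerivAt.comp_hasDerivAt t hq))
    refine (HasDerivAt.const_mul _ (HasDerivAt.fun_sum fun c _ =>
      HasDerivAt.fun_sum fun d _ => h1 c d)).congr_deriv ?_
    rw [← mul_add, ← mul_add]
    congr 1
    -- the derivative of `G` is absorbed by the commutator of the derivation with contractions
    have h2 : ∑ c, ∑ d, ((G t c d : ℝ) : ℂ) *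
        altInner (G t) (∑ e, (M c e : ℂ) • iotaAlt e (p t)) (iotaAlt d (q t)) =
        ∑ c, ∑ d, ((G' c d : ℝ) : ℂ) * altInner (G t) (iotaAlt c (p t)) (iotaAlt d (q t)) := by
      have h3 : ∀ c d, altInner (G t) (∑ e, (M c e : ℂ) • iotaAlt e (p t)) (iotaAlt d (q t)) =
          ∑ e, (M c e : ℂ) * altInner (G t) (iotaAlt e (p t)) (iotaAlt d (q t)) := by
        intro c d
        change altInnerL (G t) k _ _ = ∑ e, (M c e : ℂ) * altInnerL (G t) k _ _
        simp only [map_sum, map_smul, LinearMap.sum_apply, LinearMap.smul_apply, smul_eq_mul]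
      simp only [h3, ← hM, Matrix.mul_apply, Matrix.transpose_apply, Complex.ofReal_sum,
        Complex.ofReal_mul, Finset.sum_mul, Finset.mul_sum]
      calc _ = ∑ c, ∑ e, ∑ d, _ := Finset.sum_congr rfl fun c _ => Finset.sum_comm
        _ = ∑ e, ∑ c, ∑ d, _ := Finset.sum_comm
        _ = ∑ e, ∑ d, ∑ c, _ := Finset.sum_congr rfl fun c _ => Finset.sum_comm
        _ = _ := Finset.sum_congr rfl fun e _ => Finset.sum_congr rfl fun d _ =>
          Finset.sum_congr rfl fun c _ => by ring
    simp only [iotaAlt_derAlt, altInner_add_left, mul_add, Finset.sum_add_distrib, h2]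
    ring

lemma quad_eps_iota_apply (N : Matrix (Idx n) (Idx n) ℝ) (u : Fib n) (k : ℕ) :
    (quad (cplx N) eps iota : FibOp n) u k = derAlt N (u k) := by
  simp only [quad, LinearMap.sum_apply, Finset.sum_apply, LinearMap.smul_apply, Pi.smul_apply,
    Module.End.mul_apply]
  rcases k with _ | k
  · exact Finset.sum_eq_zero fun a _ => Finset.sum_eq_zero fun b _ =>
      smul_zero (M := ℂ) (A := Alt n 0) _
  · rfl

lemma varOp_apply {η' : Alt n 2} (h' : IsReal11 η') (G : Matrix (Idx n) (Idx n) ℝ)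
    (u : Fib n) (k : ℕ) :
    varOp G η' u k = ((1 / 2 * (gram η' * G).trace : ℝ) : ℂ) • u k
      + derAlt (-(gram η' * G)) (u k) := by
  have hP : cplx (mat η') * cplx (matJ n) = cplx (gram η') := by
    rw [gram_eq, ← Matrix.map_mul]
  have h1 : (quad (cplx (gram η')) (epsAdj G) eps : FibOp n) =
      (((gram η' * G).trace : ℝ) : ℂ) • 1 - quad (cplx (gram η')) eps (epsAdj G) := by
    have hs : ∀ a b, gram η' a b = gram η' b a := fun a b =>
      congrFun (congrFun h'.gram_transpose b) a
    simp only [quad, epsAdj_mul_eps, smul_sub, Finset.sum_sub_distrib, smul_smul,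
      ← Finset.sum_smul]
    congr 1
    · congr 1
      simp only [Matrix.trace, Matrix.diag, Matrix.mul_apply, Complex.ofReal_sum,
        Complex.ofReal_mul]
      rw [Finset.sum_comm]
      refine Finset.sum_congr rfl fun a _ => Finset.sum_congr rfl fun b _ => ?_
      rw [hs a b]; rfl
    · rw [Finset.sum_comm]
      refine Finset.sum_congr rfl fun a _ => Finset.sum_congr rfl fun b _ => ?_
      simp only [Matrix.map_apply, hs a b]
  have h2 : (epsAdj G : Idx n → FibOp n) = lin (cplx G) iota := rfl
  have h3 : (quad (cplx (gram η')) eps (epsAdj G) : FibOp n) =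
      quad (cplx (gram η' * G)) eps iota := by
    rw [h2, quad_lin_right, ← Matrix.map_mul]
  have h4 : varOp G η' = ((1 / 2 * (gram η' * G).trace : ℝ) : ℂ) • 1
      + quad (cplx (-(gram η' * G))) eps iota := by
    have h5 : cplx (-(gram η' * G)) = - cplx (gram η' * G) := by
      ext a b; simp only [Matrix.map_apply, Matrix.neg_apply, map_neg]
    rw [varOp, hP, h1, h3, h5, quad_neg, Complex.ofReal_mul]
    push_cast
    module
  rw [h4, LinearMap.add_apply, Pi.add_apply, quad_eps_iota_apply]
  rfl

/-- The volume density of a metric in the chart. -/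
def density (η : Alt n 2) : ℝ := Real.sqrt (gram η).det

lemma hasDerivAt_gram {η : ℝ → Alt n 2} {η' : Alt n 2} {t : ℝ} (h : HasDerivAt η η' t)
    (a b : Idx n) : HasDerivAt (fun s => gram (η s) a b) (gram η' a b) t :=
  (Complex.reCLM ∘L evalCLM ![realBasis n a, mulI n (realBasis n b)]).hasFDerivAt.comp_hasDerivAt
    t h

/-- The first variation of the volume-weighted inner product along a curve of metrics. -/
lemma hasDerivAt_density_mul_fibInner {η : ℝ → Alt n 2} {η' : Alt n 2} {t : ℝ}
    (hη : HasDerivAt η η' t) (hH : ∀ᶠ s in nhds t, IsHerm (η s)) (h' : IsReal11 η')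
    {p q : ℝ → Fib n} {p' q' : Fib n} (hp : ∀ k, HasDerivAt (fun s => p s k) (p' k) t)
    (hq : ∀ k, HasDerivAt (fun s => q s k) (q' k) t) :
    HasDerivAt (fun s => (density (η s) : ℂ) * fibInner (gramInv (η s)) (p s) (q s))
      (density (η t) * (fibInner (gramInv (η t)) (varOp (gramInv (η t)) η' (p t)) (q t)
        + fibInner (gramInv (η t)) p' (q t) + fibInner (gramInv (η t)) (p t) q')) t := by
  have hg := hasDerivAt_gram hη
  have hHt : IsHerm (η t) := hH.self_of_nhds
  have hdet : ∀ᶠ s in nhds t, (gram (η s)).det ≠ 0 := hH.mono fun s hs => hs.posDef.det_pos.ne'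
  have hpos := hHt.posDef.det_pos
  obtain ⟨B', hB⟩ : ∃ B' : Matrix (Idx n) (Idx n) ℝ,
      ∀ a b, HasDerivAt (fun s => gramInv (η s) a b) (B' a b) t := by
    have : ∀ a b, ∃ c, HasDerivAt (fun s => gramInv (η s) a b) c t := by
      intro a b
      simp only [gramInv, Matrix.inv_def, Ring.inverse_eq_inv', Matrix.smul_apply, smul_eq_mul,
        Matrix.adjugate_apply]
      refine ⟨_, ((hasDerivAt_det hg).inv hpos.ne').mul (hasDerivAt_det (A' := Matrix.of
        fun c d => if c = b then 0 else gram η' c d) fun c d => ?_)⟩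
      simp only [Matrix.updateRow_apply, Matrix.of_apply]
      split_ifs
      · exact hasDerivAt_const _ _
      · exact hg c d
    choose B' hB using this
    exact ⟨Matrix.of B', hB⟩
  have hBe := deriv_inv_eq hg hB hdet
  have hM : (-(gram η' * gramInv (η t))).transpose * gramInv (η t) = B' := by
    rw [Matrix.transpose_neg, Matrix.transpose_mul, hHt.gramInv_transpose, h'.gram_transpose, hBe,
      Matrix.neg_mul]
  have hρ : HasDerivAt (fun s => density (η s))
      (density (η t) * (1 / 2 * (gram η' * gramInv (η t)).trace)) t := by
    refine ((hasDerivAt_det hg).sqrt hpos.ne').congr_deriv ?_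
    have h1 : ((gram (η t)).adjugate * gram η').trace
        = (gram (η t)).det * (gram η' * gramInv (η t)).trace := by
      rw [gramInv, Matrix.inv_def, Ring.inverse_eq_inv', Matrix.mul_smul, Matrix.trace_smul,
        smul_eq_mul, ← mul_assoc, mul_inv_cancel₀ hpos.ne', one_mul, Matrix.trace_mul_comm]
    have h2 : density (η t) * density (η t) = (gram (η t)).det := Real.mul_self_sqrt hpos.le
    have h3 : density (η t) ≠ 0 := (Real.sqrt_pos.mpr hpos).ne'
    have h4 : Real.sqrt (density (η t) * density (η t)) = density (η t) :=
      Real.sqrt_mul_self (Real.sqrt_nonneg _)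
    rw [h1, ← h2, h4]
    field_simp
  have hI : HasDerivAt (fun s => fibInner (gramInv (η s)) (p s) (q s))
      (∑ k ∈ Finset.range (2 * n + 1),
        (altInner (gramInv (η t)) (derAlt (-(gram η' * gramInv (η t))) (p t k)) (q t k)
          + altInner (gramInv (η t)) (p' k) (q t k)
          + altInner (gramInv (η t)) (p t k) (q' k))) t := by
    simp only [fibInner_apply]
    exact HasDerivAt.fun_sum fun k _ => hasDerivAt_altInner hB hM (hp k) (hq k)
  refine (hρ.ofReal_comp.mul hI).congr_deriv ?_
  simp only [fibInner_apply, varOp_apply h', altInner_add_left, altInner_smul_left,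
    Finset.sum_add_distrib, ← Finset.mul_sum]
  push_cast
  ring

end HermitianForms
end

noncomputable section

namespace HermitianForms

variable {n : ℕ}

/-! ### Pullback by complex linear isomorphisms -/

/-- Pullback of forms of mixed degree by a linear map. -/
def pull (φ : Cn n →L[ℝ] Cn n) : Fib n →ₗ[ℂ] Fib n where
  toFun u k := (u k).compContinuousLinearMap φ
  map_add' u v := by ext; rfl
  map_smul' c u := by ext; rfl

lemma pull_apply (φ : Cn n →L[ℝ] Cn n) (u : Fib n) (k : ℕ) :
    pull φ u k = (u k).compContinuousLinearMap φ := rfl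

lemma pull_comp (φ ψ : Cn n →L[ℝ] Cn n) (u : Fib n) :
    pull ψ (pull φ u) = pull (φ ∘L ψ) u := rfl

lemma pull_id (u : Fib n) : pull (ContinuousLinearMap.id ℝ (Cn n)) u = u := rfl

lemma wedge_comp {p q m : ℕ} (h : p + q = m) (α : Alt n p) (β : Alt n q) (φ : Cn n →L[ℝ] Cn n) :
    wedge h (α.compContinuousLinearMap φ) (β.compContinuousLinearMap φ)
      = (wedge h α β).compContinuousLinearMap φ := by
  ext v
  rw [ContinuousAlternatingMap.compContinuousLinearMap_apply, wedge_apply, wedge_apply]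
  rfl

lemma pull_extOp (φ : Cn n →L[ℝ] Cn n) {p : ℕ} (η : Alt n p) (u : Fib n) :
    pull φ (extOp η u) = extOp (η.compContinuousLinearMap φ) (pull φ u) := by
  ext1 m
  by_cases h : p ≤ m
  · rw [pull_apply, extOp_apply (Nat.add_sub_of_le h), extOp_apply (Nat.add_sub_of_le h),
      pull_apply, wedge_comp]
  · rw [pull_apply, extOp_apply_of_lt _ _ (not_le.mp h), extOp_apply_of_lt _ _ (not_le.mp h)]
    rfl

/-- `φ` is a complex linear isomorphism with inverse `ψ`. -/
structure IsCIso (φ ψ : Cn n →L[ℝ] Cn n) : Prop where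
  comm : ∀ v, φ (mulI n v) = mulI n (φ v)
  left : ψ ∘L φ = ContinuousLinearMap.id ℝ (Cn n)
  right : φ ∘L ψ = ContinuousLinearMap.id ℝ (Cn n)

/-- The matrix of a real linear map in the real basis. -/
def linMat (φ : Cn n →L[ℝ] Cn n) : Matrix (Idx n) (Idx n) ℝ :=
  Matrix.of fun c a => coord c (φ (realBasis n a))

lemma map_realBasis (φ : Cn n →L[ℝ] Cn n) (a : Idx n) :
    φ (realBasis n a) = ∑ c, linMat φ c a • realBasis n c :=
  (sum_coord_smul_realBasis _).symm

/-- `realBasis` as a basis of the real vector space `ℂⁿ`. -/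
def realBasisB (n : ℕ) : Module.Basis (Idx n) ℝ (Cn n) :=
  Module.Basis.ofEquivFun
    { toFun := fun v a => coord a v
      map_add' := fun v w => by ext a; simp
      map_smul' := fun c v => by ext a; simp
      invFun := fun x => ∑ a, x a • realBasis n a
      left_inv := fun v => sum_coord_smul_realBasis v
      right_inv := fun x => by
        funext b
        simp only [map_sum, map_smul, coord_realBasis, smul_eq_mul, mul_ite, mul_one, mul_zero]
        simp only [Finset.sum_ite_eq, Finset.mem_univ, if_true] }

lemma realBasisB_apply (a : Idx n) : realBasisB n a = realBasis n a := by
  rw [realBasisB, Module.Basis.coe_ofEquivFun]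
  change ∑ b, (Pi.single a (1 : ℝ) : Idx n → ℝ) b • realBasis n b = _
  rw [Finset.sum_eq_single a]
  · simp
  · intro b _ hb; simp [hb]
  · simp

lemma det_linMat (φ : Cn n →L[ℝ] Cn n) : (linMat φ).det = φ.det := by
  rw [ContinuousLinearMap.det, ← LinearMap.det_toMatrix (realBasisB n)]
  congr 1
  ext c a
  rw [LinearMap.toMatrix_apply, realBasisB_apply]
  rfl

lemma linMat_comp (φ ψ : Cn n →L[ℝ] Cn n) : linMat (φ ∘L ψ) = linMat φ * linMat ψ := by
  ext c a
  simp only [linMat, Matrix.of_apply, Matrix.mul_apply, ContinuousLinearMap.comp_apply]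
  conv_lhs => rw [← sum_coord_smul_realBasis (ψ (realBasis n a))]
  simp only [map_sum, map_smul, smul_eq_mul]
  exact Finset.sum_congr rfl fun _ _ => mul_comm _ _

lemma linMat_id : linMat (ContinuousLinearMap.id ℝ (Cn n)) = 1 := by
  ext c a
  simp [linMat, coord_realBasis, Matrix.one_apply]

lemma gram_comp (η : Alt n 2) {φ : Cn n →L[ℝ] Cn n} (h : ∀ v, φ (mulI n v) = mulI n (φ v)) :
    gram (η.compContinuousLinearMap φ) = (linMat φ).transpose * gram η * linMat φ := by
  ext a b
  have h1 : gram (η.compContinuousLinearMap φ) a b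
      = (η ![φ (realBasis n a), mulI n (φ (realBasis n b))]).re := by
    rw [← h]
    simp only [gram, Matrix.of_apply, ContinuousAlternatingMap.compContinuousLinearMap_apply]
    congr 2
    funext i; fin_cases i <;> rfl
  rw [h1, map_realBasis φ a, map_realBasis φ b]
  simp only [map_sum, map_smul, alt_two_sum_left, alt_two_sum_right, Complex.re_sum,
    Complex.re_ofReal_mul, Matrix.mul_apply, Matrix.transpose_apply, gram, Matrix.of_apply,
    Finset.sum_mul, Finset.mul_sum]
  exact Finset.sum_congr rfl fun c _ => Finset.sum_congr rfl fun d _ => by ring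

lemma IsReal11.comp {η : Alt n 2} (hη : IsReal11 η) {φ : Cn n →L[ℝ] Cn n}
    (h : ∀ v, φ (mulI n v) = mulI n (φ v)) : IsReal11 (η.compContinuousLinearMap φ) := by
  have e : ∀ v w, η.compContinuousLinearMap φ ![v, w] = η ![φ v, φ w] := by
    intro v w
    rw [ContinuousAlternatingMap.compContinuousLinearMap_apply]
    congr 1; funext i; fin_cases i <;> rfl
  exact ⟨fun v w => by rw [e, hη.real], fun v w => by rw [e, e, h, h, hη.type_one_one]⟩

lemma IsHerm.comp {η : Alt n 2} (hη : IsHerm η) {φ ψ : Cn n →L[ℝ] Cn n}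
    (h : IsCIso φ ψ) : IsHerm (η.compContinuousLinearMap φ) := by
  refine ⟨hη.toIsReal11.comp h.comm, fun v hv => ?_⟩
  have e : ∀ v w, η.compContinuousLinearMap φ ![v, w] = η ![φ v, φ w] := by
    intro v w
    rw [ContinuousAlternatingMap.compContinuousLinearMap_apply]
    congr 1; funext i; fin_cases i <;> rfl
  rw [e, h.comm]
  refine hη.pos _ fun h0 => hv ?_
  have := congrArg ψ h0
  rw [map_zero, ← ContinuousLinearMap.comp_apply, h.left] at this
  exact this

section

variable {φ ψ : Cn n →L[ℝ] Cn n} (h : IsCIso φ ψ) {η : Alt n 2}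

lemma IsCIso.linMat_mul (h : IsCIso φ ψ) : linMat φ * linMat ψ = 1 := by
  rw [← linMat_comp, h.right, linMat_id]

lemma IsCIso.gramInv_comp (h : IsCIso φ ψ) (η : Alt n 2) :
    linMat φ * gramInv (η.compContinuousLinearMap φ) * (linMat φ).transpose = gramInv η := by
  have h1 := h.linMat_mul
  have h2 : (linMat ψ).transpose * (linMat φ).transpose = 1 := by
    rw [← Matrix.transpose_mul, h1, Matrix.transpose_one]
  rw [gramInv, gram_comp η h.comm, Matrix.mul_inv_rev, Matrix.mul_inv_rev,
    Matrix.inv_eq_left_inv h2, Matrix.inv_eq_right_inv h1]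
  rw [← Matrix.mul_assoc, h1, Matrix.one_mul, Matrix.mul_assoc, h2, Matrix.mul_one]

lemma iotaAlt_comp (φ : Cn n →L[ℝ] Cn n) {k : ℕ} (α : Alt n (k + 1)) (c : Idx n) :
    iotaAlt c (α.compContinuousLinearMap φ)
      = ∑ e, (linMat φ e c : ℂ) • (iotaAlt e α).compContinuousLinearMap φ := by
  have h1 : iotaAlt c (α.compContinuousLinearMap φ)
      = (α.curryLeft (φ (realBasis n c))).compContinuousLinearMap φ := by
    ext v
    rw [iotaAlt_apply, ContinuousAlternatingMap.compContinuousLinearMap_apply,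
      ContinuousAlternatingMap.compContinuousLinearMap_apply,
      ContinuousAlternatingMap.curryLeft_apply_apply]
    congr 1
    funext i
    refine Fin.cases ?_ (fun i => ?_) i <;> simp
  rw [h1, map_realBasis, map_sum]
  ext v
  simp only [map_smul, ContinuousAlternatingMap.compContinuousLinearMap_apply,
    ContinuousAlternatingMap.sum_apply, ContinuousAlternatingMap.smul_apply]
  rfl

lemma altInner_comp (h : IsCIso φ ψ) (η : Alt n 2) {k : ℕ} (α β : Alt n k) :
    altInner (gramInv (η.compContinuousLinearMap φ)) (α.compContinuousLinearMap φ)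
      (β.compContinuousLinearMap φ) = altInner (gramInv η) α β := by
  induction k with
  | zero =>
    rw [altInner_zero_degree, altInner_zero_degree]
    simp only [ContinuousAlternatingMap.compContinuousLinearMap_apply]
    have : ((φ : Cn n → Cn n) ∘ ![]) = ![] := Subsingleton.elim _ _
    rw [this]
  | succ k ih =>
    rw [altInner_succ, altInner_succ]
    congr 1
    set G' := gramInv (η.compContinuousLinearMap φ) with hG'
    have h1 : ∀ c d, altInner G' (iotaAlt c (α.compContinuousLinearMap φ))
        (iotaAlt d (β.compContinuousLinearMap φ)) = ∑ e, ∑ f, (linMat φ e c : ℂ) *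
          (linMat φ f d : ℂ) * altInner (gramInv η) (iotaAlt e α) (iotaAlt f β) := by
      intro c d
      rw [iotaAlt_comp, iotaAlt_comp]
      change altInnerL G' k _ _ = _
      simp only [map_sum, map_smul, LinearMap.sum_apply, LinearMap.smul_apply,
        LinearMap.map_smulₛₗ, Complex.conj_ofReal, smul_eq_mul, Finset.mul_sum]
      rw [Finset.sum_comm]
      refine Finset.sum_congr rfl fun e _ => Finset.sum_congr rfl fun f _ => ?_
      change _ * (_ * altInner G' _ _) = _
      rw [ih]; ring
    simp only [h1, ← h.gramInv_comp η, Matrix.mul_apply, Matrix.transpose_apply,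
      Complex.ofReal_sum, Complex.ofReal_mul, Finset.sum_mul, Finset.mul_sum]
    calc _ = ∑ c, ∑ e, ∑ d, ∑ f, _ := Finset.sum_congr rfl fun c _ => Finset.sum_comm
      _ = ∑ e, ∑ c, ∑ d, ∑ f, _ := Finset.sum_comm
      _ = ∑ e, ∑ c, ∑ f, ∑ d, _ := Finset.sum_congr rfl fun e _ =>
          Finset.sum_congr rfl fun c _ => Finset.sum_comm
      _ = ∑ e, ∑ f, ∑ c, ∑ d, _ := Finset.sum_congr rfl fun e _ => Finset.sum_comm
      _ = ∑ e, ∑ f, ∑ d, ∑ c, _ := Finset.sum_congr rfl fun e _ =>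
          Finset.sum_congr rfl fun f _ => Finset.sum_comm
      _ = _ := Finset.sum_congr rfl fun e _ => Finset.sum_congr rfl fun f _ =>
          Finset.sum_congr rfl fun d _ => Finset.sum_congr rfl fun c _ => by ring

lemma fibInner_pull (h : IsCIso φ ψ) (η : Alt n 2) (u v : Fib n) :
    fibInner (gramInv (η.compContinuousLinearMap φ)) (pull φ u) (pull φ v)
      = fibInner (gramInv η) u v := by
  simp only [fibInner_apply, pull_apply, altInner_comp h]

lemma pull_contrOp (h : IsCIso φ ψ) (hη : IsHerm η) {p : ℕ} (ζ : Alt n p) (u : Fib n) :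
    pull φ (contrOp (gramInv η) ζ u)
      = contrOp (gramInv (η.compContinuousLinearMap φ)) (ζ.compContinuousLinearMap φ)
        (pull φ u) := by
  refine eq_of_fibInner_eq (hη.comp h).posDef_inv fun w => ?_
  obtain ⟨w, rfl⟩ : ∃ w', w = pull φ w' := ⟨pull ψ w, by rw [pull_comp, h.left, pull_id]⟩
  rw [fibInner_pull h, ← isFibAdj_extOp, ← isFibAdj_extOp, ← pull_extOp, fibInner_pull h]

lemma density_comp (η : Alt n 2) (h : ∀ v, φ (mulI n v) = mulI n (φ v)) :
    density (η.compContinuousLinearMap φ) = |φ.det| * density η := by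
  rw [density, gram_comp η h, Matrix.det_mul, Matrix.det_mul, Matrix.det_transpose, det_linMat,
    mul_right_comm, Real.sqrt_mul (mul_self_nonneg _), Real.sqrt_mul_self_eq_abs, density]

end

/-! ### The operators `∂` and `∂̄` on open subsets of `ℂⁿ` -/

/-- The operator `u ↦ ∑ₐ (eᵃ ∘ A) ∧ ∂ₐu` on forms on `ℂⁿ`; for `A = id` this is the exterior
derivative and for the complex structure `A = I` its twisted version. -/
def twistedDeriv (A : Cn n →L[ℝ] Cn n) {k : ℕ} (α : Cn n → Alt n k) (y : Cn n) : Alt n (k + 1) :=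
  ContinuousAlternatingMap.alternatizeUncurryFin (fderiv ℝ α y ∘L A)

lemma linPart_eq {k : ℕ} (D : Cn n →L[ℝ] Alt n k) :
    ContinuousAlternatingMap.alternatizeUncurryFin (linPart D) = (1 / 2 : ℂ) •
      (ContinuousAlternatingMap.alternatizeUncurryFin (D ∘L ContinuousLinearMap.id ℝ (Cn n)) +
        (-Complex.I) • ContinuousAlternatingMap.alternatizeUncurryFin (D ∘L mulI n)) := by
  rw [← ContinuousAlternatingMap.alternatizeUncurryFin_smul,
    ← ContinuousAlternatingMap.alternatizeUncurryFin_add,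
    ← ContinuousAlternatingMap.alternatizeUncurryFin_smul]
  congr 1
  ext1 v
  change (1 / 2 : ℂ) • (D v - Complex.I • D (mulI n v)) = (1 / 2 : ℂ) • (D v +
    (-Complex.I) • D (mulI n v))
  module

lemma antiPart_eq {k : ℕ} (D : Cn n →L[ℝ] Alt n k) :
    ContinuousAlternatingMap.alternatizeUncurryFin (antiPart D) = (1 / 2 : ℂ) •
      (ContinuousAlternatingMap.alternatizeUncurryFin (D ∘L ContinuousLinearMap.id ℝ (Cn n)) +
        Complex.I • ContinuousAlternatingMap.alternatizeUncurryFin (D ∘L mulI n)) := by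
  rw [← ContinuousAlternatingMap.alternatizeUncurryFin_smul,
    ← ContinuousAlternatingMap.alternatizeUncurryFin_add,
    ← ContinuousAlternatingMap.alternatizeUncurryFin_smul]
  rfl

/-- The operator `∂` on forms on `ℂⁿ`. -/
def ldel {k : ℕ} (α : Cn n → Alt n k) (y : Cn n) : Alt n (k + 1) :=
  ContinuousAlternatingMap.alternatizeUncurryFin (linPart (fderiv ℝ α y))

/-- The operator `∂̄` on forms on `ℂⁿ`. -/
def ldelbar {k : ℕ} (α : Cn n → Alt n k) (y : Cn n) : Alt n (k + 1) :=
  ContinuousAlternatingMap.alternatizeUncurryFin (antiPart (fderiv ℝ α y))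

/-- The second derivatives of `f` do not contribute to the twisted derivative of a pullback, because
`(v, w) ↦ D²f (A v, w)` is symmetric. -/
lemma twistedDeriv_pullback {A : Cn n →L[ℝ] Cn n} {k : ℕ} {α : Cn n → Alt n k} {f : Cn n → Cn n}
    {y : Cn n} (hα : DifferentiableAt ℝ α (f y)) (hf : ContDiffAt ℝ 2 f y)
    (hA : ∀ v, fderiv ℝ f y (A v) = A (fderiv ℝ f y v))
    (hA2 : ∀ v w, fderiv ℝ (fderiv ℝ f) y (A v) w = fderiv ℝ (fderiv ℝ f) y (A w) v) :
    twistedDeriv A (fun z => (α (f z)).compContinuousLinearMap (fderiv ℝ f z)) y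
      = (twistedDeriv A α (f y)).compContinuousLinearMap (fderiv ℝ f y) := by
  have hdf : DifferentiableAt ℝ f y := hf.differentiableAt (by norm_num)
  have hd2f : DifferentiableAt ℝ (fderiv ℝ f) y :=
    (hf.fderiv_right (m := 1) (by norm_num)).differentiableAt (by norm_num)
  have h1 : DifferentiableAt ℝ (fun z => α (f z)) y := hα.comp y hdf
  have h2 : fderiv ℝ (fun z => α (f z)) y = fderiv ℝ α (f y) ∘L fderiv ℝ f y :=
    fderiv_comp y hα hdf
  rw [twistedDeriv, fderiv_continuousAlternatingMapCompContinuousLinearMap h1 hd2f, h2,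
    ContinuousLinearMap.add_comp, ContinuousAlternatingMap.alternatizeUncurryFin_add,
    ContinuousLinearMap.comp_assoc _ (fderiv ℝ (fderiv ℝ f) y) A,
    ContinuousAlternatingMap.alternatizeUncurryFin_fderivCompContinuousLinearMap_eq_zero, add_zero]
  · ext v
    simp only [ContinuousAlternatingMap.alternatizeUncurryFin_apply, twistedDeriv,
      ContinuousAlternatingMap.compContinuousLinearMap_apply, ContinuousLinearMap.comp_apply, hA]
    rfl
  · intro v w
    simpa using hA2 v w

/-- The real derivative of a holomorphic map commutes with the complex structure. -/
structure IsHolAt (f : Cn n → Cn n) (y : Cn n) : Prop where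
  smooth : ContDiffAt ℝ ∞ f y
  comm : ∀ᶠ z in nhds y, ∀ v, fderiv ℝ f z (mulI n v) = mulI n (fderiv ℝ f z v)

lemma IsHolAt.comm_two {f : Cn n → Cn n} {y : Cn n} (h : IsHolAt f y) (v w : Cn n) :
    fderiv ℝ (fderiv ℝ f) y (mulI n v) w = fderiv ℝ (fderiv ℝ f) y (mulI n w) v := by
  have hs : IsSymmSndFDerivAt ℝ f y := (h.smooth.of_le (m := 2) (by decide)).isSymmSndFDerivAt
    (by simp)
  have hd : DifferentiableAt ℝ (fderiv ℝ f) y :=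
    (h.smooth.fderiv_right (m := 1) (by decide)).differentiableAt (by norm_num)
  have h1 : ∀ v w, fderiv ℝ (fderiv ℝ f) y w (mulI n v)
      = mulI n (fderiv ℝ (fderiv ℝ f) y w v) := by
    intro v w
    have h2 : (fun z => fderiv ℝ f z (mulI n v)) =ᶠ[nhds y] fun z => mulI n (fderiv ℝ f z v) :=
      h.comm.mono fun z hz => hz v
    have h3 := h2.fderiv_eq (𝕜 := ℝ)
    have e1 : HasFDerivAt (fun z => fderiv ℝ f z (mulI n v)) _ y :=
      (ContinuousLinearMap.apply ℝ (Cn n) (mulI n v)).hasFDerivAt.comp y hd.hasFDerivAt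
    have e2 : HasFDerivAt (fun z => mulI n (fderiv ℝ f z v)) _ y :=
      (mulI n).hasFDerivAt.comp y
        ((ContinuousLinearMap.apply ℝ (Cn n) v).hasFDerivAt.comp y hd.hasFDerivAt)
    rw [e1.fderiv, e2.fderiv] at h3
    exact congrArg (fun T => T w) h3
  rw [hs.eq (mulI n v) w, hs.eq (mulI n w) v, h1, h1, hs.eq v w]

lemma ldel_pullback {k : ℕ} {α : Cn n → Alt n k} {f : Cn n → Cn n}
    {y : Cn n} (hα : DifferentiableAt ℝ α (f y)) (hf : IsHolAt f y) :
    ldel (fun z => (α (f z)).compContinuousLinearMap (fderiv ℝ f z)) y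
      = (ldel α (f y)).compContinuousLinearMap (fderiv ℝ f y) := by
  have hs : ContDiffAt ℝ 2 f y := hf.smooth.of_le (by decide)
  have h1 := twistedDeriv_pullback (A := ContinuousLinearMap.id ℝ (Cn n)) hα hs (fun _ => rfl)
    (fun v w => (hs.isSymmSndFDerivAt (by simp)).eq v w)
  have h2 := twistedDeriv_pullback (A := mulI n) hα hs hf.comm.self_of_nhds hf.comm_two
  unfold twistedDeriv at h1 h2
  rw [ldel, ldel, linPart_eq, linPart_eq, h1, h2]
  rfl

lemma ldelbar_pullback {k : ℕ} {α : Cn n → Alt n k} {f : Cn n → Cn n}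
    {y : Cn n} (hα : DifferentiableAt ℝ α (f y)) (hf : IsHolAt f y) :
    ldelbar (fun z => (α (f z)).compContinuousLinearMap (fderiv ℝ f z)) y
      = (ldelbar α (f y)).compContinuousLinearMap (fderiv ℝ f y) := by
  have hs : ContDiffAt ℝ 2 f y := hf.smooth.of_le (by decide)
  have h1 := twistedDeriv_pullback (A := ContinuousLinearMap.id ℝ (Cn n)) hα hs (fun _ => rfl)
    (fun v w => (hs.isSymmSndFDerivAt (by simp)).eq v w)
  have h2 := twistedDeriv_pullback (A := mulI n) hα hs hf.comm.self_of_nhds hf.comm_two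
  unfold twistedDeriv at h1 h2
  rw [ldelbar, ldelbar, antiPart_eq, antiPart_eq, h1, h2]
  rfl

end HermitianForms
end

noncomputable section

namespace HermitianForms

open ContinuousAlternatingMap (alternatizeUncurryFin alternatizeUncurryFinCLM
  alternatizeUncurryFin_add alternatizeUncurryFin_smul alternatizeUncurryFin_apply
  alternatizeUncurryFinCLM_apply)

variable {n : ℕ}

/-! ### The relation `∂∂̄ + ∂̄∂ = 0` -/

lemma differentiableAt_continuousLinearMap_comp {E F G : Type*} [NormedAddCommGroup E]
    [NormedSpace ℝ E] [NormedAddCommGroup F] [NormedSpace ℝ F] [NormedAddCommGroup G]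
    [NormedSpace ℝ G] (T : F →L[ℝ] G) {f : E → F} {y : E} (h : DifferentiableAt ℝ f y) :
    DifferentiableAt ℝ (T ∘ f) y := T.differentiableAt.comp y h

lemma fderiv_continuousLinearMap_comp {E F G : Type*} [NormedAddCommGroup E]
    [NormedSpace ℝ E] [NormedAddCommGroup F] [NormedSpace ℝ F] [NormedAddCommGroup G]
    [NormedSpace ℝ G] (T : F →L[ℝ] G) {f : E → F} {y : E} (h : DifferentiableAt ℝ f y) :
    fderiv ℝ (T ∘ f) y = T ∘L fderiv ℝ f y := (T.hasFDerivAt.comp y h.hasFDerivAt).fderiv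

/-- `twistedDeriv` in terms of the derivative, as a continuous linear map. -/
def twistedCLM (A : Cn n →L[ℝ] Cn n) (k : ℕ) : (Cn n →L[ℝ] Alt n k) →L[ℝ] Alt n (k + 1) :=
  (alternatizeUncurryFinCLM ℝ (Cn n) ℂ) ∘L
    (ContinuousLinearMap.compL ℝ (Cn n) (Cn n) (Alt n k)).flip A

lemma twistedDeriv_eq_comp (A : Cn n →L[ℝ] Cn n) {k : ℕ} (α : Cn n → Alt n k) :
    twistedDeriv A α = twistedCLM A k ∘ fderiv ℝ α := rfl

lemma twistedDeriv_twistedDeriv (A : Cn n →L[ℝ] Cn n) {k : ℕ} {α : Cn n → Alt n k} {y : Cn n}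
    (h : ContDiffAt ℝ 2 α y) : twistedDeriv A (twistedDeriv A α) y = 0 := by
  have hd : DifferentiableAt ℝ (fderiv ℝ α) y :=
    (h.fderiv_right (m := 1) (by norm_num)).differentiableAt (by norm_num)
  have h1 : fderiv ℝ (twistedDeriv A α) y = twistedCLM A k ∘L fderiv ℝ (fderiv ℝ α) y := by
    rw [twistedDeriv_eq_comp]
    exact fderiv_continuousLinearMap_comp (E := Cn n) (F := Cn n →L[ℝ] Alt n k) _ hd
  rw [twistedDeriv, h1, twistedCLM, ContinuousLinearMap.comp_assoc, ContinuousLinearMap.comp_assoc]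
  refine ContinuousAlternatingMap.alternatizeUncurryFin_alternatizeUncurryFinCLM_comp_of_symmetric
    fun v w => ?_
  exact (h.isSymmSndFDerivAt (by simp)).eq (A v) (A w)

lemma differentiableAt_twistedDeriv (A : Cn n →L[ℝ] Cn n) {k : ℕ} {α : Cn n → Alt n k} {y : Cn n}
    (h : ContDiffAt ℝ 2 α y) : DifferentiableAt ℝ (twistedDeriv A α) y := by
  have hd : DifferentiableAt ℝ (fderiv ℝ α) y :=
    (h.fderiv_right (m := 1) (by norm_num)).differentiableAt (by norm_num)
  rw [twistedDeriv_eq_comp]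
  exact differentiableAt_continuousLinearMap_comp (E := Cn n) (F := Cn n →L[ℝ] Alt n k) _ hd

lemma twistedDeriv_comb (A : Cn n →L[ℝ] Cn n) {k : ℕ} {α β : Cn n → Alt n k} {y : Cn n}
    (c d : ℂ) (hα : DifferentiableAt ℝ α y) (hβ : DifferentiableAt ℝ β y) :
    twistedDeriv A (fun z => c • (α z + d • β z)) y
      = c • (twistedDeriv A α y + d • twistedDeriv A β y) := by
  have h1 : fderiv ℝ (fun z => c • (α z + d • β z)) y
      = c • (fderiv ℝ α y + d • fderiv ℝ β y) :=
    ((hα.hasFDerivAt.add (hβ.hasFDerivAt.const_smul d)).const_smul c).fderiv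
  rw [twistedDeriv, h1, twistedDeriv, twistedDeriv, ← alternatizeUncurryFin_smul,
    ← alternatizeUncurryFin_add, ← alternatizeUncurryFin_smul]
  rfl

lemma ldel_eq {k : ℕ} (α : Cn n → Alt n k) : ldel α = fun y => (1 / 2 : ℂ) •
    (twistedDeriv (ContinuousLinearMap.id ℝ (Cn n)) α y
      + (-Complex.I) • twistedDeriv (mulI n) α y) := funext fun _ => linPart_eq _

lemma ldelbar_eq {k : ℕ} (α : Cn n → Alt n k) : ldelbar α = fun y => (1 / 2 : ℂ) •
    (twistedDeriv (ContinuousLinearMap.id ℝ (Cn n)) α y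
      + Complex.I • twistedDeriv (mulI n) α y) := funext fun _ => antiPart_eq _

lemma ldel_ldelbar {k : ℕ} {α : Cn n → Alt n k} {y : Cn n} (h : ContDiffAt ℝ 2 α y) :
    ldel (ldelbar α) y = - ldelbar (ldel α) y := by
  have hd := differentiableAt_twistedDeriv (ContinuousLinearMap.id ℝ (Cn n)) h
  have hJ := differentiableAt_twistedDeriv (mulI n) h
  rw [ldelbar_eq α, ldel_eq α, ldel_eq, ldelbar_eq]
  simp only [twistedDeriv_comb _ _ _ hd hJ, twistedDeriv_twistedDeriv _ h]
  module

/-! ### Smooth functions with values in the fibre -/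

/-- Smoothness of all homogeneous components. -/
def FSmoothOn (U : Set (Cn n)) (u : Cn n → Fib n) : Prop :=
  ∀ k, ContDiffOn ℝ ∞ (fun y => u y k) U

section smooth

variable {U : Set (Cn n)}

lemma FSmoothOn.csmul {c : Cn n → ℂ} {u : Cn n → Fib n} (hc : ContDiffOn ℝ ∞ c U)
    (hu : FSmoothOn U u) : FSmoothOn U (fun y => c y • u y) := fun k => hc.smul (hu k)

lemma FSmoothOn.sum {ι : Type*} {s : Finset ι} {u : ι → Cn n → Fib n}
    (hu : ∀ i ∈ s, FSmoothOn U (u i)) : FSmoothOn U (fun y => ∑ i ∈ s, u i y) := fun k => by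
  simp only [Finset.sum_apply]
  exact ContDiffOn.sum fun i hi => hu i hi k

lemma FSmoothOn.eps {u : Cn n → Fib n} (hu : FSmoothOn U u) (a : Idx n) :
    FSmoothOn U (fun y => eps a (u y)) := fun k => by
  rcases k with _ | k
  · exact contDiffOn_const
  · exact (epsCLM a).contDiff.comp_contDiffOn (hu k)

lemma FSmoothOn.part01 {u : Cn n → Fib n} (hu : FSmoothOn U u) (a : Idx n) :
    FSmoothOn U (fun y => part01 (cplx (matJ n)) HermitianForms.eps a (u y)) := by
  simp only [HermitianForms.part01, lin, LinearMap.smul_apply, LinearMap.add_apply,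
    LinearMap.sum_apply]
  refine FSmoothOn.csmul contDiffOn_const fun k => ?_
  exact ((hu.eps a) k).add (FSmoothOn.csmul contDiffOn_const (FSmoothOn.sum fun b _ =>
    FSmoothOn.csmul contDiffOn_const (hu.eps b)) k)

lemma FSmoothOn.iota {u : Cn n → Fib n} (hu : FSmoothOn U u) (a : Idx n) :
    FSmoothOn U (fun y => iota a (u y)) := fun k =>
  (iotaCLM a).contDiff.comp_contDiffOn (hu (k + 1))

lemma FSmoothOn.extOp {u : Cn n → Fib n} (hu : FSmoothOn U u) {p : ℕ} {η : Cn n → Alt n p}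
    (hη : ContDiffOn ℝ ∞ η U) : FSmoothOn U (fun y => extOp (η y) (u y)) := by
  induction p with
  | zero => exact FSmoothOn.csmul ((evalCLM ![]).contDiff.comp_contDiffOn hη) hu
  | succ p ih =>
    simp only [HermitianForms.extOp, LinearMap.smul_apply, LinearMap.sum_apply,
      Module.End.mul_apply]
    exact FSmoothOn.csmul contDiffOn_const (FSmoothOn.sum fun a _ =>
      (ih ((iotaCLM a).contDiff.comp_contDiffOn hη)).eps a)

lemma FSmoothOn.epsAdj {u : Cn n → Fib n} (hu : FSmoothOn U u)
    {G : Cn n → Matrix (Idx n) (Idx n) ℝ} (hG : ∀ a b, ContDiffOn ℝ ∞ (fun y => G y a b) U)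
    (a : Idx n) : FSmoothOn U (fun y => epsAdj (G y) a (u y)) := by
  simp only [HermitianForms.epsAdj, LinearMap.smul_apply, LinearMap.sum_apply]
  exact FSmoothOn.sum fun d _ => FSmoothOn.csmul
    (Complex.ofRealCLM.contDiff.comp_contDiffOn (hG a d)) (hu.iota d)

lemma FSmoothOn.contrOp {u : Cn n → Fib n} (hu : FSmoothOn U u)
    {G : Cn n → Matrix (Idx n) (Idx n) ℝ} (hG : ∀ a b, ContDiffOn ℝ ∞ (fun y => G y a b) U)
    {p : ℕ} {η : Cn n → Alt n p} (hη : ContDiffOn ℝ ∞ η U) :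
    FSmoothOn U (fun y => contrOp (G y) (η y) (u y)) := by
  induction p generalizing u with
  | zero =>
    exact FSmoothOn.csmul ((Complex.conjCLE : ℂ →L[ℝ] ℂ).contDiff.comp_contDiffOn
      ((evalCLM ![]).contDiff.comp_contDiffOn hη)) hu
  | succ p ih =>
    simp only [HermitianForms.contrOp, LinearMap.smul_apply, LinearMap.sum_apply,
      Module.End.mul_apply]
    exact FSmoothOn.csmul contDiffOn_const (FSmoothOn.sum fun a _ =>
      ih (hu.epsAdj hG a) ((iotaCLM a).contDiff.comp_contDiffOn hη))

lemma contDiffOn_gram {η : Cn n → Alt n 2} (hη : ContDiffOn ℝ ∞ η U) (a b : Idx n) :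
    ContDiffOn ℝ ∞ (fun y => gram (η y) a b) U :=
  (Complex.reCLM ∘L evalCLM ![realBasis n a, mulI n (realBasis n b)]).contDiff.comp_contDiffOn hη

lemma contDiffOn_gramInv {η : Cn n → Alt n 2} (hη : ContDiffOn ℝ ∞ η U)
    (hH : ∀ y ∈ U, IsHerm (η y)) (a b : Idx n) :
    ContDiffOn ℝ ∞ (fun y => gramInv (η y) a b) U :=
  contDiffOn_inv_apply (contDiffOn_gram hη) (fun y hy => (hH y hy).posDef.det_pos.ne') a b

lemma contDiffOn_density {η : Cn n → Alt n 2} (hη : ContDiffOn ℝ ∞ η U)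
    (hH : ∀ y ∈ U, IsHerm (η y)) : ContDiffOn ℝ ∞ (fun y => density (η y)) U :=
  (contDiffOn_det (contDiffOn_gram hη)).sqrt fun y hy => (hH y hy).posDef.det_pos.ne'

lemma contDiffOn_altInner {G : Cn n → Matrix (Idx n) (Idx n) ℝ}
    (hG : ∀ a b, ContDiffOn ℝ ∞ (fun y => G y a b) U) {k : ℕ} {α β : Cn n → Alt n k}
    (hα : ContDiffOn ℝ ∞ α U) (hβ : ContDiffOn ℝ ∞ β U) :
    ContDiffOn ℝ ∞ (fun y => altInner (G y) (α y) (β y)) U := by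
  simp only [altInner]
  refine contDiffOn_const.mul (ContDiffOn.sum fun a _ => ContDiffOn.sum fun b _ => ?_)
  have h0 : ContDiffOn ℝ ∞ (fun y => ∏ s, G y (a s) (b s)) U :=
    contDiffOn_prod fun s _ => hG (a s) (b s)
  have h1 : ContDiffOn ℝ ∞ (fun y => ((∏ s, G y (a s) (b s) : ℝ) : ℂ)) U :=
    Complex.ofRealCLM.contDiff.comp_contDiffOn h0
  have h2 : ContDiffOn ℝ ∞ (fun y => α y (realBasis n ∘ a)) U :=
    (evalCLM _).contDiff.comp_contDiffOn hα
  refine h1.mul (h2.mul ?_)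
  exact (Complex.conjCLE : ℂ →L[ℝ] ℂ).contDiff.comp_contDiffOn
    ((evalCLM _).contDiff.comp_contDiffOn hβ)

lemma contDiffOn_fibInner {G : Cn n → Matrix (Idx n) (Idx n) ℝ}
    (hG : ∀ a b, ContDiffOn ℝ ∞ (fun y => G y a b) U) {u v : Cn n → Fib n}
    (hu : FSmoothOn U u) (hv : FSmoothOn U v) :
    ContDiffOn ℝ ∞ (fun y => fibInner (G y) (u y) (v y)) U := by
  simp only [fibInner_apply]
  exact ContDiffOn.sum fun k _ => contDiffOn_altInner hG (hu k) (hv k)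

lemma contDiffOn_twistedDeriv (A : Cn n →L[ℝ] Cn n) (hU : IsOpen U) {k : ℕ} {α : Cn n → Alt n k}
    (h : ContDiffOn ℝ ∞ α U) : ContDiffOn ℝ ∞ (twistedDeriv A α) U :=
  (twistedCLM A k).contDiff.comp_contDiffOn (h.fderiv_of_isOpen hU (by decide))

lemma contDiffOn_ldel (hU : IsOpen U) {k : ℕ} {α : Cn n → Alt n k}
    (h : ContDiffOn ℝ ∞ α U) : ContDiffOn ℝ ∞ (ldel α) U := by
  rw [ldel_eq]
  exact ((contDiffOn_twistedDeriv _ hU h).add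
    ((contDiffOn_twistedDeriv _ hU h).const_smul (-Complex.I))).const_smul (1 / 2 : ℂ)

lemma contDiffOn_ldelbar (hU : IsOpen U) {k : ℕ} {α : Cn n → Alt n k}
    (h : ContDiffOn ℝ ∞ α U) : ContDiffOn ℝ ∞ (ldelbar α) U := by
  rw [ldelbar_eq]
  exact ((contDiffOn_twistedDeriv _ hU h).add
    ((contDiffOn_twistedDeriv _ hU h).const_smul Complex.I)).const_smul (1 / 2 : ℂ)

end smooth

/-! ### Derivatives of sections of the bundle of mixed forms -/

/-- The derivatives of the components of `u` at `y`. -/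
def fjet (u : Cn n → Fib n) (y : Cn n) (k : ℕ) : Cn n →L[ℝ] Alt n k :=
  fderiv ℝ (fun z => u z k) y

/-- The partial derivative of `u` at `y` in the direction `realBasis n a`. -/
def fpartial (u : Cn n → Fib n) (y : Cn n) (a : Idx n) : Fib n :=
  fun k => fjet u y k (realBasis n a)

/-- Differentiability of all components at `y`. -/
def FDiffAt (u : Cn n → Fib n) (y : Cn n) : Prop := ∀ k, DifferentiableAt ℝ (fun z => u z k) y

lemma FSmoothOn.fDiffAt {U : Set (Cn n)} (hU : IsOpen U) {u : Cn n → Fib n} (hu : FSmoothOn U u)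
    {y : Cn n} (hy : y ∈ U) : FDiffAt u y := fun k =>
  ((hu k).contDiffAt (hU.mem_nhds hy)).differentiableAt (by decide)

lemma hasDerivAt_line {F : Type*} [NormedAddCommGroup F] [NormedSpace ℝ F] {f : Cn n → F}
    {y : Cn n} (h : DifferentiableAt ℝ f y) (v : Cn n) :
    HasDerivAt (fun t : ℝ => f (y + t • v)) (fderiv ℝ f y v) 0 := by
  have h1 : HasDerivAt (fun t : ℝ => y + t • v) v 0 := by
    simpa using ((hasDerivAt_id (0 : ℝ)).smul_const v).const_add y
  have h2 : HasFDerivAt f (fderiv ℝ f y) (y + (0 : ℝ) • v) := by simpa using h.hasFDerivAt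
  exact h2.comp_hasDerivAt 0 h1

lemma FDiffAt.hasDerivAt {u : Cn n → Fib n} {y : Cn n} (h : FDiffAt u y) (a : Idx n) (k : ℕ) :
    HasDerivAt (fun t : ℝ => u (y + t • realBasis n a) k) (fpartial u y a k) 0 :=
  hasDerivAt_line (h k) _

lemma fpartial_eq {u : Cn n → Fib n} {y : Cn n} (h : FDiffAt u y) {a : Idx n} {w : Fib n}
    (hw : ∀ k, HasDerivAt (fun t : ℝ => u (y + t • realBasis n a) k) (w k) 0) :
    fpartial u y a = w := funext fun k => (h.hasDerivAt a k).unique (hw k)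

lemma hasDerivAt_extOp {p : ℕ} {η : ℝ → Alt n p} {η' : Alt n p} {u : ℝ → Fib n} {u' : Fib n}
    {t : ℝ} (hη : HasDerivAt η η' t) (hu : ∀ k, HasDerivAt (fun s => u s k) (u' k) t) (k : ℕ) :
    HasDerivAt (fun s => extOp (η s) (u s) k) ((extOp η' (u t) + extOp (η t) u') k) t := by
  induction p generalizing k with
  | zero =>
    have h1 : HasDerivAt (fun s => η s ![]) (η' ![]) t :=
      (evalCLM ![]).hasFDerivAt.comp_hasDerivAt t hη
    exact (h1.smul (hu k)).congr_deriv (add_comm _ _)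
  | succ p ih =>
    have h1 : ∀ a, HasDerivAt (fun s => (eps a (extOp (iotaAlt a (η s)) (u s))) k)
        ((eps a (extOp (iotaAlt a η') (u t) + extOp (iotaAlt a (η t)) u')) k) t := by
      intro a
      rcases k with _ | k
      · exact hasDerivAt_const _ _
      · exact (epsCLM a).hasFDerivAt.comp_hasDerivAt t
          (ih ((iotaCLM a).hasFDerivAt.comp_hasDerivAt t hη) k)
    have h2 := (HasDerivAt.fun_sum (u := Finset.univ) fun a _ => h1 a).const_smul
      (((p : ℂ) + 1)⁻¹)
    have e1 : ∀ (ζ : Alt n (p + 1)) (w : Fib n), extOp ζ w k =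
        ((p : ℂ) + 1)⁻¹ • ∑ a, (eps a (extOp (iotaAlt a ζ) w)) k := by
      intro ζ w
      simp only [extOp, LinearMap.smul_apply, LinearMap.sum_apply, Module.End.mul_apply,
        Pi.smul_apply, Finset.sum_apply]
    simp only [Pi.add_apply, e1]
    refine h2.congr_deriv ?_
    simp only [map_add, Pi.add_apply, Finset.sum_add_distrib]
    exact smul_add (M := ℂ) (A := Alt n k) _ _ _

/-- The operator `∂` on functions with values in the fibre. -/
def fdel (u : Cn n → Fib n) (y : Cn n) : Fib n := jetDel (fjet u y)

/-- The operator `∂̄` on functions with values in the fibre. -/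
def fdelbar (u : Cn n → Fib n) (y : Cn n) : Fib n := jetDelbar (fjet u y)

lemma fdel_eq (u : Cn n → Fib n) (y : Cn n) :
    fdel u y = ∑ a, part10 (cplx (matJ n)) eps a (fpartial u y a) := jetDel_eq _

lemma fdelbar_eq (u : Cn n → Fib n) (y : Cn n) :
    fdelbar u y = ∑ a, part01 (cplx (matJ n)) eps a (fpartial u y a) := jetDelbar_eq _

section Leibniz

variable {p : ℕ} {η : Cn n → Alt n p} {u : Cn n → Fib n} {y : Cn n}

lemma fpartial_extOp (hη : DifferentiableAt ℝ η y) (hu : FDiffAt u y)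
    (h : FDiffAt (fun z => extOp (η z) (u z)) y) (a : Idx n) :
    fpartial (fun z => extOp (η z) (u z)) y a
      = extOp (fderiv ℝ η y (realBasis n a)) (u y) + extOp (η y) (fpartial u y a) := by
  refine fpartial_eq h fun k => ?_
  have := hasDerivAt_extOp (hasDerivAt_line hη (realBasis n a)) (hu.hasDerivAt a) k
  simpa only [zero_smul, add_zero] using this

lemma part10_mul_extOp (a : Idx n) (ζ : Alt n p) :
    part10 (cplx (matJ n)) eps a * extOp ζ
      = (-1 : ℂ) ^ p • (extOp ζ * part10 (cplx (matJ n)) eps a) := by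
  simp only [part10, lin, smul_mul_assoc, mul_smul_comm, sub_mul, mul_sub, Finset.sum_mul,
    Finset.mul_sum, eps_mul_extOp, smul_sub, Finset.smul_sum, smul_smul, mul_comm,
    mul_left_comm]

lemma part01_mul_extOp (a : Idx n) (ζ : Alt n p) :
    part01 (cplx (matJ n)) eps a * extOp ζ
      = (-1 : ℂ) ^ p • (extOp ζ * part01 (cplx (matJ n)) eps a) := by
  simp only [part01, lin, smul_mul_assoc, mul_smul_comm, add_mul, mul_add, Finset.sum_mul,
    Finset.mul_sum, eps_mul_extOp, smul_add, Finset.smul_sum, smul_smul, mul_comm,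
    mul_left_comm]

/-- The Leibniz rule for `∂`. -/
lemma fdel_extOp (hη : DifferentiableAt ℝ η y) (hu : FDiffAt u y)
    (h : FDiffAt (fun z => extOp (η z) (u z)) y) :
    fdel (fun z => extOp (η z) (u z)) y
      = extOp (ldel η y) (u y) + (-1 : ℂ) ^ p • extOp (η y) (fdel u y) := by
  simp only [fdel_eq, fpartial_extOp hη hu h, map_add, Finset.sum_add_distrib, ldel,
    extOp_linPart, LinearMap.sum_apply, Module.End.mul_apply, map_sum, Finset.smul_sum]
  congr 1
  refine Finset.sum_congr rfl fun a _ => ?_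
  rw [← Module.End.mul_apply, part10_mul_extOp]
  rfl

/-- The Leibniz rule for `∂̄`. -/
lemma fdelbar_extOp (hη : DifferentiableAt ℝ η y) (hu : FDiffAt u y)
    (h : FDiffAt (fun z => extOp (η z) (u z)) y) :
    fdelbar (fun z => extOp (η z) (u z)) y
      = extOp (ldelbar η y) (u y) + (-1 : ℂ) ^ p • extOp (η y) (fdelbar u y) := by
  simp only [fdelbar_eq, fpartial_extOp hη hu h, map_add, Finset.sum_add_distrib, ldelbar,
    extOp_antiPart, LinearMap.sum_apply, Module.End.mul_apply, map_sum, Finset.smul_sum]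
  congr 1
  refine Finset.sum_congr rfl fun a _ => ?_
  rw [← Module.End.mul_apply, part01_mul_extOp]
  rfl

end Leibniz

/-! ### The divergence identity -/

section divergence

variable {U : Set (Cn n)} {θ : Cn n → Alt n 2}

lemma isReal11_fderiv (hU : IsOpen U) (hθ : ContDiffOn ℝ ∞ θ U) (hH : ∀ y ∈ U, IsHerm (θ y))
    {y : Cn n} (hy : y ∈ U) (b : Cn n) : IsReal11 (fderiv ℝ θ y b) := by
  have hd := hasDerivAt_line ((hθ.contDiffAt (hU.mem_nhds hy)).differentiableAt (by decide)) b
  have hev : ∀ᶠ t in nhds (0 : ℝ), y + t • b ∈ U := by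
    have hc : ContinuousAt (fun t : ℝ => y + t • b) 0 := by fun_prop
    exact hc.preimage_mem_nhds (by simpa using hU.mem_nhds hy)
  have he : ∀ v, HasDerivAt (fun t : ℝ => θ (y + t • b) v) (fderiv ℝ θ y b v) 0 := fun v =>
    (evalCLM v).hasFDerivAt.comp_hasDerivAt 0 hd
  refine ⟨fun v w => ?_, fun v w => ?_⟩
  · have h1 : HasDerivAt (fun t : ℝ => (θ (y + t • b) ![v, w]).im) (fderiv ℝ θ y b ![v, w]).im 0 :=
      Complex.imCLM.hasFDerivAt.comp_hasDerivAt 0 (he ![v, w])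
    refine h1.unique ((hasDerivAt_const (0 : ℝ) (0 : ℝ)).congr_of_eventuallyEq ?_)
    filter_upwards [hev] with t ht using (hH _ ht).real v w
  · refine (he ![mulI n v, mulI n w]).unique ((he ![v, w]).congr_of_eventuallyEq ?_)
    filter_upwards [hev] with t ht using (hH _ ht).type_one_one v w

/-- The expression of the formal adjoint of `∂̄` that follows from the commutation relation
`[Λ, ∂] = i (∂̄* + τ̄*)`. -/
def fdelbarStar (θ : Cn n → Alt n 2) (v : Cn n → Fib n) (y : Cn n) : Fib n :=
  (-Complex.I) • (contrOp (gramInv (θ y)) (θ y) (fdel v y)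
      - fdel (fun z => contrOp (gramInv (θ z)) (θ z) (v z)) y)
    - (contrOp (gramInv (θ y)) (ldelbar θ y) (extOp (θ y) (v y))
      - extOp (θ y) (contrOp (gramInv (θ y)) (ldelbar θ y) (v y)))

variable {y : Cn n}

lemma eventually_line_mem (hU : IsOpen U) (hy : y ∈ U) (b : Cn n) :
    ∀ᶠ t in nhds (0 : ℝ), y + t • b ∈ U := by
  have hc : ContinuousAt (fun t : ℝ => y + t • b) 0 := by fun_prop
  exact hc.preimage_mem_nhds (by simpa using hU.mem_nhds hy)

/-- The derivative of the volume-weighted inner product of two sections. -/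
lemma hasDerivAt_density_mul_fibInner_line (hU : IsOpen U) (hθ : ContDiffOn ℝ ∞ θ U)
    (hH : ∀ y ∈ U, IsHerm (θ y)) (hy : y ∈ U) {u v : Cn n → Fib n} (hu : FDiffAt u y)
    (hv : FDiffAt v y) (a : Idx n) :
    HasDerivAt (fun t : ℝ => (density (θ (y + t • realBasis n a)) : ℂ) *
        fibInner (gramInv (θ (y + t • realBasis n a))) (u (y + t • realBasis n a))
          (v (y + t • realBasis n a)))
      (density (θ y) * (fibInner (gramInv (θ y))
          (varOp (gramInv (θ y)) (fderiv ℝ θ y (realBasis n a)) (u y)) (v y)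
        + fibInner (gramInv (θ y)) (fpartial u y a) (v y)
        + fibInner (gramInv (θ y)) (u y) (fpartial v y a))) 0 := by
  have hd := hasDerivAt_line ((hθ.contDiffAt (hU.mem_nhds hy)).differentiableAt (by decide))
    (realBasis n a)
  have := hasDerivAt_density_mul_fibInner hd
    ((eventually_line_mem hU hy (realBasis n a)).mono fun t ht => hH _ ht)
    (isReal11_fderiv hU hθ hH hy _) (hu.hasDerivAt a) (hv.hasDerivAt a)
  simpa only [zero_smul, add_zero] using this

/-- The operator of the first variation is self-adjoint. -/
lemma isFibAdj_varOp {η η' : Alt n 2} (h : IsHerm η) (h' : IsReal11 η') (a : Idx n) :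
    IsFibAdj (gramInv η) (varOp (gramInv η) η') (varOp (gramInv η) η') := by
  have hj := h.jetOps h' a
  have ht := h.gramInv_transpose
  have h1 := ((isFibAdj_extOp (gramInv η) η).symm ht).mul (isFibAdj_extOp (gramInv η) η')
  have h2 := (isFibAdj_extOp (gramInv η) η').mul ((isFibAdj_extOp (gramInv η) η).symm ht)
  have h3 := h1.sub h2
  rw [← hj.E_eq, ← hj.E_eq'] at h3
  exact h3

/-- The derivative of `Λ` is minus the adjoint of the derivative of `L`. -/
lemma fpartial_Lam (hU : IsOpen U) (hθ : ContDiffOn ℝ ∞ θ U) (hH : ∀ y ∈ U, IsHerm (θ y))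
    (hy : y ∈ U) {v : Cn n → Fib n} (hv : FSmoothOn U v) (a : Idx n) :
    fpartial (fun z => contrOp (gramInv (θ z)) (θ z) (v z)) y a
      = contrOp (gramInv (θ y)) (θ y) (fpartial v y a)
        - contrOp (gramInv (θ y)) (fderiv ℝ θ y (realBasis n a)) (v y) := by
  have hHy := hH y hy
  have h' := isReal11_fderiv hU hθ hH hy (realBasis n a)
  have hj := hHy.jetOps h' a
  have hθd : DifferentiableAt ℝ θ y := (hθ.contDiffAt (hU.mem_nhds hy)).differentiableAt (by decide)
  refine eq_of_fibInner_eq hHy.posDef_inv fun w => ?_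
  -- the derivatives of the two sides of `⟨L w, v⟩ = ⟨w, Λ v⟩`, with `w` constant
  have hw : FSmoothOn U (fun _ => w) := fun k => contDiffOn_const
  have hLw : FSmoothOn U (fun z => extOp (θ z) w) := hw.extOp hθ
  have hLv : FSmoothOn U (fun z => contrOp (gramInv (θ z)) (θ z) (v z)) :=
    hv.contrOp (contDiffOn_gramInv hθ hH) hθ
  have d1 := hasDerivAt_density_mul_fibInner_line hU hθ hH hy (hLw.fDiffAt hU hy)
    (hv.fDiffAt hU hy) a
  have d2 := hasDerivAt_density_mul_fibInner_line hU hθ hH hy (hw.fDiffAt hU hy)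
    (hLv.fDiffAt hU hy) a
  simp only [← isFibAdj_extOp _ _ _ _] at d2
  have d3 := d1.unique d2
  have hρ : (density (θ y) : ℂ) ≠ 0 :=
    Complex.ofReal_ne_zero.mpr (Real.sqrt_pos.mpr hHy.posDef.det_pos).ne'
  have d4 := mul_left_cancel₀ hρ d3
  have hw0 : fpartial (fun _ : Cn n => w) y a = 0 :=
    fpartial_eq (hw.fDiffAt hU hy) fun k => hasDerivAt_const _ _
  rw [fpartial_extOp hθd (hw.fDiffAt hU hy) (hLw.fDiffAt hU hy), hw0, map_zero, map_zero,
    LinearMap.zero_apply, add_zero, add_zero] at d4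
  have hE := isFibAdj_varOp hHy h' a
  have hL := isFibAdj_extOp (gramInv (θ y)) (θ y)
  have hLp := isFibAdj_extOp (gramInv (θ y)) (fderiv ℝ θ y (realBasis n a))
  have h5 := LinearMap.congr_fun hj.Lam_E (v y)
  simp only [LinearMap.sub_apply, Module.End.mul_apply, LinearMap.neg_apply, two_mul,
    LinearMap.add_apply] at h5
  have h6 := congrArg (fibInner (gramInv (θ y)) w) h5
  simp only [map_sub, map_neg, map_add] at h6
  rw [hE, hL, hLp, hL, hL, hE] at d4
  rw [map_sub]
  linear_combination -d4 + h6

lemma neg_I_smul_aux {V : Type*} [AddCommGroup V] [Module ℂ V] (p q r s : V) :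
    (-Complex.I) • ((p - Complex.I • s) - (p - q)) - r = -(Complex.I • q + r + s) := by
  have h : Complex.I • Complex.I • s = -s := by rw [smul_smul, Complex.I_mul_I, neg_one_smul]
  simp only [smul_sub, neg_smul, h]
  abel

/-- The pointwise form of the integration by parts that computes the adjoint of `∂̄`: the difference
of the two sides is a divergence. -/
lemma divergence_identity (hU : IsOpen U) (hθ : ContDiffOn ℝ ∞ θ U) (hH : ∀ y ∈ U, IsHerm (θ y))
    (hy : y ∈ U) {u v : Cn n → Fib n} (hu : FSmoothOn U u) (hv : FSmoothOn U v) :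
    ∑ a, fderiv ℝ (fun z => (density (θ z) : ℂ) * fibInner (gramInv (θ z))
        (part01 (cplx (matJ n)) eps a (u z)) (v z)) y (realBasis n a)
      = density (θ y) * (fibInner (gramInv (θ y)) (fdelbar u y) (v y)
        - fibInner (gramInv (θ y)) (u y) (fdelbarStar θ v y)) := by
  have hHy := hH y hy
  have h' := fun a => isReal11_fderiv hU hθ hH hy (realBasis n a)
  set G := gramInv (θ y) with hG
  set e : Idx n → FibOp n := fun a => part01 (cplx (matJ n)) eps a with he
  set e' : Idx n → FibOp n := fun a => part10 (cplx (matJ n)) eps a with he'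
  set s : Idx n → FibOp n := fun a => part10 (cplx (matJ n)) (epsAdj G) a with hs
  set M : Idx n → FibOp n := fun a => contrOp G (fderiv ℝ θ y (realBasis n a)) with hM
  set E : Idx n → FibOp n := fun a => varOp G (fderiv ℝ θ y (realBasis n a)) with hE
  set Lam : FibOp n := contrOp G (θ y) with hLam
  set L : FibOp n := extOp (θ y) with hL
  have hes : ∀ a, IsFibAdj G (e a) (s a) := isFibAdj_part01 (matJ n) (isFibAdj_eps _)
  have hEE : ∀ a, IsFibAdj G (E a) (E a) := fun a => isFibAdj_varOp hHy (h' a) a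
  have heu : ∀ a, FSmoothOn U (fun z => e a (u z)) := hu.part01
  have hpe : ∀ a, fpartial (fun z => e a (u z)) y a = e a (fpartial u y a) := by
    intro a
    refine fpartial_eq ((heu a).fDiffAt hU hy) fun k => ?_
    have hd := (hu.fDiffAt hU hy).hasDerivAt a
    have h1 : ∀ b, HasDerivAt (fun t : ℝ => eps b (u (y + t • realBasis n a)) k)
        (eps b (fpartial u y a) k) 0 := by
      intro b
      rcases k with _ | k
      · exact hasDerivAt_const _ _
      · exact (epsCLM b).hasFDerivAt.comp_hasDerivAt 0 (hd k)
    have h2 : ∀ w, e a w k = (1 / 2 : ℂ) • (eps a w k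
        + Complex.I • ∑ b, cplx (matJ n) a b • eps b w k) := by
      intro w
      simp only [he, part01, lin, LinearMap.smul_apply, LinearMap.add_apply, LinearMap.sum_apply,
        Pi.smul_apply, Pi.add_apply, Finset.sum_apply]
    simp only [h2]
    exact ((h1 a).add ((HasDerivAt.fun_sum fun b _ =>
      (h1 b).const_smul (cplx (matJ n) a b)).const_smul Complex.I)).const_smul (1 / 2 : ℂ)
  have hder : ∀ a, fderiv ℝ (fun z => (density (θ z) : ℂ) * fibInner (gramInv (θ z))
        (e a (u z)) (v z)) y (realBasis n a)
      = density (θ y) * (fibInner G (E a (e a (u y))) (v y)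
        + fibInner G (e a (fpartial u y a)) (v y)
        + fibInner G (e a (u y)) (fpartial v y a)) := by
    intro a
    have hsm : ContDiffOn ℝ ∞ (fun z => (density (θ z) : ℂ) * fibInner (gramInv (θ z))
        (e a (u z)) (v z)) U :=
      (Complex.ofRealCLM.contDiff.comp_contDiffOn (contDiffOn_density hθ hH)).mul
        (contDiffOn_fibInner (contDiffOn_gramInv hθ hH) (heu a) hv)
    have h1 := hasDerivAt_line
      ((hsm.contDiffAt (hU.mem_nhds hy)).differentiableAt (by decide)) (realBasis n a)
    have h2 := hasDerivAt_density_mul_fibInner_line hU hθ hH hy ((heu a).fDiffAt hU hy)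
      (hv.fDiffAt hU hy) a
    rw [hpe] at h2
    exact h1.unique h2
  have hstar : fdelbarStar θ v y = -∑ a, (s a (E a (v y)) + s a (fpartial v y a)) := by
    have hN : contrOp G (ldelbar θ y) = ∑ a, M a * s a := contrOp_antiPart hHy
    have hj := fun a => hHy.jetOps (h' a) a
    have h1 : ∀ a, s a (E a (v y)) = Complex.I • e' a (M a (v y))
        + (M a (s a (L (v y))) - L (M a (s a (v y)))) := fun a =>
      LinearMap.congr_fun (hj a).s_mul_E (v y)
    have h2 : ∀ a, Lam (e' a (fpartial v y a)) = e' a (Lam (fpartial v y a))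
        - Complex.I • s a (fpartial v y a) := by
      intro a
      have := LinearMap.congr_fun (hj a).Lam_e' (fpartial v y a)
      simp only [LinearMap.sub_apply, Module.End.mul_apply, LinearMap.neg_apply,
        LinearMap.smul_apply] at this
      rw [sub_eq_iff_eq_add] at this
      rw [this]; abel
    have h3 : ∀ a, fpartial (fun z => contrOp (gramInv (θ z)) (θ z) (v z)) y a
        = Lam (fpartial v y a) - M a (v y) := fun a => fpartial_Lam hU hθ hH hy hv a
    rw [fdelbarStar, ← hG, hN, fdel_eq, fdel_eq]
    simp only [h3, ← hLam, ← hL, map_sum, map_sub, LinearMap.sum_apply, Module.End.mul_apply, h1]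
    rw [← Finset.sum_sub_distrib, ← Finset.sum_sub_distrib, Finset.smul_sum,
      ← Finset.sum_sub_distrib, ← Finset.sum_neg_distrib]
    refine Finset.sum_congr rfl fun a _ => ?_
    rw [h2]
    exact neg_I_smul_aux _ _ _ _
  refine (Finset.sum_congr rfl fun a _ => hder a).trans ?_
  rw [fdelbar_eq, hstar]
  simp only [map_neg, map_sum, map_add, LinearMap.sum_apply, ← Finset.mul_sum]
  congr 1
  rw [sub_neg_eq_add, ← Finset.sum_add_distrib]
  refine Finset.sum_congr rfl fun a _ => ?_
  rw [← hes, ← hes, ← hEE]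
  simp only [he]
  ring

end divergence

end HermitianForms
end

noncomputable section

namespace HermitianForms

variable {n : ℕ}

lemma mem_transition_source {X : Type*} [TopologicalSpace X]
    {e e' : OpenPartialHomeomorph X (Cn n)} {y : Cn n}
    (hy : y ∈ e.target) (hy' : e.symm y ∈ e'.source) : y ∈ (e.symm ≫ₕ e').source := by
  simp [hy, hy']

variable {X : Type*} [TopologicalSpace X] [ChartedSpace (Cn n) X]

/-! ### Forms in the charts of a complex manifold -/

lemma contDiffOn_transition [IsManifold 𝓘(ℂ, Cn n) ω X] {e e' : OpenPartialHomeomorph X (Cn n)}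
    (he : e ∈ atlas (Cn n) X) (he' : e' ∈ atlas (Cn n) X) :
    ContDiffOn ℂ ω (e' ∘ e.symm) (e.symm ≫ₕ e').source := by
  have := (contDiffGroupoid ω 𝓘(ℂ, Cn n)).compatible he he'
  rw [contDiffGroupoid, mem_groupoid_of_pregroupoid] at this
  simpa [contDiffPregroupoid] using this.1

lemma isManifold_real [IsManifold 𝓘(ℂ, Cn n) ω X] : IsManifold 𝓘(ℝ, Cn n) ∞ X := by
  refine isManifold_of_contDiffOn _ _ _ fun e e' he he' => ?_
  have := ((contDiffOn_transition he he').restrict_scalars ℝ).of_le (m := ∞) le_top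
  simpa using this

lemma isHolAt_transition [IsManifold 𝓘(ℂ, Cn n) ω X] {e e' : OpenPartialHomeomorph X (Cn n)}
    (he : e ∈ atlas (Cn n) X) (he' : e' ∈ atlas (Cn n) X) {y : Cn n}
    (hy : y ∈ e.target) (hy' : e.symm y ∈ e'.source) : IsHolAt (e' ∘ e.symm) y := by
  have hc := contDiffOn_transition he he'
  have ho : (e.symm ≫ₕ e').source ∈ nhds y :=
    (e.symm ≫ₕ e').open_source.mem_nhds (mem_transition_source hy hy')
  refine ⟨((hc.contDiffAt ho).restrict_scalars ℝ).of_le le_top, ?_⟩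
  filter_upwards [(e.symm ≫ₕ e').open_source.mem_nhds (mem_transition_source hy hy')] with z hz v
  have hd : DifferentiableAt ℂ (e' ∘ e.symm) z :=
    (hc.contDiffAt ((e.symm ≫ₕ e').open_source.mem_nhds hz)).differentiableAt (by decide)
  rw [hd.fderiv_restrictScalars ℝ]
  simp [mulI]

/-- The differential of `e.symm`, with values in the tangent space of `X`. -/
def chartDeriv (e : OpenPartialHomeomorph X (Cn n)) (y : Cn n) : Cn n →L[ℝ] Cn n :=
  mfderiv 𝓘(ℝ, Cn n) 𝓘(ℝ, Cn n) e.symm y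

lemma chartDeriv_eq [IsManifold 𝓘(ℂ, Cn n) ω X] {e : OpenPartialHomeomorph X (Cn n)}
    (he : e ∈ atlas (Cn n) X) {y : Cn n} (hy : y ∈ e.target) :
    chartDeriv e y = fderiv ℝ (chartAt (Cn n) (e.symm y) ∘ e.symm) y := by
  have : IsManifold 𝓘(ℝ, Cn n) ∞ X := isManifold_real
  have h1 : ContMDiffAt 𝓘(ℝ, Cn n) 𝓘(ℝ, Cn n) ∞ e.symm y :=
    contMDiffAt_symm_of_mem_maximalAtlas (IsManifold.subset_maximalAtlas he) hy
  have h2 : MDifferentiableAt 𝓘(ℝ, Cn n) 𝓘(ℝ, Cn n) e.symm y := h1.mdifferentiableAt (by decide)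
  rw [chartDeriv, h2.mfderiv]
  simp only [writtenInExtChartAt, extChartAt_model_space_eq_id, modelWithCornersSelf_coe,
    Set.range_id, fderivWithin_univ]
  rfl

lemma chartDeriv_transition [IsManifold 𝓘(ℂ, Cn n) ω X] {e e' : OpenPartialHomeomorph X (Cn n)}
    (he : e ∈ atlas (Cn n) X) (he' : e' ∈ atlas (Cn n) X) {y : Cn n}
    (hy : y ∈ e.target) (hy' : e.symm y ∈ e'.source) :
    chartDeriv e y = chartDeriv e' (e' (e.symm y)) ∘L fderiv ℝ (e' ∘ e.symm) y := by
  have hs : e'.symm (e' (e.symm y)) = e.symm y := e'.left_inv hy'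
  have hy2 : e' (e.symm y) ∈ e'.target := e'.map_source hy'
  rw [chartDeriv_eq he hy, chartDeriv_eq he' hy2, hs]
  set c := chartAt (Cn n) (e.symm y) with hc
  have hev : (c ∘ e.symm) =ᶠ[nhds y] (c ∘ e'.symm) ∘ (e' ∘ e.symm) := by
    filter_upwards [(e.symm ≫ₕ e').open_source.mem_nhds (mem_transition_source hy hy')] with z hz
    simp only [Function.comp_apply]
    rw [e'.left_inv]
    simp at hz
    exact hz.2
  rw [hev.fderiv_eq]
  refine fderiv_comp y ?_ ?_
  · have := (isHolAt_transition he' (chart_mem_atlas (Cn n) (e.symm y)) hy2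
      (by rw [hs]; exact mem_chart_source _ _)).smooth
    exact this.differentiableAt (by decide)
  · exact (isHolAt_transition he he' hy hy').smooth.differentiableAt (by decide)

lemma chartDeriv_self [IsManifold 𝓘(ℂ, Cn n) ω X] (x : X) :
    chartDeriv (chartAt (Cn n) x) (chartAt (Cn n) x x) = ContinuousLinearMap.id ℝ (Cn n) := by
  set c := chartAt (Cn n) x with hc
  have hx : c x ∈ c.target := mem_chart_target _ _
  have hs : c.symm (c x) = x := c.left_inv (mem_chart_source _ _)
  rw [chartDeriv_eq (chart_mem_atlas (Cn n) x) hx, hs, ← hc]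
  have hev : (c ∘ c.symm) =ᶠ[nhds (c x)] id := by
    filter_upwards [c.open_target.mem_nhds hx] with z hz using c.right_inv hz
  rw [hev.fderiv_eq, fderiv_id]

lemma fderiv_transition_comp [IsManifold 𝓘(ℂ, Cn n) ω X] {e e' : OpenPartialHomeomorph X (Cn n)}
    (he : e ∈ atlas (Cn n) X) (he' : e' ∈ atlas (Cn n) X) {y : Cn n}
    (hy : y ∈ e.target) (hy' : e.symm y ∈ e'.source) :
    fderiv ℝ (e ∘ e'.symm) (e' (e.symm y)) ∘L fderiv ℝ (e' ∘ e.symm) y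
      = ContinuousLinearMap.id ℝ (Cn n) := by
  have hs : e'.symm (e' (e.symm y)) = e.symm y := e'.left_inv hy'
  have hy2 : e' (e.symm y) ∈ e'.target := e'.map_source hy'
  have hev : ((e ∘ e'.symm) ∘ (e' ∘ e.symm)) =ᶠ[nhds y] id := by
    filter_upwards [(e.symm ≫ₕ e').open_source.mem_nhds (mem_transition_source hy hy')] with z hz
    simp only [OpenPartialHomeomorph.trans_source, OpenPartialHomeomorph.symm_source,
      Set.mem_inter_iff, Set.mem_preimage] at hz
    simp only [Function.comp_apply, id]
    rw [e'.left_inv hz.2, e.right_inv hz.1]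
  have h1 := hev.fderiv_eq (𝕜 := ℝ)
  rw [fderiv_id] at h1
  have d1 : DifferentiableAt ℝ (e ∘ e'.symm) ((e' ∘ e.symm) y) :=
    (isHolAt_transition he' he hy2
      (by rw [hs]; exact e.map_target hy)).smooth.differentiableAt (by decide)
  have d2 : DifferentiableAt ℝ (e' ∘ e.symm) y :=
    (isHolAt_transition he he' hy hy').smooth.differentiableAt (by decide)
  rw [← h1]
  exact (fderiv_comp y d1 d2).symm

lemma isCIso_transition [IsManifold 𝓘(ℂ, Cn n) ω X] {e e' : OpenPartialHomeomorph X (Cn n)}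
    (he : e ∈ atlas (Cn n) X) (he' : e' ∈ atlas (Cn n) X) {y : Cn n}
    (hy : y ∈ e.target) (hy' : e.symm y ∈ e'.source) :
    IsCIso (fderiv ℝ (e' ∘ e.symm) y) (fderiv ℝ (e ∘ e'.symm) (e' (e.symm y))) := by
  have hs : e'.symm (e' (e.symm y)) = e.symm y := e'.left_inv hy'
  have hy2 : e' (e.symm y) ∈ e'.target := e'.map_source hy'
  refine ⟨(isHolAt_transition he he' hy hy').comm.self_of_nhds,
    fderiv_transition_comp he he' hy hy', ?_⟩
  have := fderiv_transition_comp he' he hy2 (by rw [hs]; exact e.map_target hy)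
  rwa [hs, e.right_inv hy] at this

/-- The inverse of `chartDeriv`. -/
lemma exists_isCIso_chartDeriv [IsManifold 𝓘(ℂ, Cn n) ω X] {e : OpenPartialHomeomorph X (Cn n)}
    (he : e ∈ atlas (Cn n) X) {y : Cn n} (hy : y ∈ e.target) :
    ∃ ψ, IsCIso (chartDeriv e y) ψ := by
  rw [chartDeriv_eq he hy]
  exact ⟨_, isCIso_transition he (chart_mem_atlas (Cn n) (e.symm y)) hy (mem_chart_source _ _)⟩

/-- The expression of a form of mixed degree in a chart. -/
def Form.inChart (u : Form n X) (e : OpenPartialHomeomorph X (Cn n)) (y : Cn n) : Fib n :=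
  fun k => HermitianForms.inChart (u k) e y

lemma inChart_apply {k : ℕ} (α : KForm n X k) (e : OpenPartialHomeomorph X (Cn n)) (y : Cn n) :
    inChart α e y = (α (e.symm y)).compContinuousLinearMap (chartDeriv e y) := rfl

lemma Form.inChart_eq_pull (u : Form n X) (e : OpenPartialHomeomorph X (Cn n)) (y : Cn n) :
    u.inChart e y = pull (chartDeriv e y) (u.at (e.symm y)) := rfl

lemma inChart_self [IsManifold 𝓘(ℂ, Cn n) ω X] {k : ℕ} (α : KForm n X k) (x : X) :
    inChart α (chartAt (Cn n) x) (chartAt (Cn n) x x) = α x := by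
  rw [inChart_apply, chartDeriv_self, (chartAt (Cn n) x).left_inv (mem_chart_source _ _)]
  rfl

lemma inChart_transition [IsManifold 𝓘(ℂ, Cn n) ω X] {e e' : OpenPartialHomeomorph X (Cn n)}
    (he : e ∈ atlas (Cn n) X) (he' : e' ∈ atlas (Cn n) X) {k : ℕ} (α : KForm n X k) {y : Cn n}
    (hy : y ∈ e.target) (hy' : e.symm y ∈ e'.source) :
    inChart α e y = (inChart α e' ((e' ∘ e.symm) y)).compContinuousLinearMap
      (fderiv ℝ (e' ∘ e.symm) y) := by
  rw [inChart_apply, inChart_apply, chartDeriv_transition he he' hy hy', Function.comp_apply,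
    e'.left_inv hy']
  rfl

lemma isSmooth_zero {k : ℕ} : KForm.IsSmooth (0 : KForm n X k) := fun _ _ =>
  contDiffOn_const (c := (0 : Alt n k))

lemma Form.isSmooth_iff {u : Form n X} :
    u.IsSmooth ↔ ∀ e ∈ atlas (Cn n) X, FSmoothOn e.target (u.inChart e) :=
  ⟨fun h e he k => h k e he, fun h k e he => h e he k⟩

lemma inChart_extMul (e : OpenPartialHomeomorph X (Cn n)) {p : ℕ} (η : KForm n X p)
    (u : Form n X) (y : Cn n) :
    (extMul η u).inChart e y = extOp (inChart η e y) (u.inChart e y) := by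
  rw [Form.inChart_eq_pull, extMul_at, pull_extOp]
  rfl

lemma Form.IsSmooth.extMul {u : Form n X} (hu : u.IsSmooth) {p : ℕ} {η : KForm n X p}
    (hη : η.IsSmooth) : Form.IsSmooth (extMul η u) := by
  rw [Form.isSmooth_iff] at hu ⊢
  intro e he k
  refine ((hu e he).extOp (hη e he) k).congr fun y _ => ?_
  exact congrFun (inChart_extMul e η u y) k

lemma Form.IsSmooth.add {u v : Form n X} (hu : u.IsSmooth) (hv : v.IsSmooth) :
    Form.IsSmooth (u + v) := fun k e he => (hu k e he).add (hv k e he)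

lemma Form.IsSmooth.sub {u v : Form n X} (hu : u.IsSmooth) (hv : v.IsSmooth) :
    Form.IsSmooth (u - v) := fun k e he => (hu k e he).sub (hv k e he)

lemma Form.IsSmooth.smul (c : ℂ) {u : Form n X} (hu : u.IsSmooth) :
    Form.IsSmooth (c • u) := fun k e he => (hu k e he).const_smul c

lemma Form.inChart_add (u v : Form n X) (e : OpenPartialHomeomorph X (Cn n)) (y : Cn n) :
    (u + v).inChart e y = u.inChart e y + v.inChart e y := rfl

lemma Form.inChart_smul (c : ℂ) (u : Form n X) (e : OpenPartialHomeomorph X (Cn n))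
    (y : Cn n) :
    (c • u).inChart e y = c • u.inChart e y := rfl

lemma KForm.IsSmooth.contDiffAt {k : ℕ} {α : KForm n X k} (hα : α.IsSmooth)
    {e : OpenPartialHomeomorph X (Cn n)}     (he : e ∈ atlas (Cn n) X) {y : Cn n} (hy : y ∈ e.target) :
    ContDiffAt ℝ ∞ (HermitianForms.inChart α e) y :=
  (hα e he).contDiffAt (e.open_target.mem_nhds hy)

section derivatives

variable [IsManifold 𝓘(ℂ, Cn n) ω X] {e : OpenPartialHomeomorph X (Cn n)}

lemma inChart_eventuallyEq {e' : OpenPartialHomeomorph X (Cn n)} (he : e ∈ atlas (Cn n) X)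
    (he' : e' ∈ atlas (Cn n) X) {k : ℕ} (α : KForm n X k) {y : Cn n}
    (hy : y ∈ e.target) (hy' : e.symm y ∈ e'.source) :
    inChart α e =ᶠ[nhds y] fun z => (inChart α e' ((e' ∘ e.symm) z)).compContinuousLinearMap
      (fderiv ℝ (e' ∘ e.symm) z) := by
  filter_upwards [(e.symm ≫ₕ e').open_source.mem_nhds (mem_transition_source hy hy')] with z hz
  simp only [OpenPartialHomeomorph.trans_source, OpenPartialHomeomorph.symm_source,
      Set.mem_inter_iff, Set.mem_preimage] at hz
  exact inChart_transition he he' α hz.1 hz.2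

/-- The operator `∂`, defined through the preferred charts, is computed in every chart by the same
formula. -/
lemma inChart_del (he : e ∈ atlas (Cn n) X) {k : ℕ} {α : KForm n X k} (hα : α.IsSmooth)
    {y : Cn n} (hy : y ∈ e.target) : inChart (del α) e y = ldel (inChart α e) y := by
  have hc := chart_mem_atlas (Cn n) (e.symm y)
  have hs := mem_chart_source (Cn n) (e.symm y)
  rw [inChart_apply, chartDeriv_eq he hy]
  set c := chartAt (Cn n) (e.symm y) with hcdef
  have h1 := ldel_pullback ((hα.contDiffAt hc (c.map_source hs)).differentiableAt (by decide))
    (isHolAt_transition he hc hy hs)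
  have h2 : ldel (inChart α e) y = ldel (fun z =>
      (inChart α c ((c ∘ e.symm) z)).compContinuousLinearMap (fderiv ℝ (c ∘ e.symm) z)) y := by
    rw [ldel, ldel, (inChart_eventuallyEq he hc α hy hs).fderiv_eq]
  rw [h2]
  exact h1.symm

lemma inChart_delbar (he : e ∈ atlas (Cn n) X) {k : ℕ} {α : KForm n X k} (hα : α.IsSmooth)
    {y : Cn n} (hy : y ∈ e.target) : inChart (delbar α) e y = ldelbar (inChart α e) y := by
  have hc := chart_mem_atlas (Cn n) (e.symm y)
  have hs := mem_chart_source (Cn n) (e.symm y)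
  rw [inChart_apply, chartDeriv_eq he hy]
  set c := chartAt (Cn n) (e.symm y) with hcdef
  have h1 := ldelbar_pullback ((hα.contDiffAt hc (c.map_source hs)).differentiableAt (by decide))
    (isHolAt_transition he hc hy hs)
  have h2 : ldelbar (inChart α e) y = ldelbar (fun z =>
      (inChart α c ((c ∘ e.symm) z)).compContinuousLinearMap (fderiv ℝ (c ∘ e.symm) z)) y := by
    rw [ldelbar, ldelbar, (inChart_eventuallyEq he hc α hy hs).fderiv_eq]
  rw [h2]
  exact h1.symm

lemma KForm.IsSmooth.del {k : ℕ} {α : KForm n X k} (hα : α.IsSmooth) :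
    (HermitianForms.del α).IsSmooth := fun e he =>
  (contDiffOn_ldel e.open_target (hα e he)).congr fun _ hy => inChart_del he hα hy

lemma KForm.IsSmooth.delbar {k : ℕ} {α : KForm n X k} (hα : α.IsSmooth) :
    (HermitianForms.delbar α).IsSmooth := fun e he =>
  (contDiffOn_ldelbar e.open_target (hα e he)).congr fun _ hy => inChart_delbar he hα hy

lemma kform_eq_of_inChart {k : ℕ} {α β : KForm n X k}
    (h : ∀ e ∈ atlas (Cn n) X, ∀ y ∈ e.target, inChart α e y = inChart β e y) : α = β := by
  funext x
  rw [← inChart_self α, ← inChart_self β]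
  exact h _ (chart_mem_atlas _ _) _ (mem_chart_target _ _)

lemma form_eq_of_inChart {u v : Form n X}
    (h : ∀ e ∈ atlas (Cn n) X, ∀ y ∈ e.target, u.inChart e y = v.inChart e y) : u = v :=
  funext fun k => kform_eq_of_inChart fun e he y hy => congrFun (h e he y hy) k

lemma inChart_delOp (he : e ∈ atlas (Cn n) X) {u : Form n X} (hu : u.IsSmooth)
    {y : Cn n} (hy : y ∈ e.target) : (delOp u).inChart e y = fdel (u.inChart e) y := by
  funext k
  rcases k with _ | k
  · rfl
  · exact inChart_del he (hu k) hy

lemma inChart_delbarOp (he : e ∈ atlas (Cn n) X) {u : Form n X} (hu : u.IsSmooth)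
    {y : Cn n} (hy : y ∈ e.target) : (delbarOp u).inChart e y = fdelbar (u.inChart e) y := by
  funext k
  rcases k with _ | k
  · rfl
  · exact inChart_delbar he (hu k) hy

lemma Form.IsSmooth.delOp {u : Form n X} (hu : u.IsSmooth) :
    Form.IsSmooth (HermitianForms.delOp u) := fun k => by
  rcases k with _ | k
  · exact isSmooth_zero
  · exact (hu k).del

lemma Form.IsSmooth.delbarOp {u : Form n X} (hu : u.IsSmooth) :
    Form.IsSmooth (HermitianForms.delbarOp u) := fun k => by
  rcases k with _ | k
  · exact isSmooth_zero
  · exact (hu k).delbar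

end derivatives

end HermitianForms
end

noncomputable section

namespace HermitianForms

variable {n : ℕ}

/-! ### Complex conjugation -/

/-- Complex conjugation of `k`-forms with constant coefficients. -/
def conjCLM (n k : ℕ) : Alt n k →L[ℝ] Alt n k :=
  ContinuousLinearMap.compContinuousAlternatingMapCLM ℝ (Cn n) ℂ ℂ (Fin k)
    (Complex.conjCLE : ℂ →L[ℝ] ℂ)

@[simp] lemma conjCLM_apply {k : ℕ} (u : Alt n k) (v : Fin k → Cn n) :
    conjCLM n k u v = (starRingEnd ℂ) (u v) := rfl

lemma conjCLM_conjCLM {k : ℕ} (u : Alt n k) : conjCLM n k (conjCLM n k u) = u := by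
  ext v; simp

lemma conjCLM_smul {k : ℕ} (c : ℂ) (u : Alt n k) :
    conjCLM n k (c • u) = (starRingEnd ℂ) c • conjCLM n k u := by
  ext v; simp

/-- Complex conjugation of forms of mixed degree with constant coefficients. -/
def conjFib (u : Fib n) : Fib n := fun k => conjCLM n k (u k)

lemma conjFib_smul (c : ℂ) (u : Fib n) : conjFib (c • u) = (starRingEnd ℂ) c • conjFib u :=
  funext fun _ => conjCLM_smul _ _

lemma conjFib_sum {ι : Type*} (s : Finset ι) (u : ι → Fib n) :
    conjFib (∑ i ∈ s, u i) = ∑ i ∈ s, conjFib (u i) := by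
  funext k
  simp only [conjFib, Finset.sum_apply, map_sum]

lemma conjFib_eps (a : Idx n) (u : Fib n) : conjFib (eps a u) = eps a (conjFib u) := by
  funext k
  rcases k with _ | k
  · exact map_zero _
  · ext v
    change (starRingEnd ℂ) (epsAlt a (u k) v) = epsAlt a (conjCLM n k (u k)) v
    simp [epsAlt_apply]

lemma conjFib_iota (a : Idx n) (u : Fib n) : conjFib (iota a u) = iota a (conjFib u) := rfl

lemma conj_succ_inv (p : ℕ) : (starRingEnd ℂ) ((p : ℂ) + 1)⁻¹ = ((p : ℂ) + 1)⁻¹ := by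
  rw [map_inv₀, map_add, map_natCast, map_one]

lemma conjFib_extOp {p : ℕ} (η : Alt n p) (u : Fib n) :
    conjFib (extOp η u) = extOp (conjCLM n p η) (conjFib u) := by
  induction p with
  | zero => exact conjFib_smul _ _
  | succ p ih =>
    simp only [extOp, LinearMap.smul_apply, LinearMap.sum_apply, Module.End.mul_apply,
      conjFib_smul, conjFib_sum, conjFib_eps, ih, conj_succ_inv]
    rfl

lemma conjFib_epsAdj (G : Matrix (Idx n) (Idx n) ℝ) (a : Idx n) (u : Fib n) :
    conjFib (epsAdj G a u) = epsAdj G a (conjFib u) := by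
  simp only [epsAdj, LinearMap.smul_apply, LinearMap.sum_apply, conjFib_smul, conjFib_sum,
    conjFib_iota, Complex.conj_ofReal]

lemma conjFib_contrOp (G : Matrix (Idx n) (Idx n) ℝ) {p : ℕ} (η : Alt n p) (u : Fib n) :
    conjFib (contrOp G η u) = contrOp G (conjCLM n p η) (conjFib u) := by
  induction p generalizing u with
  | zero => exact conjFib_smul _ _
  | succ p ih =>
    simp only [contrOp, LinearMap.smul_apply, LinearMap.sum_apply, Module.End.mul_apply,
      conjFib_smul, conjFib_sum, conjFib_epsAdj, ih, conj_succ_inv]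
    rfl

lemma fibInner_conjFib (G : Matrix (Idx n) (Idx n) ℝ) (u v : Fib n) :
    fibInner G (conjFib u) (conjFib v) = (starRingEnd ℂ) (fibInner G u v) := by
  simp only [fibInner_apply, map_sum, altInner, map_mul, map_inv₀, map_natCast,
    Complex.conj_ofReal]
  rfl

lemma conjCLM_of_isReal11 {η : Alt n 2} (h : IsReal11 η) : conjCLM n 2 η = η := by
  ext v
  have hv : v = ![v 0, v 1] := by funext i; fin_cases i <;> rfl
  rw [hv, conjCLM_apply, Complex.conj_eq_iff_im]
  exact h.real _ _

lemma alternatizeUncurryFin_conjCLM {k : ℕ} (T : Cn n →L[ℝ] Alt n k) :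
    ContinuousAlternatingMap.alternatizeUncurryFin (conjCLM n k ∘L T)
      = conjCLM n (k + 1) (ContinuousAlternatingMap.alternatizeUncurryFin T) := by
  ext v
  simp [ContinuousAlternatingMap.alternatizeUncurryFin_apply]

lemma linPart_conjCLM {k : ℕ} (D : Cn n →L[ℝ] Alt n k) :
    linPart (conjCLM n k ∘L D) = conjCLM n k ∘L antiPart D := by
  ext1 v
  change (1 / 2 : ℂ) • (conjCLM n k (D v) - Complex.I • conjCLM n k (D (mulI n v)))
    = conjCLM n k ((1 / 2 : ℂ) • (D v + Complex.I • D (mulI n v)))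
  rw [conjCLM_smul, map_add, conjCLM_smul, conj_one_half, Complex.conj_I]
  module

variable {X : Type*}

lemma form_ext_at {u v : Form n X} (h : ∀ x, u.at x = v.at x) : u = v :=
  funext fun k => funext fun x => congrFun (h x) k

lemma conjForm_at (u : Form n X) (x : X) : (conjForm u).at x = conjFib (u.at x) := rfl

lemma conjForm_conjForm (u : Form n X) : conjForm (conjForm u) = u :=
  funext fun _ => funext fun _ => conjCLM_conjCLM _

lemma conjForm_add (u v : Form n X) : conjForm (u + v) = conjForm u + conjForm v :=
  funext fun _ => funext fun _ => map_add (conjCLM _ _) _ _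

lemma conjForm_smul (c : ℂ) (u : Form n X) :
    conjForm (c • u) = (starRingEnd ℂ) c • conjForm u :=
  funext fun _ => funext fun _ => conjCLM_smul _ _

/-- Complex conjugation of `k`-forms. -/
def KForm.conj {k : ℕ} (α : KForm n X k) : KForm n X k := fun x => conjCLM n k (α x)

lemma KForm.conj_conj {k : ℕ} (α : KForm n X k) : α.conj.conj = α :=
  funext fun _ => conjCLM_conjCLM _

lemma conjForm_extMul {p : ℕ} (η : KForm n X p) (u : Form n X) :
    conjForm (extMul η u) = extMul η.conj (conjForm u) := by
  funext k x
  have h1 : (conjForm (extMul η u)).at x = (extMul η.conj (conjForm u)).at x := by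
    rw [conjForm_at, extMul_at, extMul_at, conjForm_at, conjFib_extOp]
    rfl
  exact congrFun h1 k

variable [TopologicalSpace X] [ChartedSpace (Cn n) X]

lemma inChart_conj {k : ℕ} (α : KForm n X k) (e : OpenPartialHomeomorph X (Cn n)) :
    inChart α.conj e = conjCLM n k ∘ inChart α e := rfl

lemma KForm.IsSmooth.conj {k : ℕ} {α : KForm n X k} (hα : α.IsSmooth) : α.conj.IsSmooth :=
  fun e he => (conjCLM n k).contDiff.comp_contDiffOn (hα e he)

lemma Form.IsSmooth.conjForm {u : Form n X} (hu : u.IsSmooth) :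
    Form.IsSmooth (HermitianForms.conjForm u) := fun k => (hu k).conj

lemma del_conj {k : ℕ} {α : KForm n X k} (hα : α.IsSmooth) : del α.conj = (delbar α).conj := by
  funext x
  have h : DifferentiableAt ℝ (inChart α (chartAt (Cn n) x)) (chartAt (Cn n) x x) :=
    (hα.contDiffAt (chart_mem_atlas _ _) (mem_chart_target _ _)).differentiableAt (by decide)
  rw [del, inChart_conj, fderiv_continuousLinearMap_comp (E := Cn n) (F := Alt n k) _ h,
    linPart_conjCLM, alternatizeUncurryFin_conjCLM]
  rfl

lemma delOp_conjForm {u : Form n X} (hu : u.IsSmooth) :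
    delOp (conjForm u) = conjForm (delbarOp u) := by
  funext k
  rcases k with _ | k
  · exact funext fun _ => (map_zero (conjCLM n 0)).symm
  · exact del_conj (hu k)

lemma delbarOp_conjForm {u : Form n X} (hu : u.IsSmooth) :
    delbarOp (conjForm u) = conjForm (delOp u) := by
  have := delOp_conjForm hu.conjForm
  rw [conjForm_conjForm] at this
  rw [this, conjForm_conjForm]

/-! ### Pointwise operations on a Hermitian manifold -/

namespace HermitianMetric

variable (g : HermitianMetric n X)

lemma isHerm (x : X) : IsHerm (g.form x) :=
  { real := g.real x, type_one_one := g.type_one_one x, pos := g.pos x }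

/-- The pointwise inner product of forms of mixed degree. -/
def ptInner (u v : Form n X) (x : X) : ℂ := fibInner (gramInv (g.form x)) (u.at x) (v.at x)

/-- The pointwise adjoint of the exterior multiplication by `η`. -/
def contrMul {p : ℕ} (η : KForm n X p) : Op n X := fun u k x =>
  contrOp (gramInv (g.form x)) (η x) (u.at x) k

lemma contrMul_at {p : ℕ} (η : KForm n X p) (u : Form n X) (x : X) :
    (g.contrMul η u).at x = contrOp (gramInv (g.form x)) (η x) (u.at x) := rfl

lemma ptInner_extMul {p : ℕ} (η : KForm n X p) (u v : Form n X) (x : X) :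
    g.ptInner (extMul η u) v x = g.ptInner u (g.contrMul η v) x := by
  rw [ptInner, extMul_at, isFibAdj_extOp]
  rfl

lemma conj_ptInner (u v : Form n X) (x : X) :
    (starRingEnd ℂ) (g.ptInner u v x) = g.ptInner v u x :=
  fibInner_conj_symm (g.isHerm x).gramInv_transpose _ _

open ComplexOrder in
lemma ptInner_self_nonneg (u : Form n X) (x : X) : 0 ≤ g.ptInner u u x :=
  fibInner_self_nonneg (g.isHerm x).posDef_inv _

open ComplexOrder in
lemma ptInner_self_eq (u : Form n X) (x : X) :
    g.ptInner u u x = ((g.ptInner u u x).re : ℂ) := by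
  have := (Complex.nonneg_iff.mp (g.ptInner_self_nonneg u x)).2
  apply Complex.ext <;> simp [← this]

open ComplexOrder in
lemma ptInner_self_re_nonneg (u : Form n X) (x : X) : 0 ≤ (g.ptInner u u x).re :=
  (Complex.nonneg_iff.mp (g.ptInner_self_nonneg u x)).1

lemma ptInner_eq (u v : Form n X) (x : X) :
    g.ptInner u v x = ∑ k ∈ Finset.range (2 * n + 1), g.fiberInner x (u k x) (v k x) :=
  fibInner_apply _ _ _

lemma ptInner_conjForm (u v : Form n X) (x : X) :
    g.ptInner (conjForm u) (conjForm v) x = (starRingEnd ℂ) (g.ptInner u v x) :=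
  fibInner_conjFib _ _ _

lemma conj_form : KForm.conj g.form = g.form := funext fun x =>
  conjCLM_of_isReal11 (g.isHerm x).toIsReal11

lemma conjForm_contrMul {p : ℕ} (η : KForm n X p) (u : Form n X) :
    conjForm (g.contrMul η u) = g.contrMul η.conj (conjForm u) :=
  form_ext_at fun _ => conjFib_contrOp _ _ _

variable [IsManifold 𝓘(ℂ, Cn n) ω X] {e : OpenPartialHomeomorph X (Cn n)}

lemma isHerm_inChart (he : e ∈ atlas (Cn n) X) {y : Cn n} (hy : y ∈ e.target) :
    IsHerm (inChart g.form e y) := by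
  obtain ⟨ψ, h⟩ := exists_isCIso_chartDeriv he hy
  exact (g.isHerm _).comp h

lemma inChart_contrMul (he : e ∈ atlas (Cn n) X) {p : ℕ} (η : KForm n X p) (u : Form n X)
    {y : Cn n} (hy : y ∈ e.target) :
    (g.contrMul η u).inChart e y
      = contrOp (gramInv (inChart g.form e y)) (inChart η e y) (u.inChart e y) := by
  obtain ⟨ψ, h⟩ := exists_isCIso_chartDeriv he hy
  rw [Form.inChart_eq_pull, contrMul_at, pull_contrOp h (g.isHerm _)]
  rfl

lemma isSmooth_contrMul {p : ℕ} {η : KForm n X p} (hη : η.IsSmooth) {u : Form n X}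
    (hu : u.IsSmooth) : Form.IsSmooth (g.contrMul η u) := by
  rw [Form.isSmooth_iff] at hu ⊢
  intro e he k
  refine ((hu e he).contrOp (contDiffOn_gramInv (g.smooth e he)
    fun y hy => g.isHerm_inChart he hy) (hη e he) k).congr fun y hy => ?_
  exact congrFun (g.inChart_contrMul he η u hy) k

lemma ptInner_inChart (he : e ∈ atlas (Cn n) X) (u v : Form n X) {y : Cn n} (hy : y ∈ e.target) :
    fibInner (gramInv (inChart g.form e y)) (u.inChart e y) (v.inChart e y)
      = g.ptInner u v (e.symm y) := by
  obtain ⟨ψ, h⟩ := exists_isCIso_chartDeriv he hy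
  exact fibInner_pull h _ _ _

lemma continuous_fiberInner {k : ℕ} {α β : KForm n X k} (hα : α.IsSmooth) (hβ : β.IsSmooth) :
    Continuous (fun x => g.fiberInner x (α x) (β x)) := by
  rw [continuous_iff_continuousAt]
  intro x
  set e := chartAt (Cn n) x with he'
  have he : e ∈ atlas (Cn n) X := chart_mem_atlas _ _
  have hx : x ∈ e.source := mem_chart_source _ _
  have h1 : ContinuousAt (fun y => altInner (gramInv (inChart g.form e y)) (inChart α e y)
      (inChart β e y)) (e x) :=
    ((contDiffOn_altInner (contDiffOn_gramInv (g.smooth e he) fun y hy => g.isHerm_inChart he hy)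
      (hα e he) (hβ e he)).continuousOn).continuousAt
      (e.open_target.mem_nhds (e.map_source hx))
  refine (h1.comp (e.continuousAt hx)).congr ?_
  filter_upwards [e.open_source.mem_nhds hx] with z hz
  obtain ⟨ψ, h⟩ := exists_isCIso_chartDeriv he (e.map_source hz)
  have h2 := altInner_comp h (g.form (e.symm (e z))) (α (e.symm (e z))) (β (e.symm (e z)))
  rw [e.left_inv hz] at h2
  rw [Function.comp_apply, inChart_apply, inChart_apply, inChart_apply, e.left_inv hz]
  exact h2

lemma continuous_ptInner {u v : Form n X} (hu : u.IsSmooth) (hv : v.IsSmooth) :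
    Continuous (g.ptInner u v) := by
  have : g.ptInner u v = fun x => ∑ k ∈ Finset.range (2 * n + 1),
      g.fiberInner x (u k x) (v k x) := funext fun x => g.ptInner_eq u v x
  rw [this]
  exact continuous_finsetSum _ fun k _ => g.continuous_fiberInner (hu k) (hv k)

/-- The formal adjoint of `∂̄`. -/
def delbarStar : Op n X := fun v =>
  (-Complex.I) • (g.contrMul g.form (delOp v) - delOp (g.contrMul g.form v))
    - (g.contrMul (delbar g.form) (extMul g.form v) - extMul g.form (g.contrMul (delbar g.form) v))

lemma inChart_delbarStar (he : e ∈ atlas (Cn n) X) {v : Form n X} (hv : v.IsSmooth)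
    {y : Cn n} (hy : y ∈ e.target) :
    (g.delbarStar v).inChart e y = fdelbarStar (inChart g.form e) (v.inChart e) y := by
  have h1 : fdel (fun z => contrOp (gramInv (inChart g.form e z)) (inChart g.form e z)
      (v.inChart e z)) y = (delOp (g.contrMul g.form v)).inChart e y := by
    rw [inChart_delOp he (g.isSmooth_contrMul g.smooth hv) hy, fdel, fdel]
    congr 1
    funext k
    refine Filter.EventuallyEq.fderiv_eq ?_
    filter_upwards [e.open_target.mem_nhds hy] with z hz
    rw [g.inChart_contrMul he _ _ hz]
  rw [fdelbarStar, h1, ← inChart_delOp he hv hy, ← inChart_delbar he g.smooth hy,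
    ← g.inChart_contrMul he _ _ hy, ← g.inChart_contrMul he _ _ hy, ← inChart_extMul,
    ← inChart_extMul, ← g.inChart_contrMul he _ _ hy]
  exact funext fun _ => rfl

lemma isSmooth_delbarStar {v : Form n X} (hv : v.IsSmooth) : Form.IsSmooth (g.delbarStar v) := by
  have hN : KForm.IsSmooth (delbar g.form) := KForm.IsSmooth.delbar g.smooth
  exact (((g.isSmooth_contrMul g.smooth hv.delOp).sub
    (g.isSmooth_contrMul g.smooth hv).delOp).smul _).sub
      ((g.isSmooth_contrMul hN (hv.extMul g.smooth)).sub
        ((g.isSmooth_contrMul hN hv).extMul g.smooth))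

end HermitianMetric

end HermitianForms
end

noncomputable section

namespace HermitianForms

variable {n : ℕ} {X : Type*} [TopologicalSpace X]

/-! ### The volume measure -/

open MeasureTheory

section

variable [MeasurableSpace X] [BorelSpace X]

lemma aemeasurable_chart_symm (e : OpenPartialHomeomorph X (Cn n)) :
    AEMeasurable e.symm ((volume : Measure (Cn n)).restrict e.target) :=
  e.continuousOn_symm.aemeasurable e.open_target.measurableSet

lemma measurableSet_target_inter_preimage (e : OpenPartialHomeomorph X (Cn n)) {A : Set X}
    (hA : MeasurableSet A) : MeasurableSet (e.target ∩ e.symm ⁻¹' A) := by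
  have h1 : MeasurableSet (e.target.domRestrict e.symm ⁻¹' A) :=
    (continuousOn_iff_continuous_domRestrict.mp e.continuousOn_symm).measurable hA
  have h2 := e.open_target.measurableSet.subtype_image h1
  convert h2 using 1
  ext y
  exact ⟨fun h => ⟨⟨y, h.1⟩, h.2, rfl⟩, fun ⟨z, hz, h⟩ => h ▸ ⟨z.2, hz⟩⟩

end

variable [ChartedSpace (Cn n) X] [IsManifold 𝓘(ℂ, Cn n) ω X]

lemma density_transition {e e' : OpenPartialHomeomorph X (Cn n)} (he : e ∈ atlas (Cn n) X)
    (he' : e' ∈ atlas (Cn n) X) (η : KForm n X 2) {y : Cn n} (hy : y ∈ e.target)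
    (hy' : e.symm y ∈ e'.source) :
    density (inChart η e y) = |(fderiv ℝ (e' ∘ e.symm) y).det| *
      density (inChart η e' ((e' ∘ e.symm) y)) := by
  rw [inChart_transition he he' η hy hy', density_comp _ (isCIso_transition he he' hy hy').comm]

namespace HermitianMetric

variable (g : HermitianMetric n X) {e e' : OpenPartialHomeomorph X (Cn n)}

lemma continuousOn_density (he : e ∈ atlas (Cn n) X) :
    ContinuousOn (fun y => density (inChart g.form e y)) e.target :=
  (contDiffOn_density (g.smooth e he) fun _ hy => g.isHerm_inChart he hy).continuousOn

lemma density_pos (he : e ∈ atlas (Cn n) X) {y : Cn n} (hy : y ∈ e.target) :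
    0 < density (inChart g.form e y) :=
  Real.sqrt_pos.mpr (g.isHerm_inChart he hy).posDef.det_pos

variable [MeasurableSpace X] [BorelSpace X]

lemma chartVolume_apply (e : OpenPartialHomeomorph X (Cn n)) {A : Set X} (hA : MeasurableSet A) :
    g.chartVolume e A
      = ∫⁻ y in e.target ∩ e.symm ⁻¹' A, ENNReal.ofReal (density (inChart g.form e y)) := by
  rw [chartVolume, Measure.map_apply_of_aemeasurable
    ((aemeasurable_chart_symm e).mono_ac (withDensity_absolutelyContinuous _ _)) hA,
    withDensity_apply', Measure.restrict_restrict' e.open_target.measurableSet, Set.inter_comm]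
  rfl

lemma chartVolume_inter_source (e : OpenPartialHomeomorph X (Cn n)) {A : Set X}
    (hA : MeasurableSet A) : g.chartVolume e (A ∩ e.source) = g.chartVolume e A := by
  rw [chartVolume_apply _ _ hA, chartVolume_apply _ _ (hA.inter e.open_source.measurableSet)]
  congr 2
  ext y
  simp only [Set.mem_inter_iff, Set.mem_preimage]
  exact ⟨fun h => ⟨h.1, h.2.1⟩, fun h => ⟨h.1, h.2, e.map_target h.1⟩⟩

/-- The volume measures of two charts agree on their common domain. -/
lemma chartVolume_eq_of_subset (he : e ∈ atlas (Cn n) X) (he' : e' ∈ atlas (Cn n) X) {A : Set X}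
    (hA : MeasurableSet A) (h : A ⊆ e.source) (h' : A ⊆ e'.source) :
    g.chartVolume e A = g.chartVolume e' A := by
  rw [chartVolume_apply _ _ hA, chartVolume_apply _ _ hA]
  set s := e.target ∩ e.symm ⁻¹' A with hs
  have hms : MeasurableSet s := measurableSet_target_inter_preimage e hA
  have himg : (e' ∘ e.symm) '' s = e'.target ∩ e'.symm ⁻¹' A := by
    ext z
    constructor
    · rintro ⟨y, ⟨hy, hyA⟩, rfl⟩
      refine ⟨e'.map_source (h' hyA), ?_⟩
      simpa only [Set.mem_preimage, Function.comp_apply, e'.left_inv (h' hyA)] using hyA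
    · rintro ⟨hz, hzA⟩
      refine ⟨e (e'.symm z), ⟨e.map_source (h hzA), ?_⟩, ?_⟩
      · simpa only [Set.mem_preimage, e.left_inv (h hzA)] using hzA
      · simp only [Function.comp_apply]
        rw [e.left_inv (h hzA), e'.right_inv hz]
  have hinj : Set.InjOn (e' ∘ e.symm) s := by
    intro y hy z hz hyz
    have h1 := congrArg e'.symm hyz
    simp only [Function.comp_apply] at h1
    rw [e'.left_inv (h' hy.2), e'.left_inv (h' hz.2)] at h1
    rw [← e.right_inv hy.1, ← e.right_inv hz.1, h1]
  have hder : ∀ y ∈ s, HasFDerivWithinAt (e' ∘ e.symm) (fderiv ℝ (e' ∘ e.symm) y) s y :=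
    fun y hy => ((isHolAt_transition he he' hy.1
      (h' hy.2)).smooth.differentiableAt (by decide)).hasFDerivAt.hasFDerivWithinAt
  rw [← himg, lintegral_image_eq_lintegral_abs_det_fderiv_mul volume hms hder hinj]
  refine setLIntegral_congr_fun hms fun y hy => ?_
  rw [density_transition he he' g.form hy.1 (h' hy.2), ENNReal.ofReal_mul (abs_nonneg _)]

lemma vol_apply_of_subset (he : e ∈ atlas (Cn n) X) {A : Set X} (hA : MeasurableSet A)
    (h : A ⊆ e.source) : g.vol A = g.chartVolume e A := by
  refine le_antisymm ?_ ?_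
  · -- an upper bound of all chart volumes that is infinite outside of the chart
    let m : Measure X := g.chartVolume e + (⊤ : ENNReal) • Measure.count.restrict e.sourceᶜ
    have hm : g.vol ≤ m := by
      refine iSup₂_le fun e' he' => Measure.le_iff.mpr fun B hB => ?_
      have hse := e.open_source.measurableSet
      by_cases hBe : B ⊆ e.source
      · have hse' := e'.open_source.measurableSet
        calc g.chartVolume e' B = g.chartVolume e' (B ∩ e'.source) :=
              (g.chartVolume_inter_source e' hB).symm
          _ = g.chartVolume e (B ∩ e'.source) := g.chartVolume_eq_of_subset he' he
              (hB.inter hse') Set.inter_subset_right (Set.inter_subset_left.trans hBe)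
          _ ≤ g.chartVolume e B := measure_mono Set.inter_subset_left
          _ ≤ m B := by
              simp only [m, Measure.add_apply]
              exact le_self_add
      · have h1 : Measure.count (B ∩ e.sourceᶜ) ≠ 0 := by
          rw [Set.not_subset] at hBe
          obtain ⟨x, hx, hxe⟩ := hBe
          exact Measure.count_ne_zero ⟨x, hx, hxe⟩
        have h2 : m B = ⊤ := by
          simp only [m, Measure.add_apply, Measure.smul_apply, smul_eq_mul,
            Measure.restrict_apply hB, ENNReal.top_mul h1, add_top]
        rw [h2]
        exact le_top
    calc g.vol A ≤ m A := hm A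
      _ = g.chartVolume e A := by
        have h3 : A ∩ e.sourceᶜ = ∅ := by
          rw [← Set.sdiff_eq, Set.sdiff_eq_empty]; exact h
        simp only [m, Measure.add_apply, Measure.smul_apply, smul_eq_mul,
          Measure.restrict_apply hA, h3, measure_empty, mul_zero, add_zero]
  · exact le_iSup₂ (f := fun e (_ : e ∈ atlas (Cn n) X) => g.chartVolume e) e he A

lemma vol_restrict_source (he : e ∈ atlas (Cn n) X) :
    g.vol.restrict e.source = g.chartVolume e := by
  ext A hA
  rw [Measure.restrict_apply hA, g.vol_apply_of_subset he (hA.inter e.open_source.measurableSet)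
    Set.inter_subset_right, g.chartVolume_inter_source e hA]

/-- Integration over a chart. -/
lemma setIntegral_source (he : e ∈ atlas (Cn n) X) {F : X → ℂ} (hF : Continuous F) :
    ∫ x in e.source, F x ∂g.vol
      = ∫ y in e.target, (density (inChart g.form e y) : ℂ) * F (e.symm y) := by
  rw [g.vol_restrict_source he, chartVolume, integral_map
    ((aemeasurable_chart_symm e).mono_ac (withDensity_absolutelyContinuous _ _))
    hF.measurable.aestronglyMeasurable]
  have hm : AEMeasurable (fun y => ENNReal.ofReal (Real.sqrt (gram (inChart g.form e y)).det))
      ((volume : Measure (Cn n)).restrict e.target) :=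
    ((g.continuousOn_density he).aemeasurable e.open_target.measurableSet).ennreal_ofReal
  rw [integral_withDensity_eq_integral_toReal_smul₀ hm
    (Filter.Eventually.of_forall fun _ => ENNReal.ofReal_lt_top)]
  refine integral_congr_ae (Filter.Eventually.of_forall fun y => ?_)
  simp only [ENNReal.toReal_ofReal (Real.sqrt_nonneg _), Complex.real_smul]
  rfl

instance isLocallyFiniteMeasure_vol : IsLocallyFiniteMeasure g.vol := by
  refine ⟨fun x => ?_⟩
  set e := chartAt (Cn n) x with he_def
  have he : e ∈ atlas (Cn n) X := chart_mem_atlas _ _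
  have hx : x ∈ e.source := mem_chart_source _ _
  have hc : ContinuousAt (fun y => density (inChart g.form e y)) (e x) :=
    (g.continuousOn_density he).continuousAt (e.open_target.mem_nhds (e.map_source hx))
  set c := density (inChart g.form e (e x)) + 1 with hcdef
  have h1 : ∀ᶠ y in nhds (e x), density (inChart g.form e y) < c :=
    hc.eventually (gt_mem_nhds (by simp [hcdef]))
  obtain ⟨V, hV, hVo, hxV⟩ := eventually_nhds_iff.mp
    (h1.and (Metric.ball_mem_nhds (e x) one_pos : ∀ᶠ y in nhds (e x), y ∈ Metric.ball (e x) 1))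
  refine ⟨e.source ∩ e ⁻¹' V, Filter.inter_mem (e.open_source.mem_nhds hx)
    (e.continuousAt hx (hVo.mem_nhds hxV)), ?_⟩
  have hmeas : MeasurableSet (e.source ∩ e ⁻¹' V) :=
    (e.continuousOn.isOpen_inter_preimage e.open_source hVo).measurableSet
  rw [g.vol_apply_of_subset he hmeas Set.inter_subset_left, chartVolume_apply _ _ hmeas]
  have hsub : e.target ∩ e.symm ⁻¹' (e.source ∩ e ⁻¹' V) ⊆ V := by
    rintro y ⟨hy, -, hyV⟩
    simpa only [Set.mem_preimage, e.right_inv hy] using hyV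
  calc _ ≤ ∫⁻ y in V, ENNReal.ofReal (density (inChart g.form e y)) := lintegral_mono_set hsub
    _ ≤ ∫⁻ _ in V, ENNReal.ofReal c := setLIntegral_mono measurable_const fun y hy =>
        ENNReal.ofReal_le_ofReal (hV y hy).1.le
    _ = ENNReal.ofReal c * volume V := setLIntegral_const _ _
    _ ≤ ENNReal.ofReal c * volume (Metric.ball (e x) 1) := by
        gcongr; exact fun y hy => (hV y hy).2
    _ < ⊤ := ENNReal.mul_lt_top ENNReal.ofReal_lt_top measure_ball_lt_top

instance isOpenPosMeasure_vol : g.vol.IsOpenPosMeasure := by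
  refine ⟨fun U hU hne h0 => ?_⟩
  obtain ⟨x, hxU⟩ := hne
  set e := chartAt (Cn n) x with he_def
  have he : e ∈ atlas (Cn n) X := chart_mem_atlas _ _
  have hx : x ∈ e.source := mem_chart_source _ _
  have hmeas : MeasurableSet (U ∩ e.source) := (hU.inter e.open_source).measurableSet
  have h1 : g.vol (U ∩ e.source) = 0 := measure_mono_null Set.inter_subset_left h0
  rw [g.vol_apply_of_subset he hmeas Set.inter_subset_right, chartVolume_apply _ _ hmeas] at h1
  set s := e.target ∩ e.symm ⁻¹' (U ∩ e.source) with hs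
  have hso : IsOpen s := e.continuousOn_symm.isOpen_inter_preimage e.open_target
    (hU.inter e.open_source)
  have hxs : e x ∈ s := ⟨e.map_source hx, by
    simpa only [Set.mem_preimage, e.left_inv hx] using ⟨hxU, hx⟩⟩
  have hm : AEMeasurable (fun y => ENNReal.ofReal (density (inChart g.form e y)))
      ((volume : Measure (Cn n)).restrict s) :=
    (((g.continuousOn_density he).mono Set.inter_subset_left).aemeasurable
      hso.measurableSet).ennreal_ofReal
  rw [lintegral_eq_zero_iff' hm, Filter.EventuallyEq, ae_restrict_iff' hso.measurableSet] at h1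
  have h2 : ∀ᵐ y ∂(volume : Measure (Cn n)), y ∉ s := by
    filter_upwards [h1] with y hy hys
    have := hy hys
    rw [Pi.zero_apply, ENNReal.ofReal_eq_zero] at this
    exact absurd this (not_le.mpr (g.density_pos he hys.1))
  have h3 : volume s = 0 := by
    rw [ae_iff] at h2
    simpa using h2
  exact hso.measure_ne_zero volume ⟨_, hxs⟩ h3

section compact

variable [CompactSpace X]

lemma integrable_of_continuous {F : X → ℂ} (hF : Continuous F) : Integrable F g.vol :=
  hF.integrable_of_hasCompactSupport (HasCompactSupport.of_compactSpace _)

lemma l2Inner_eq {u v : Form n X} (hu : u.IsSmooth) (hv : v.IsSmooth) :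
    g.l2Inner u v = ∫ x, g.ptInner u v x ∂g.vol := by
  simp only [ptInner_eq]
  rw [integral_finsetSum _ fun k _ =>
    g.integrable_of_continuous (g.continuous_fiberInner (hu k) (hv k))]
  rfl

lemma integrable_ptInner {u v : Form n X} (hu : u.IsSmooth) (hv : v.IsSmooth) :
    Integrable (g.ptInner u v) g.vol := g.integrable_of_continuous (g.continuous_ptInner hu hv)

end compact

end HermitianMetric

end HermitianForms
end

noncomputable section

namespace HermitianForms

variable {n : ℕ} {X : Type*} [TopologicalSpace X] [ChartedSpace (Cn n) X]

/-! ### The space of smooth forms and the `L²` inner product -/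

variable (n X) in
/-- The space of smooth forms of mixed degree. -/
def smoothForms : Submodule ℂ (Form n X) where
  carrier := {u | u.IsSmooth}
  add_mem' hu hv := hu.add hv
  zero_mem' := fun _ => isSmooth_zero
  smul_mem' c _ hu := hu.smul c

-- A shortcut, so that the subtraction of endomorphisms is found.
instance : AddCommGroup (smoothForms n X) := (smoothForms n X).addCommGroup

variable (n X) in
/-- Linear endomorphisms of the space of smooth forms. -/
abbrev SmoothEnd : Type _ := Module.End ℂ (smoothForms n X)

-- Shortcuts, so that all lemmas on rings see the same negation.
instance : Ring (SmoothEnd n X) := inferInstance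
instance : Neg (SmoothEnd n X) := Ring.toNeg

/-- A linear endomorphism of the space of smooth forms from an operator that is linear on smooth
forms. -/
def smoothEnd (T : Op n X) (hT : ∀ u : Form n X, u.IsSmooth → Form.IsSmooth (T u))
    (hlin : ∀ (u v : Form n X) (c : ℂ), u.IsSmooth → v.IsSmooth → T (u + c • v) = T u + c • T v) :
    SmoothEnd n X where
  toFun u := ⟨T u, hT u u.2⟩
  map_add' u v := Subtype.ext (by
    have := hlin u v 1 u.2 v.2
    rwa [one_smul, one_smul] at this)
  map_smul' c u := Subtype.ext (by
    have h0 : T 0 = 0 := by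
      have := hlin 0 0 1 (smoothForms n X).zero_mem (smoothForms n X).zero_mem
      rw [one_smul, one_smul, add_zero] at this
      exact left_eq_add.mp this
    have := hlin 0 u c (smoothForms n X).zero_mem u.2
    rwa [zero_add, h0, zero_add] at this)

lemma twistedDeriv_add_smul (A : Cn n →L[ℝ] Cn n) {k : ℕ} {α β : Cn n → Alt n k} {y : Cn n}
    (c : ℂ) (hα : DifferentiableAt ℝ α y) (hβ : DifferentiableAt ℝ β y) :
    twistedDeriv A (fun z => α z + c • β z) y = twistedDeriv A α y + c • twistedDeriv A β y := by
  have := twistedDeriv_comb A 1 c hα hβ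
  simpa only [one_smul] using this

lemma del_add_smul {k : ℕ} {α β : KForm n X k} (c : ℂ) (hα : α.IsSmooth) (hβ : β.IsSmooth) :
    del (α + c • β) = del α + c • del β := by
  funext x
  have h1 := (hα.contDiffAt (chart_mem_atlas _ x) (mem_chart_target _ x)).differentiableAt
    (by decide)
  have h2 := (hβ.contDiffAt (chart_mem_atlas _ x) (mem_chart_target _ x)).differentiableAt
    (by decide)
  change ldel (fun y => inChart α _ y + c • inChart β _ y) _ = ldel _ _ + c • ldel _ _
  simp only [ldel_eq, twistedDeriv_add_smul _ c h1 h2]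
  module

lemma delbar_add_smul {k : ℕ} {α β : KForm n X k} (c : ℂ) (hα : α.IsSmooth) (hβ : β.IsSmooth) :
    delbar (α + c • β) = delbar α + c • delbar β := by
  funext x
  have h1 := (hα.contDiffAt (chart_mem_atlas _ x) (mem_chart_target _ x)).differentiableAt
    (by decide)
  have h2 := (hβ.contDiffAt (chart_mem_atlas _ x) (mem_chart_target _ x)).differentiableAt
    (by decide)
  change ldelbar (fun y => inChart α _ y + c • inChart β _ y) _ = ldelbar _ _ + c • ldelbar _ _
  simp only [ldelbar_eq, twistedDeriv_add_smul _ c h1 h2]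
  module

variable [IsManifold 𝓘(ℂ, Cn n) ω X]

variable (n X) in
/-- The operator `∂` on smooth forms. -/
def delEnd : SmoothEnd n X := smoothEnd delOp (fun _ hu => hu.delOp)
  (fun u v c hu hv => funext fun k => by
    rcases k with _ | k
    · exact (add_zero (0 : KForm n X 0)).symm.trans
        (congrArg (fun w => (0 : KForm n X 0) + w) (smul_zero c).symm)
    · exact del_add_smul c (hu k) (hv k))

variable (n X) in
/-- The operator `∂̄` on smooth forms. -/
def delbarEnd : SmoothEnd n X := smoothEnd delbarOp (fun _ hu => hu.delbarOp)
  (fun u v c hu hv => funext fun k => by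
    rcases k with _ | k
    · exact (add_zero (0 : KForm n X 0)).symm.trans
        (congrArg (fun w => (0 : KForm n X 0) + w) (smul_zero c).symm)
    · exact delbar_add_smul c (hu k) (hv k))

/-- The exterior multiplication by a smooth form, on smooth forms. -/
def extEnd {p : ℕ} (η : KForm n X p) (hη : η.IsSmooth) : SmoothEnd n X :=
  smoothEnd (extMul η) (fun _ hu => hu.extMul hη) (fun u v c _ _ => form_ext_at fun x => by
    change _ = (extMul η u).at x + c • (extMul η v).at x
    rw [extMul_at, extMul_at, extMul_at, ← map_smul, ← map_add]
    rfl)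

namespace HermitianMetric

variable (g : HermitianMetric n X)

/-- The contraction with a smooth form, on smooth forms. -/
def contrEnd {p : ℕ} (η : KForm n X p) (hη : η.IsSmooth) : SmoothEnd n X :=
  smoothEnd (g.contrMul η) (fun _ hu => g.isSmooth_contrMul hη hu)
    (fun u v c _ _ => form_ext_at fun x => by
      change _ = (g.contrMul η u).at x + c • (g.contrMul η v).at x
      rw [contrMul_at, contrMul_at, contrMul_at, ← map_smul, ← map_add]
      rfl)

variable [CompactSpace X] [MeasurableSpace X] [BorelSpace X]

open MeasureTheory

/-- The `L²` inner product of smooth forms. -/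
def l2 : smoothForms n X →ₗ[ℂ] smoothForms n X →ₛₗ[starRingEnd ℂ] ℂ :=
  LinearMap.mk₂'ₛₗ (RingHom.id ℂ) (starRingEnd ℂ) (fun u v => g.l2Inner u v)
    (fun u u' v => by
      rw [g.l2Inner_eq u.2 v.2, g.l2Inner_eq u'.2 v.2, g.l2Inner_eq (u + u').2 v.2,
        ← integral_add (g.integrable_ptInner u.2 v.2) (g.integrable_ptInner u'.2 v.2)]
      congr 1; funext x
      exact (congrArg (fun w => w ((v : Form n X).at x))
        ((fibInner (gramInv (g.form x))).map_add _ _)))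
    (fun c u v => by
      rw [g.l2Inner_eq u.2 v.2, g.l2Inner_eq (c • u).2 v.2, smul_eq_mul, RingHom.id_apply,
        ← integral_const_mul]
      congr 1; funext x
      exact (congrArg (fun w => w ((v : Form n X).at x))
        ((fibInner (gramInv (g.form x))).map_smul _ _)))
    (fun u v v' => by
      rw [g.l2Inner_eq u.2 v.2, g.l2Inner_eq u.2 v'.2, g.l2Inner_eq u.2 (v + v').2,
        ← integral_add (g.integrable_ptInner u.2 v.2) (g.integrable_ptInner u.2 v'.2)]
      congr 1; funext x
      exact (fibInner (gramInv (g.form x)) _).map_add _ _)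
    (fun c u v => by
      rw [g.l2Inner_eq u.2 v.2, g.l2Inner_eq u.2 (c • v).2, smul_eq_mul, ← integral_const_mul]
      congr 1; funext x
      exact (fibInner (gramInv (g.form x)) _).map_smulₛₗ _ _)

lemma l2_eq (u v : smoothForms n X) : g.l2 u v = ∫ x, g.ptInner u v x ∂g.vol :=
  g.l2Inner_eq u.2 v.2

lemma conj_l2 (u v : smoothForms n X) : (starRingEnd ℂ) (g.l2 u v) = g.l2 v u := by
  rw [l2_eq, l2_eq, ← integral_conj]
  simp only [conj_ptInner]

lemma l2_self_eq (u : smoothForms n X) :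
    g.l2 u u = ((∫ x, (g.ptInner u u x).re ∂g.vol : ℝ) : ℂ) := by
  rw [l2_eq, ← integral_complex_ofReal]
  congr 1
  funext x
  exact g.ptInner_self_eq u x

open ComplexOrder in
lemma l2_self_nonneg (u : smoothForms n X) : 0 ≤ g.l2 u u := by
  rw [l2_self_eq]
  exact Complex.zero_le_real.mpr (integral_nonneg fun x => g.ptInner_self_re_nonneg _ x)

lemma eq_zero_of_l2_self {u : smoothForms n X} (h : g.l2 u u = 0) : u = 0 := by
  have hc : Continuous fun x => (g.ptInner u u x).re :=
    Complex.continuous_re.comp (g.continuous_ptInner u.2 u.2)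
  rw [l2_self_eq, Complex.ofReal_eq_zero, integral_eq_zero_iff_of_nonneg
    (fun x => g.ptInner_self_re_nonneg _ x) (g.integrable_ptInner u.2 u.2).re] at h
  have h2 := (Continuous.ae_eq_iff_eq g.vol hc continuous_zero).mp h
  refine Subtype.ext (form_ext_at fun x => ?_)
  refine eq_zero_of_fibInner_self (g.isHerm x).posDef_inv ?_
  change g.ptInner u u x = 0
  rw [ptInner_self_eq, congrFun h2 x]
  simp

/-- `S` is a formal adjoint of `T`. -/
def IsL2Adj (T S : SmoothEnd n X) : Prop :=
  ∀ u v, g.l2 (T u) v = g.l2 u (S v)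

variable {g}

namespace IsL2Adj

variable {T T' S S' : SmoothEnd n X}

lemma add (h : g.IsL2Adj T S) (h' : g.IsL2Adj T' S') : g.IsL2Adj (T + T') (S + S') := by
  intro u v
  rw [LinearMap.add_apply, LinearMap.add_apply, map_add, map_add, LinearMap.add_apply, h, h']

lemma sub (h : g.IsL2Adj T S) (h' : g.IsL2Adj T' S') : g.IsL2Adj (T - T') (S - S') := by
  intro u v
  rw [LinearMap.sub_apply, LinearMap.sub_apply, map_sub, map_sub, LinearMap.sub_apply, h, h']

lemma smul (c : ℂ) (h : g.IsL2Adj T S) : g.IsL2Adj (c • T) ((starRingEnd ℂ) c • S) := by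
  intro u v
  rw [LinearMap.smul_apply, LinearMap.smul_apply, map_smul, LinearMap.map_smulₛₗ,
    LinearMap.smul_apply, h, Complex.conj_conj]

lemma mul (h : g.IsL2Adj T S) (h' : g.IsL2Adj T' S') : g.IsL2Adj (T * T') (S' * S) := by
  intro u v
  rw [Module.End.mul_apply, Module.End.mul_apply, h, h']

lemma symm (h : g.IsL2Adj T S) : g.IsL2Adj S T := by
  intro u v
  rw [← conj_l2, ← h, conj_l2]

lemma unique (h : g.IsL2Adj T S) (h' : g.IsL2Adj T S') : S = S' := by
  ext1 v
  rw [← sub_eq_zero]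
  refine g.eq_zero_of_l2_self ?_
  rw [map_sub, ← h, ← h', sub_self]

end IsL2Adj

lemma isL2Adj_ext {p : ℕ} {η : KForm n X p} (hη : η.IsSmooth) :
    g.IsL2Adj (extEnd η hη) (g.contrEnd η hη) := by
  intro u v
  rw [l2_eq, l2_eq]
  congr 1
  funext x
  exact g.ptInner_extMul η u v x

end HermitianMetric

end HermitianForms
end

noncomputable section

namespace HermitianForms

variable {n : ℕ}

/-! ### Integration by parts -/

open MeasureTheory

lemma integral_fderiv_eq_zero {Φ : Cn n → ℂ} (hΦ : ContDiff ℝ ∞ Φ) (hc : HasCompactSupport Φ)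
    (v : Cn n) : ∫ y, fderiv ℝ Φ y v = 0 := by
  have hd : Continuous fun y => fderiv ℝ Φ y v :=
    (hΦ.continuous_fderiv (by decide)).clm_apply continuous_const
  have hi : Integrable (fun y => fderiv ℝ Φ y v) :=
    hd.integrable_of_hasCompactSupport (hc.fderiv_apply ℝ v)
  have := integral_mul_fderiv_eq_neg_fderiv_mul_of_integrable (μ := (volume : Measure (Cn n)))
    (f := fun _ => (1 : ℂ)) (g := Φ) (v := v) (by simp) (by simpa using hi)
    (by simpa using hΦ.continuous.integrable_of_hasCompactSupport hc)
    (fun _ _ => differentiableAt_const _) (fun _ _ => hΦ.differentiable (by decide) _)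
  simpa using this

/-- Extension by zero of a function with compact support in an open set. -/
lemma contDiff_indicator {U K : Set (Cn n)} (hU : IsOpen U) (hK : IsClosed K) (hKU : K ⊆ U)
    {Φ : Cn n → ℂ} (hΦ : ContDiffOn ℝ ∞ Φ U) (h0 : ∀ y ∈ U, y ∉ K → Φ y = 0) :
    ContDiff ℝ ∞ (U.indicator Φ) := by
  rw [contDiff_iff_contDiffAt]
  intro y
  by_cases hy : y ∈ U
  · refine (hΦ.contDiffAt (hU.mem_nhds hy)).congr_of_eventuallyEq ?_
    filter_upwards [hU.mem_nhds hy] with z hz using Set.indicator_of_mem hz _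
  · refine (contDiffAt_const (c := (0 : ℂ))).congr_of_eventuallyEq ?_
    filter_upwards [hK.isOpen_compl.mem_nhds fun h => hy (hKU h)] with z hz
    by_cases hzU : z ∈ U
    · rw [Set.indicator_of_mem hzU, h0 z hzU hz]
    · exact Set.indicator_of_notMem hzU _

variable {X : Type*} [TopologicalSpace X] [ChartedSpace (Cn n) X]

lemma delbarOp_at_eq_zero {u : Form n X} {x : X} (h : ∀ᶠ z in nhds x, u.at z = 0) :
    (delbarOp u).at x = 0 := by
  funext k
  rcases k with _ | k
  · rfl
  · set c := chartAt (Cn n) x with hc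
    have hx : c x ∈ c.target := mem_chart_target _ _
    have h1 : inChart (u k) c =ᶠ[nhds (c x)] fun _ => 0 := by
      have hcont : ContinuousAt c.symm (c x) := c.continuousAt_symm hx
      have h2 : ∀ᶠ y in nhds (c x), u.at (c.symm y) = 0 := by
        have h3 : ∀ᶠ z in nhds (c.symm (c x)), u.at z = 0 := by
          rwa [c.left_inv (mem_chart_source _ _)]
        exact hcont.tendsto.eventually h3
      filter_upwards [h2] with y hy
      have h3 : u k (c.symm y) = 0 := congrFun hy k
      rw [inChart_apply, h3]
      rfl
    change ldelbar (inChart (u k) c) (c x) = 0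
    have h4 : antiPart (0 : Cn n →L[ℝ] Alt n k) = 0 := by
      ext1 v
      change (1 / 2 : ℂ) • ((0 : Alt n k) + Complex.I • (0 : Alt n k)) = 0
      have hz : ∀ c : ℂ, c • (0 : Alt n k) = 0 := fun c => smul_zero (M := ℂ) (A := Alt n k) c
      rw [hz, add_zero, hz]
    rw [ldelbar, h1.fderiv_eq, fderiv_fun_const, Pi.zero_apply, h4]
    exact map_zero (ContinuousAlternatingMap.alternatizeUncurryFinCLM ℝ (Cn n) ℂ)

namespace HermitianMetric

variable [IsManifold 𝓘(ℂ, Cn n) ω X] (g : HermitianMetric n X)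
  [MeasurableSpace X] [BorelSpace X] [T2Space X]

/-- Integration by parts for a form with support in a chart. -/
lemma integral_delbarOp_of_support {e : OpenPartialHomeomorph X (Cn n)}
    (he : e ∈ atlas (Cn n) X) {u v : Form n X} (hu : u.IsSmooth) (hv : v.IsSmooth) {K : Set X}
    (hK : IsCompact K) (hKe : K ⊆ e.source) (h0 : ∀ x ∉ K, u.at x = 0) :
    ∫ x, (g.ptInner (delbarOp u) v x - g.ptInner u (g.delbarStar v) x) ∂g.vol = 0 := by
  have hsu := Form.isSmooth_iff.mp hu e he
  have hsv := Form.isSmooth_iff.mp hv e he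
  have hH : ∀ y ∈ e.target, IsHerm (inChart g.form e y) := fun y hy => g.isHerm_inChart he hy
  have hθ := g.smooth e he
  have hF : Continuous fun x => g.ptInner (delbarOp u) v x - g.ptInner u (g.delbarStar v) x :=
    (g.continuous_ptInner hu.delbarOp hv).sub (g.continuous_ptInner hu (g.isSmooth_delbarStar hv))
  have hout : ∀ x, x ∉ e.source →
      g.ptInner (delbarOp u) v x - g.ptInner u (g.delbarStar v) x = 0 := by
    intro x hx
    have hxK : x ∉ K := fun h => hx (hKe h)
    have h1 : (delbarOp u).at x = 0 := delbarOp_at_eq_zero (by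
      filter_upwards [hK.isClosed.isOpen_compl.mem_nhds hxK] with z hz using h0 z hz)
    rw [ptInner, ptInner, h1, h0 x hxK, map_zero, LinearMap.zero_apply, LinearMap.zero_apply,
      sub_zero]
  rw [← setIntegral_eq_integral_of_forall_compl_eq_zero hout, g.setIntegral_source he hF]
  let Φ : Idx n → Cn n → ℂ := fun a z => (density (inChart g.form e z) : ℂ) *
    fibInner (gramInv (inChart g.form e z)) (part01 (cplx (matJ n)) eps a (u.inChart e z))
      (v.inChart e z)
  have hΦs : ∀ a, ContDiffOn ℝ ∞ (Φ a) e.target := by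
    intro a
    refine (Complex.ofRealCLM.contDiff.comp_contDiffOn (contDiffOn_density hθ hH)).mul
      (contDiffOn_fibInner (contDiffOn_gramInv hθ hH) (fun k => ?_) hsv)
    exact hsu.part01 a k
  have hKimg : IsCompact (e '' K) := hK.image_of_continuousOn (e.continuousOn.mono hKe)
  have hKt : e '' K ⊆ e.target := by
    rintro _ ⟨x, hx, rfl⟩
    exact e.map_source (hKe hx)
  have hΦ0 : ∀ a, ∀ y ∈ e.target, y ∉ e '' K → Φ a y = 0 := by
    intro a y hy hyK
    have h1 : e.symm y ∉ K := fun h => hyK ⟨_, h, e.right_inv hy⟩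
    have h2 : u.inChart e y = 0 := by
      rw [Form.inChart_eq_pull, h0 _ h1, map_zero]
    simp only [Φ, h2, map_zero, LinearMap.zero_apply, mul_zero]
  have hsm := fun a => contDiff_indicator e.open_target hKimg.isClosed hKt (hΦs a) (hΦ0 a)
  have hcs : ∀ a, HasCompactSupport (e.target.indicator (Φ a)) := by
    intro a
    refine HasCompactSupport.intro hKimg fun y hy => ?_
    by_cases hyU : y ∈ e.target
    · rw [Set.indicator_of_mem hyU, hΦ0 a y hyU hy]
    · exact Set.indicator_of_notMem hyU _
  have hfd : ∀ y ∈ e.target, ∀ a, fderiv ℝ (e.target.indicator (Φ a)) y = fderiv ℝ (Φ a) y := by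
    intro y hy a
    refine Filter.EventuallyEq.fderiv_eq ?_
    filter_upwards [e.open_target.mem_nhds hy] with z hz using Set.indicator_of_mem hz _
  have hdiv : ∀ y ∈ e.target, (density (inChart g.form e y) : ℂ) *
      (g.ptInner (delbarOp u) v (e.symm y) - g.ptInner u (g.delbarStar v) (e.symm y))
      = ∑ a, fderiv ℝ (e.target.indicator (Φ a)) y (realBasis n a) := by
    intro y hy
    have h1 := divergence_identity e.open_target hθ hH hy hsu hsv
    rw [← inChart_delbarOp he hu hy, ← g.inChart_delbarStar he hv hy, g.ptInner_inChart he _ _ hy,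
      g.ptInner_inChart he _ _ hy] at h1
    rw [← h1]
    exact Finset.sum_congr rfl fun a _ => by rw [hfd y hy a]
  have hzero : ∀ y, y ∉ e.target →
      ∑ a, fderiv ℝ (e.target.indicator (Φ a)) y (realBasis n a) = 0 := by
    intro y hy
    refine Finset.sum_eq_zero fun a _ => ?_
    have h1 : e.target.indicator (Φ a) =ᶠ[nhds y] fun _ => 0 := by
      filter_upwards [hKimg.isClosed.isOpen_compl.mem_nhds fun h => hy (hKt h)] with z hz
      by_cases hzU : z ∈ e.target
      · rw [Set.indicator_of_mem hzU, hΦ0 a z hzU hz]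
      · exact Set.indicator_of_notMem hzU _
    rw [h1.fderiv_eq, fderiv_fun_const]
    rfl
  rw [setIntegral_congr_fun e.open_target.measurableSet hdiv,
    setIntegral_eq_integral_of_forall_compl_eq_zero hzero, integral_finsetSum]
  · exact Finset.sum_eq_zero fun a _ => integral_fderiv_eq_zero (hsm a) (hcs a) _
  · intro a _
    exact (((hsm a).continuous_fderiv (by decide)).clm_apply
      continuous_const).integrable_of_hasCompactSupport ((hcs a).fderiv_apply ℝ _)

end HermitianMetric

lemma isSmooth_smul_of_contMDiff [IsManifold 𝓘(ℂ, Cn n) ω X] {f : X → ℝ}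
    (hf : ContMDiff 𝓘(ℝ, Cn n) 𝓘(ℝ) ∞ f) {u : Form n X} (hu : u.IsSmooth) :
    Form.IsSmooth (fun k x => (f x : ℂ) • u k x : Form n X) := by
  have : IsManifold 𝓘(ℝ, Cn n) ∞ X := isManifold_real
  intro k e he
  have h1 : ContDiffOn ℝ ∞ (f ∘ e.symm) e.target := by
    rw [← contMDiffOn_iff_contDiffOn]
    exact hf.comp_contMDiffOn
      (contMDiffOn_symm_of_mem_maximalAtlas (IsManifold.subset_maximalAtlas he))
  have h2 : ContDiffOn ℝ ∞ (fun y => ((f (e.symm y) : ℝ) : ℂ)) e.target :=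
    Complex.ofRealCLM.contDiff.comp_contDiffOn h1
  exact h2.smul (hu k e he)

namespace HermitianMetric

variable [IsManifold 𝓘(ℂ, Cn n) ω X] (g : HermitianMetric n X)
  [MeasurableSpace X] [BorelSpace X] [T2Space X] [CompactSpace X]

/-- The operator `∂̄*` on smooth forms. -/
def delbarStarEnd : SmoothEnd n X :=
  (-Complex.I) • (g.contrEnd g.form g.smooth * delEnd n X - delEnd n X * g.contrEnd g.form g.smooth)
    - (g.contrEnd (delbar g.form) (KForm.IsSmooth.delbar g.smooth) * extEnd g.form g.smooth
      - extEnd g.form g.smooth * g.contrEnd (delbar g.form) (KForm.IsSmooth.delbar g.smooth))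

/-- Integration by parts: `∂̄*` is the formal adjoint of `∂̄`. -/
lemma isL2Adj_delbar : g.IsL2Adj (delbarEnd n X) g.delbarStarEnd := by
  have : IsManifold 𝓘(ℝ, Cn n) ∞ X := isManifold_real
  obtain ⟨t, ht⟩ := isCompact_univ.elim_nhds_subcover
    (fun x : X => (chartAt (Cn n) x).source) fun x _ =>
      (chartAt (Cn n) x).open_source.mem_nhds (mem_chart_source _ _)
  obtain ⟨f, hf⟩ := SmoothPartitionOfUnity.exists_isSubordinate (ι := t) 𝓘(ℝ, Cn n) isClosed_univ
    (fun i => (chartAt (Cn n) (i : X)).source) (fun i => (chartAt (Cn n) (i : X)).open_source)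
    (by simpa [Set.iUnion_subtype] using ht.2)
  intro u v
  let w : t → smoothForms n X := fun i =>
    ⟨fun k x => (f i x : ℂ) • (u : Form n X) k x, isSmooth_smul_of_contMDiff (f i).contMDiff u.2⟩
  have hw : ∑ i, w i = u := by
    refine Subtype.ext (funext fun k => funext fun x => ?_)
    have h1 : ∑ i, f i x = 1 := by
      rw [← finsum_eq_sum_of_fintype]
      exact f.sum_eq_one (Set.mem_univ x)
    rw [AddSubmonoidClass.coe_finsetSum, Finset.sum_apply, Finset.sum_apply]
    change ∑ i, (f i x : ℂ) • (u : Form n X) k x = _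
    rw [← Finset.sum_smul, ← Complex.ofReal_sum, h1, Complex.ofReal_one, one_smul]
  have hi : ∀ i, g.l2 (delbarEnd n X (w i)) v = g.l2 (w i) (g.delbarStarEnd v) := by
    intro i
    have h1 := g.integral_delbarOp_of_support (chart_mem_atlas (Cn n) (i : X)) (w i).2 v.2
      (isClosed_tsupport (f i)).isCompact (hf i) (fun x hx => by
        funext k
        change (f i x : ℂ) • (u : Form n X) k x = 0
        rw [image_eq_zero_of_notMem_tsupport hx, Complex.ofReal_zero]
        exact zero_smul ℂ ((u : Form n X) k x))
    rw [integral_sub (g.integrable_ptInner (w i).2.delbarOp v.2)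
      (g.integrable_ptInner (w i).2 (g.isSmooth_delbarStar v.2)), sub_eq_zero] at h1
    rw [l2_eq, l2_eq]
    exact h1
  rw [← hw]
  simp only [map_sum, LinearMap.sum_apply, hi]

end HermitianMetric

end HermitianForms
end

noncomputable section

namespace HermitianForms

/-! ### The algebra of the Bochner–Kodaira–Nakano identity -/

section algebra

variable {R : Type*} [Ring R] [Algebra ℂ R] {dl db dls dbs tb tbs ts Lam N Ns : R}

/-- The Bochner–Kodaira–Nakano identity for an SKT metric, deduced from the commutation relations
of its ingredients: `dl`, `db` stand for `∂`, `∂̄` and `dls`, `dbs` for their adjoints, `tb` for the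
torsion operator `τ̄ = [Λ, N]`, `N` for the multiplication by `∂̄ω`, and `tbs`, `ts`, `Ns` for the
adjoints of `τ̄`, `τ`, `N`. The hypothesis `hN`, saying that `∂` and `∂̄ω` anticommute, is the SKT
condition. -/
lemma bochner_kodaira_nakano
    (hdls : dls = Complex.I • (Lam * db - db * Lam) - ts)
    (hdbs : dbs = (-Complex.I) • (Lam * dl - dl * Lam) - tbs)
    (htb : tb = Lam * N - N * Lam)
    (hts : Lam * tb - tb * Lam = (2 * Complex.I) • ts)
    (h1 : Lam * dbs - dbs * Lam = Ns)
    (h2 : Lam * tbs - tbs * Lam = -(3 : ℂ) • Ns)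
    (hN : dl * N + N * dl = 0) (hd : dl * db + db * dl = 0) :
    (db + tb) * (dbs + tbs) + (dbs + tbs) * (db + tb)
      = dl * dls + dls * dl + (N * Ns + Ns * N) := by
  obtain ⟨P, hP⟩ : ∃ P, P = Lam * dl - dl * Lam := ⟨_, rfl⟩
  obtain ⟨Q, hQ⟩ : ∃ Q, Q = Lam * db - db * Lam := ⟨_, rfl⟩
  have hA : dbs + tbs = (-Complex.I) • P := by rw [hdbs, hP]; module
  have hts' : ts = (-Complex.I / 2) • (Lam * tb - tb * Lam) := by
    rw [hts, smul_smul]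
    have : -Complex.I / 2 * (2 * Complex.I) = 1 := by linear_combination -Complex.I_mul_I
    rw [this, one_smul]
  have hPL : Lam * P - P * Lam = (-(2 * Complex.I)) • Ns := by
    have h3 : P = Complex.I • (dbs + tbs) := by
      rw [hA, smul_smul]
      have : Complex.I * -Complex.I = 1 := by linear_combination -Complex.I_mul_I
      rw [this, one_smul]
    have h4 : Lam * (dbs + tbs) - (dbs + tbs) * Lam = (-(2 : ℂ)) • Ns := by
      have : Lam * (dbs + tbs) - (dbs + tbs) * Lam
        = (Lam * dbs - dbs * Lam) + (Lam * tbs - tbs * Lam) := by noncomm_ring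
      rw [this, h1, h2]
      module
    rw [h3, mul_smul_comm, smul_mul_assoc, ← smul_sub, h4, smul_smul]
    congr 1
    ring
  -- the commutator of `Λ` with `[∂, ∂̄] = 0`
  have e1 : (db * P + P * db) + (dl * Q + Q * dl) = 0 := by
    have : (db * P + P * db) + (dl * Q + Q * dl)
        = Lam * (dl * db + db * dl) - (dl * db + db * dl) * Lam := by
      rw [hP, hQ]; noncomm_ring
    rw [this, hd, mul_zero, zero_mul, sub_zero]
  -- the iterated commutator of `Λ` with `[∂, N] = 0`
  have e2 : (tb * dl + dl * tb) + (N * P + P * N) = 0 := by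
    have : (tb * dl + dl * tb) + (N * P + P * N)
        = Lam * (dl * N + N * dl) - (dl * N + N * dl) * Lam := by
      rw [hP, htb]; noncomm_ring
    rw [this, hN, mul_zero, zero_mul, sub_zero]
  have e3 : ((Lam * tb - tb * Lam) * dl + dl * (Lam * tb - tb * Lam)) + (2 : ℂ) • (tb * P + P * tb)
      + (N * (Lam * P - P * Lam) + (Lam * P - P * Lam) * N) = 0 := by
    have : ((Lam * tb - tb * Lam) * dl + dl * (Lam * tb - tb * Lam)) + (2 : ℂ) • (tb * P + P * tb)
        + (N * (Lam * P - P * Lam) + (Lam * P - P * Lam) * N)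
        = Lam * ((tb * dl + dl * tb) + (N * P + P * N))
          - ((tb * dl + dl * tb) + (N * P + P * N)) * Lam := by
      have h5 : Lam * N - N * Lam = tb := htb.symm
      have h6 : Lam * dl - dl * Lam = P := hP.symm
      have h7 : Lam * N = tb + N * Lam := by rw [← h5]; noncomm_ring
      have h8 : Lam * dl = P + dl * Lam := by rw [← h6]; noncomm_ring
      have h9 : N * Lam = Lam * N - tb := by rw [← h5]; noncomm_ring
      have h10 : dl * Lam = Lam * dl - P := by rw [← h6]; noncomm_ring
      have k1 : Lam * (tb * dl) - tb * dl * Lam = (Lam * tb - tb * Lam) * dl + tb * P := by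
        rw [hP]; noncomm_ring
      have k2 : Lam * (dl * tb) - dl * tb * Lam = dl * (Lam * tb - tb * Lam) + P * tb := by
        rw [hP]; noncomm_ring
      have k3 : Lam * (N * P) - N * P * Lam = N * (Lam * P - P * Lam) + tb * P := by
        rw [htb]; noncomm_ring
      have k4 : Lam * (P * N) - P * N * Lam = (Lam * P - P * Lam) * N + P * tb := by
        rw [htb]; noncomm_ring
      have k : Lam * ((tb * dl + dl * tb) + (N * P + P * N))
          - ((tb * dl + dl * tb) + (N * P + P * N)) * Lam
          = (Lam * (tb * dl) - tb * dl * Lam) + (Lam * (dl * tb) - dl * tb * Lam)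
          + (Lam * (N * P) - N * P * Lam) + (Lam * (P * N) - P * N * Lam) := by noncomm_ring
      rw [k, k1, k2, k3, k4]
      module
    rw [this, e2, mul_zero, zero_mul, sub_zero]
  rw [hPL] at e3
  rw [hA, hdls, ← hQ, hts']
  generalize Lam * tb - tb * Lam = W at e3 ⊢
  simp only [add_mul, mul_add, sub_mul, mul_sub, smul_mul_assoc, mul_smul_comm] at e1 e3 ⊢
  linear_combination (norm := skip) (-Complex.I) • e1 + (-Complex.I / 2) • e3
  match_scalars <;>
    first
      | ring1
      | linear_combination (-1 : ℂ) * Complex.I_mul_I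

/-- With the Bochner–Kodaira–Nakano identity, the difference of the two sides of the comparison of
the Laplacians is a combination, with nonnegative coefficients, of squares: that of `h∂ + ∂̄` and
that of `(1 - h)∂̄ - hτ̄`. -/
lemma laplacian_comparison (h : ℂ)
    (key : (db + tb) * (dbs + tbs) + (dbs + tbs) * (db + tb)
      = dl * dls + dls * dl + (N * Ns + Ns * N)) :
    ((h • dl + db) * (h • dls + dbs) + (h • dls + dbs) * (h • dl + db))
      - h ^ 2 • ((dl + db) * (dls + dbs) + (dls + dbs) * (dl + db))
      - h ^ 2 • ((1 - h) • (N * Ns + Ns * N) - (tb * tbs + tbs * tb))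
    = (1 - h) • ((h • dl + db) * (h • dls + dbs) + (h • dls + dbs) * (h • dl + db))
      + h • (((1 - h) • db - h • tb) * ((1 - h) • dbs - h • tbs)
        + ((1 - h) • dbs - h • tbs) * ((1 - h) • db - h • tb)) := by
  simp only [add_mul, mul_add, sub_mul, mul_sub, smul_mul_assoc, mul_smul_comm] at key ⊢
  linear_combination (norm := module) (h ^ 2 * (1 - h)) • key

end algebra

variable {n : ℕ} {X : Type*} [TopologicalSpace X] [ChartedSpace (Cn n) X]

/-! ### Complex conjugation of operators -/

/-- Complex conjugation of smooth forms. -/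
def conjSmooth (u : smoothForms n X) : smoothForms n X := ⟨conjForm u, u.2.conjForm⟩

lemma conjSmooth_conjSmooth (u : smoothForms n X) : conjSmooth (conjSmooth u) = u :=
  Subtype.ext (conjForm_conjForm _)

lemma conjSmooth_add (u v : smoothForms n X) :
    conjSmooth (u + v) = conjSmooth u + conjSmooth v := Subtype.ext (conjForm_add _ _)

lemma conjSmooth_smul (c : ℂ) (u : smoothForms n X) :
    conjSmooth (c • u) = (starRingEnd ℂ) c • conjSmooth u := Subtype.ext (conjForm_smul _ _)

lemma conjSmooth_sub (u v : smoothForms n X) :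
    conjSmooth (u - v) = conjSmooth u - conjSmooth v := by
  rw [sub_eq_add_neg, ← neg_one_smul ℂ v, conjSmooth_add, conjSmooth_smul, map_neg, map_one,
    neg_one_smul, ← sub_eq_add_neg]

/-- The complex conjugate `u ↦ conj (T (conj u))` of an endomorphism of the space of smooth
forms. -/
def conjEnd (T : SmoothEnd n X) : SmoothEnd n X where
  toFun u := conjSmooth (T (conjSmooth u))
  map_add' u v := by rw [conjSmooth_add, map_add, conjSmooth_add]
  map_smul' c u := by
    rw [conjSmooth_smul, map_smul, conjSmooth_smul, Complex.conj_conj, RingHom.id_apply]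

lemma conjEnd_apply (T : SmoothEnd n X) (u : smoothForms n X) :
    conjEnd T u = conjSmooth (T (conjSmooth u)) := rfl

lemma conjEnd_mul (T S : SmoothEnd n X) : conjEnd (T * S) = conjEnd T * conjEnd S := by
  ext1 u
  rw [Module.End.mul_apply, conjEnd_apply, conjEnd_apply, conjEnd_apply, conjSmooth_conjSmooth,
    Module.End.mul_apply]

lemma conjEnd_sub (T S : SmoothEnd n X) : conjEnd (T - S) = conjEnd T - conjEnd S := by
  ext1 u
  rw [LinearMap.sub_apply, conjEnd_apply, conjEnd_apply, conjEnd_apply, LinearMap.sub_apply,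
    conjSmooth_sub]

lemma conjEnd_smul (c : ℂ) (T : SmoothEnd n X) :
    conjEnd (c • T) = (starRingEnd ℂ) c • conjEnd T := by
  ext1 u
  rw [LinearMap.smul_apply, conjEnd_apply, conjEnd_apply, LinearMap.smul_apply, conjSmooth_smul]

lemma conjSmooth_coe (u : smoothForms n X) :
    (conjSmooth u : Form n X) = conjForm (u : Form n X) := rfl

/-! ### Operators that preserve the smooth forms -/

/-- The operator `T` maps smooth forms to smooth forms, on which it is given by `T'`. -/
def Restricts (T : Op n X) (T' : SmoothEnd n X) : Prop :=
  ∀ u : smoothForms n X, T (u : Form n X) = (T' u : Form n X)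

section Restricts

variable {T S : Op n X} {T' S' : SmoothEnd n X}

lemma Restricts.sub (hT : Restricts T T') (hS : Restricts S S') : Restricts (T - S) (T' - S') :=
  fun u => congrArg₂ (· - ·) (hT u) (hS u)

lemma Restricts.smul (c : ℂ) (hT : Restricts T T') : Restricts (c • T) (c • T') :=
  fun u => congrArg (c • ·) (hT u)

lemma Restricts.comp (hT : Restricts T T') (hS : Restricts S S') : Restricts (T ∘ S) (T' * S') :=
  fun u => by rw [Function.comp_apply, hS, hT, Module.End.mul_apply]

lemma Restricts.id : Restricts (_root_.id : Op n X) 1 := fun _ => rfl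

lemma Restricts.conjOp (hT : Restricts T T') : Restricts (conjOp T) (conjEnd T') := fun u => by
  rw [HermitianForms.conjOp, ← conjSmooth_coe, hT, ← conjSmooth_coe]
  rfl

lemma Restricts.anticomm (a b : ℤ) (hab : (-1 : ℂ) ^ (a * b) = -1) (hT : Restricts T T')
    (hS : Restricts S S') : Restricts (gradedComm a b T S) (T' * S' + S' * T') := by
  have := (hT.comp hS).sub ((hS.comp hT).smul (-1))
  rw [neg_one_smul, sub_neg_eq_add] at this
  rwa [gradedComm, hab]

lemma Restricts.comm (a b : ℤ) (hab : (-1 : ℂ) ^ (a * b) = 1) (hT : Restricts T T')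
    (hS : Restricts S S') : Restricts (gradedComm a b T S) (T' * S' - S' * T') := by
  rw [gradedComm, hab, one_smul]
  exact (hT.comp hS).sub (hS.comp hT)

end Restricts

lemma smoothEnd_ext {T S : SmoothEnd n X}
    (h : ∀ (u : smoothForms n X) (x : X), (T u : Form n X).at x = (S u : Form n X).at x) :
    T = S :=
  LinearMap.ext fun u => Subtype.ext (form_ext_at (h u))

lemma del_zero {k : ℕ} : del (0 : KForm n X k) = 0 := by
  have h := del_add_smul (1 : ℂ) (isSmooth_zero (X := X) (n := n) (k := k)) isSmooth_zero
  rw [one_smul, one_smul, add_zero] at h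
  exact left_eq_add.mp h

lemma delbar_zero {k : ℕ} : delbar (0 : KForm n X k) = 0 := by
  have h := delbar_add_smul (1 : ℂ) (isSmooth_zero (X := X) (n := n) (k := k)) isSmooth_zero
  rw [one_smul, one_smul, add_zero] at h
  exact left_eq_add.mp h

variable [IsManifold 𝓘(ℂ, Cn n) ω X]

/-! ### Commutation relations of the operators on smooth forms -/

section Leibniz

variable {p : ℕ} {η : KForm n X p} (hη : η.IsSmooth)

lemma delEnd_mul_extEnd : delEnd n X * extEnd η hη
    = extEnd (del η) hη.del + (-1 : ℂ) ^ p • (extEnd η hη * delEnd n X) := by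
  refine LinearMap.ext fun u => Subtype.ext (form_eq_of_inChart fun e he y hy => ?_)
  have hs := Form.isSmooth_iff.mp u.2 e he
  have h1 := fdel_extOp (((hη e he).contDiffAt (e.open_target.mem_nhds hy)).differentiableAt
    (by decide)) (hs.fDiffAt e.open_target hy) ((hs.extOp (hη e he)).fDiffAt e.open_target hy)
  have h2 := inChart_delOp he (u.2.extMul hη) hy
  have h3 : (extMul η u).inChart e = fun z => extOp (inChart η e z) ((u : Form n X).inChart e z) :=
    funext fun z => inChart_extMul e η u z
  rw [h3, h1, ← inChart_del he hη hy, ← inChart_delOp he u.2 hy, ← inChart_extMul,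
    ← inChart_extMul, ← Form.inChart_smul, ← Form.inChart_add] at h2
  exact h2

lemma delbarEnd_mul_extEnd : delbarEnd n X * extEnd η hη
    = extEnd (delbar η) hη.delbar + (-1 : ℂ) ^ p • (extEnd η hη * delbarEnd n X) := by
  refine LinearMap.ext fun u => Subtype.ext (form_eq_of_inChart fun e he y hy => ?_)
  have hs := Form.isSmooth_iff.mp u.2 e he
  have h1 := fdelbar_extOp (((hη e he).contDiffAt (e.open_target.mem_nhds hy)).differentiableAt
    (by decide)) (hs.fDiffAt e.open_target hy) ((hs.extOp (hη e he)).fDiffAt e.open_target hy)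
  have h2 := inChart_delbarOp he (u.2.extMul hη) hy
  have h3 : (extMul η u).inChart e = fun z => extOp (inChart η e z) ((u : Form n X).inChart e z) :=
    funext fun z => inChart_extMul e η u z
  rw [h3, h1, ← inChart_delbar he hη hy, ← inChart_delbarOp he u.2 hy, ← inChart_extMul,
    ← inChart_extMul, ← Form.inChart_smul, ← Form.inChart_add] at h2
  exact h2

end Leibniz

lemma del_delbar {k : ℕ} {α : KForm n X k} (hα : α.IsSmooth) :
    del (delbar α) = -delbar (del α) := by
  refine kform_eq_of_inChart fun e he y hy => ?_
  have h1 : inChart (delbar α) e =ᶠ[nhds y] ldelbar (inChart α e) := by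
    filter_upwards [e.open_target.mem_nhds hy] with z hz using inChart_delbar he hα hz
  have h2 : inChart (del α) e =ᶠ[nhds y] ldel (inChart α e) := by
    filter_upwards [e.open_target.mem_nhds hy] with z hz using inChart_del he hα hz
  have h3 : inChart (-delbar (del α)) e y = -inChart (delbar (del α)) e y := rfl
  rw [h3, inChart_del he hα.delbar hy, inChart_delbar he hα.del hy, ldel, h1.fderiv_eq, ldelbar,
    h2.fderiv_eq]
  exact ldel_ldelbar ((hα.contDiffAt he hy).of_le (by decide))

lemma delEnd_mul_delbarEnd : delEnd n X * delbarEnd n X + delbarEnd n X * delEnd n X = 0 := by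
  refine LinearMap.ext fun u => Subtype.ext (funext fun k => ?_)
  rcases k with _ | _ | k
  · exact add_zero _
  · have h0 : del (0 : KForm n X 0) + delbar (0 : KForm n X 0) = 0 := by
      rw [del_zero, delbar_zero, add_zero]
    exact h0
  · have h1 := del_delbar (u.2 k)
    have h2 : del (delbar ((u : Form n X) k)) + delbar (del ((u : Form n X) k)) = 0 := by
      rw [h1, neg_add_cancel]
    exact h2

lemma conjEnd_extEnd {p : ℕ} {η ζ : KForm n X p} (hη : η.IsSmooth) (hζ : ζ.IsSmooth)
    (h : η.conj = ζ) : conjEnd (extEnd η hη) = extEnd ζ hζ := by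
  subst h
  refine LinearMap.ext fun u => Subtype.ext ?_
  have := conjForm_extMul η (conjForm u)
  rwa [conjForm_conjForm] at this

lemma delEnd_apply (u : smoothForms n X) : (delEnd n X u : Form n X) = delOp (u : Form n X) := rfl

lemma delbarEnd_apply (u : smoothForms n X) :
    (delbarEnd n X u : Form n X) = delbarOp (u : Form n X) := rfl

lemma conjEnd_delEnd : conjEnd (delEnd n X) = delbarEnd n X := by
  refine LinearMap.ext fun u => Subtype.ext ?_
  rw [conjEnd_apply, conjSmooth_coe, delEnd_apply, conjSmooth_coe, delbarEnd_apply,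
    delOp_conjForm u.2, conjForm_conjForm]

lemma conjEnd_delbarEnd : conjEnd (delbarEnd n X) = delEnd n X := by
  refine LinearMap.ext fun u => Subtype.ext ?_
  rw [conjEnd_apply, conjSmooth_coe, delbarEnd_apply, conjSmooth_coe, delEnd_apply,
    delbarOp_conjForm u.2, conjForm_conjForm]

namespace HermitianMetric

variable (g : HermitianMetric n X)

lemma conjEnd_contrEnd {p : ℕ} {η ζ : KForm n X p} (hη : η.IsSmooth) (hζ : ζ.IsSmooth)
    (h : η.conj = ζ) : conjEnd (g.contrEnd η hη) = g.contrEnd ζ hζ := by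
  subst h
  refine LinearMap.ext fun u => Subtype.ext ?_
  have := g.conjForm_contrMul η (conjForm u)
  rwa [conjForm_conjForm] at this

lemma conj_delbar_form : (delbar g.form).conj = del g.form := by
  have := del_conj g.smooth
  rw [conj_form] at this
  exact this.symm

lemma conj_del_form : (del g.form).conj = delbar g.form := by
  rw [← conj_delbar_form, KForm.conj_conj]

lemma smooth_del : KForm.IsSmooth (del g.form) := KForm.IsSmooth.del g.smooth

lemma smooth_delbar : KForm.IsSmooth (delbar g.form) := KForm.IsSmooth.delbar g.smooth

/-- The operator `τ̄ = [Λ, ∂̄ω ∧ ·]` on smooth forms. -/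
def torsionBarEnd : SmoothEnd n X :=
  g.contrEnd g.form g.smooth * extEnd (delbar g.form) g.smooth_delbar
    - extEnd (delbar g.form) g.smooth_delbar * g.contrEnd g.form g.smooth

/-- The operator `τ̄*` on smooth forms. -/
def torsionBarStarEnd : SmoothEnd n X :=
  g.contrEnd (delbar g.form) g.smooth_delbar * extEnd g.form g.smooth
    - extEnd g.form g.smooth * g.contrEnd (delbar g.form) g.smooth_delbar

/-- The operator `τ*` on smooth forms. -/
def torsionStarEnd : SmoothEnd n X :=
  g.contrEnd (del g.form) g.smooth_del * extEnd g.form g.smooth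
    - extEnd g.form g.smooth * g.contrEnd (del g.form) g.smooth_del

lemma isReal11_fderiv_form (x : X) (a : Idx n) :
    IsReal11 (fderiv ℝ (inChart g.form (chartAt (Cn n) x)) (chartAt (Cn n) x x)
      (realBasis n a)) :=
  isReal11_fderiv (chartAt (Cn n) x).open_target (g.smooth _ (chart_mem_atlas _ x))
    (fun _ hy => g.isHerm_inChart (chart_mem_atlas _ x) hy) (mem_chart_target _ x) _

/-- The identity `[Λ, τ̄] = 2iτ*`. -/
lemma Lam_comm_torsionBarEnd :
    g.contrEnd g.form g.smooth * g.torsionBarEnd - g.torsionBarEnd * g.contrEnd g.form g.smooth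
      = (2 * Complex.I) • g.torsionStarEnd := by
  refine smoothEnd_ext fun u x => ?_
  have h := Lam_comm_torsion (g.isHerm x) (g.isReal11_fderiv_form x)
  have h' := LinearMap.congr_fun h ((u : Form n X).at x)
  simp only [LinearMap.sub_apply, Module.End.mul_apply, LinearMap.smul_apply] at h'
  change contrOp _ _ ((contrOp _ _ ((extMul _ _).at x)) - (extMul _ _).at x)
    - (contrOp _ _ ((extMul _ _).at x) - (extMul _ _).at x)
    = (2 * Complex.I) • (contrOp _ _ ((extMul _ _).at x) - (extMul _ _).at x)
  simp only [extMul_at]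
  exact h'

/-- The identity `[L, τ̄] = 3 ∂̄ω ∧ ·`. -/
lemma L_comm_torsionBarEnd :
    extEnd g.form g.smooth * g.torsionBarEnd - g.torsionBarEnd * extEnd g.form g.smooth
      = (3 : ℂ) • extEnd (delbar g.form) g.smooth_delbar := by
  refine smoothEnd_ext fun u x => ?_
  have h := L_comm_torsion (g.isHerm x) (g.isReal11_fderiv_form x)
  have h3 : ∀ T : FibOp n, 3 * T = (3 : ℂ) • T := fun T => by
    rw [ofNat_smul_eq_nsmul, nsmul_eq_mul]; rfl
  simp only [h3] at h
  have h' := LinearMap.congr_fun h ((u : Form n X).at x)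
  simp only [LinearMap.sub_apply, Module.End.mul_apply, LinearMap.smul_apply] at h'
  have hL : ∀ v : smoothForms n X, ((extEnd g.form g.smooth v : smoothForms n X) : Form n X).at x
      = extOp (g.form x) ((v : Form n X).at x) := fun v => extMul_at _ _ _
  have hN : ∀ v : smoothForms n X,
      ((extEnd (delbar g.form) g.smooth_delbar v : smoothForms n X) : Form n X).at x
      = extOp (delbar g.form x) ((v : Form n X).at x) := fun v => extMul_at _ _ _
  have ht : ∀ v : smoothForms n X, ((g.torsionBarEnd v : smoothForms n X) : Form n X).at x
      = contrOp (gramInv (g.form x)) (g.form x) (extOp (delbar g.form x) ((v : Form n X).at x))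
        - extOp (delbar g.form x)
          (contrOp (gramInv (g.form x)) (g.form x) ((v : Form n X).at x)) := fun v => by
    rw [← hN]
    exact congrArg₂ (· - ·) rfl (hN _)
  change ((extEnd g.form g.smooth (g.torsionBarEnd u) : smoothForms n X) : Form n X).at x
    - ((g.torsionBarEnd (extEnd g.form g.smooth u) : smoothForms n X) : Form n X).at x
    = (3 : ℂ) • ((extEnd (delbar g.form) g.smooth_delbar u : smoothForms n X) : Form n X).at x
  rw [hL, ht, ht, hL, hN]
  exact h'

end HermitianMetric

end HermitianForms
end

noncomputable section

namespace HermitianForms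

variable {n : ℕ} {X : Type*} [TopologicalSpace X] [ChartedSpace (Cn n) X]
  [IsManifold 𝓘(ℂ, Cn n) ω X]

/-! ### The identity on an SKT manifold -/

lemma extEnd_eq_zero {p : ℕ} {η : KForm n X p} (hη : η.IsSmooth) (h : η = 0) :
    extEnd η hη = 0 := by
  subst h
  refine smoothEnd_ext fun u x => (extMul_at _ _ _).trans ?_
  exact LinearMap.congr_fun (map_zero (extOpL (n := n) p)) _

namespace HermitianMetric

variable {g : HermitianMetric n X}

variable (g) in
/-- The operator `∂*` on smooth forms. -/
def delStarEnd : SmoothEnd n X := conjEnd g.delbarStarEnd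

/-- The conjugate of the formula that defines `∂̄*`. -/
lemma delStarEnd_eq : g.delStarEnd = Complex.I • (g.contrEnd g.form g.smooth * delbarEnd n X
    - delbarEnd n X * g.contrEnd g.form g.smooth) - g.torsionStarEnd := by
  rw [delStarEnd, delbarStarEnd, conjEnd_sub, conjEnd_smul, conjEnd_sub, conjEnd_mul, conjEnd_mul,
    conjEnd_sub, conjEnd_mul, conjEnd_mul, conjEnd_delEnd,
    g.conjEnd_contrEnd g.smooth g.smooth g.conj_form, conjEnd_extEnd g.smooth g.smooth g.conj_form,
    g.conjEnd_contrEnd _ g.smooth_del g.conj_delbar_form, map_neg, Complex.conj_I, neg_neg]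
  rfl

variable [MeasurableSpace X] [BorelSpace X] [CompactSpace X]

lemma l2_conjSmooth (u v : smoothForms n X) :
    g.l2 (conjSmooth u) (conjSmooth v) = (starRingEnd ℂ) (g.l2 u v) := by
  rw [l2_eq, l2_eq, ← integral_conj]
  congr 1
  funext x
  exact g.ptInner_conjForm u v x

lemma IsL2Adj.conjEnd {T S : SmoothEnd n X} (h : g.IsL2Adj T S) :
    g.IsL2Adj (HermitianForms.conjEnd T) (HermitianForms.conjEnd S) := by
  intro u v
  have h1 := h (conjSmooth u) (conjSmooth v)
  rw [conjEnd_apply, conjEnd_apply, ← conjSmooth_conjSmooth v, l2_conjSmooth,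
    conjSmooth_conjSmooth, h1, ← l2_conjSmooth, conjSmooth_conjSmooth]

lemma isL2Adj_torsionBar : g.IsL2Adj g.torsionBarEnd g.torsionBarStarEnd := by
  have hL := isL2Adj_ext (g := g) g.smooth
  have hN := isL2Adj_ext (g := g) g.smooth_delbar
  exact (hL.symm.mul hN).sub (hN.mul hL.symm)

/-- The formal adjoint of an operator is given on smooth forms by any operator with the adjunction
property. -/
lemma _root_.HermitianForms.Restricts.adj {T : Op n X} {T' S' : SmoothEnd n X}
    (hT : Restricts T T') (h : g.IsL2Adj T' S') :
    Restricts (g.adj T) S' := by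
  intro v
  have hex : ∃ w : Form n X, Form.IsSmooth w ∧
      ∀ u : Form n X, Form.IsSmooth u → g.l2Inner (T u) v = g.l2Inner u w :=
    ⟨S' v, (S' v).2, fun u hu => by rw [hT ⟨u, hu⟩]; exact h ⟨u, hu⟩ v⟩
  rw [HermitianMetric.adj, dif_pos hex]
  obtain ⟨h1, h2⟩ := hex.choose_spec
  have h3 : (⟨hex.choose, h1⟩ : smoothForms n X) = S' v := by
    rw [← sub_eq_zero]
    refine g.eq_zero_of_l2_self ?_
    set d : smoothForms n X := ⟨hex.choose, h1⟩ - S' v with hd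
    have h4 := h2 d d.2
    rw [hT d] at h4
    have h5 : g.l2 d ⟨hex.choose, h1⟩ = g.l2 d (S' v) := h4.symm.trans (h d v)
    rw [← h] at h5
    have h6 : g.l2 d d = g.l2 d ⟨hex.choose, h1⟩ - g.l2 d (S' v) := by
      rw [← map_sub]
    rw [h6, h5, h, sub_self]
  exact congrArg Subtype.val h3

lemma l2_anticomm_eq {T S : SmoothEnd n X} (h : g.IsL2Adj T S) (u : smoothForms n X) :
    g.l2 ((T * S + S * T) u) u = g.l2 (S u) (S u) + g.l2 (T u) (T u) := by
  rw [LinearMap.add_apply, Module.End.mul_apply, Module.End.mul_apply, map_add,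
    LinearMap.add_apply, h (S u) u, h.symm (T u) u]

open ComplexOrder in
lemma l2_anticomm_nonneg {T S : SmoothEnd n X} (h : g.IsL2Adj T S) (u : smoothForms n X) :
    0 ≤ g.l2 ((T * S + S * T) u) u := by
  rw [l2_anticomm_eq h]
  exact add_nonneg (g.l2_self_nonneg _) (g.l2_self_nonneg _)

open ComplexOrder in
lemma opLE_of_restricts {A B : Op n X} {A' B' : SmoothEnd n X} (hA : Restricts A A')
    (hB : Restricts B B') (h : ∀ u, 0 ≤ g.l2 ((B' - A') u) u) : g.OpLE A B := by
  intro u hu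
  rw [hA ⟨u, hu⟩, hB ⟨u, hu⟩, ← sub_nonneg]
  have := h ⟨u, hu⟩
  rwa [LinearMap.sub_apply, map_sub, LinearMap.sub_apply] at this

variable [T2Space X]

lemma isL2Adj_del : g.IsL2Adj (delEnd n X) g.delStarEnd := by
  have := (g.isL2Adj_delbar).conjEnd
  rwa [conjEnd_delbarEnd] at this

/-- The adjoint of the Leibniz rule `[∂̄, L] = ∂̄ω ∧ ·`. -/
lemma Lam_comm_delbarStarEnd :
    g.contrEnd g.form g.smooth * g.delbarStarEnd - g.delbarStarEnd * g.contrEnd g.form g.smooth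
      = g.contrEnd (delbar g.form) g.smooth_delbar := by
  have hL := isL2Adj_ext (g := g) g.smooth
  have hN := isL2Adj_ext (g := g) g.smooth_delbar
  have h1 := (g.isL2Adj_delbar.mul hL).sub (hL.mul g.isL2Adj_delbar)
  rw [delbarEnd_mul_extEnd, neg_one_sq, one_smul, add_sub_cancel_right] at h1
  exact h1.unique hN

/-- The adjoint of `[L, τ̄] = 3 ∂̄ω ∧ ·`. -/
lemma Lam_comm_torsionBarStarEnd :
    g.contrEnd g.form g.smooth * g.torsionBarStarEnd
        - g.torsionBarStarEnd * g.contrEnd g.form g.smooth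
      = -(3 : ℂ) • g.contrEnd (delbar g.form) g.smooth_delbar := by
  have hL := isL2Adj_ext (g := g) g.smooth
  have hN := isL2Adj_ext (g := g) g.smooth_delbar
  have ht := isL2Adj_torsionBar (g := g)
  have h1 := (hL.mul ht).sub (ht.mul hL)
  rw [L_comm_torsionBarEnd] at h1
  have h2 := h1.unique (hN.smul 3)
  rw [← neg_sub, h2, neg_smul]
  congr 2
  exact Complex.conj_ofNat 3

/-- The Bochner–Kodaira–Nakano identity on an SKT manifold:
`[∂̄ + τ̄, ∂̄* + τ̄*] = [∂, ∂*] + [∂̄ω ∧ ·, (∂̄ω ∧ ·)*]`. -/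
lemma laplacian_identity (hg : g.IsSKT) :
    (delbarEnd n X + g.torsionBarEnd) * (g.delbarStarEnd + g.torsionBarStarEnd)
        + (g.delbarStarEnd + g.torsionBarStarEnd) * (delbarEnd n X + g.torsionBarEnd)
      = delEnd n X * g.delStarEnd + g.delStarEnd * delEnd n X
        + (extEnd (delbar g.form) g.smooth_delbar * g.contrEnd (delbar g.form) g.smooth_delbar
          + g.contrEnd (delbar g.form) g.smooth_delbar
            * extEnd (delbar g.form) g.smooth_delbar) := by
  refine bochner_kodaira_nakano delStarEnd_eq rfl rfl g.Lam_comm_torsionBarEnd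
    Lam_comm_delbarStarEnd Lam_comm_torsionBarStarEnd ?_ delEnd_mul_delbarEnd
  have h3 : (-1 : ℂ) ^ 3 = -1 := by norm_num
  rw [delEnd_mul_extEnd, extEnd_eq_zero _ hg, zero_add, h3, neg_one_smul, neg_add_cancel]

/-! ### The operators of the statement, restricted to smooth forms -/

lemma restricts_extMul {p : ℕ} {η : KForm n X p} (hη : η.IsSmooth) :
    Restricts (extMul η) (extEnd η hη) := fun _ => rfl

lemma restricts_dOp (h : ℝ) : Restricts (dOp h : Op n X) ((h : ℂ) • delEnd n X + delbarEnd n X) :=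
  fun _ => rfl

lemma isL2Adj_dOp (h : ℝ) : g.IsL2Adj ((h : ℂ) • delEnd n X + delbarEnd n X)
    ((h : ℂ) • g.delStarEnd + g.delbarStarEnd) := by
  have := ((isL2Adj_del (g := g)).smul (h : ℂ)).add g.isL2Adj_delbar
  rwa [Complex.conj_ofReal] at this

lemma restricts_laplacian (h : ℝ) : Restricts (g.laplacian h)
    (((h : ℂ) • delEnd n X + delbarEnd n X) * ((h : ℂ) • g.delStarEnd + g.delbarStarEnd)
      + ((h : ℂ) • g.delStarEnd + g.delbarStarEnd) * ((h : ℂ) • delEnd n X + delbarEnd n X)) :=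
  (restricts_dOp h).anticomm 1 (-1) (by norm_num) ((restricts_dOp h).adj (isL2Adj_dOp h))

lemma restricts_conjOp_torsion : Restricts (conjOp g.torsion) g.torsionBarEnd := by
  have hL := (restricts_extMul g.smooth).adj (isL2Adj_ext (g := g) g.smooth)
  have h1 := (hL.comm (-2) 3 (by norm_num [zpow_neg]) (restricts_extMul g.smooth_del)).conjOp
  rw [conjEnd_sub, conjEnd_mul, conjEnd_mul, g.conjEnd_contrEnd g.smooth g.smooth g.conj_form,
    conjEnd_extEnd _ g.smooth_delbar g.conj_del_form] at h1
  exact h1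

lemma restricts_torsionLaplacian : Restricts g.torsionLaplacian
    (g.torsionBarEnd * g.torsionBarStarEnd + g.torsionBarStarEnd * g.torsionBarEnd) :=
  restricts_conjOp_torsion.anticomm 1 (-1) (by norm_num)
    (restricts_conjOp_torsion.adj isL2Adj_torsionBar)

lemma restricts_Xbar : Restricts g.Xbar
    (extEnd (delbar g.form) g.smooth_delbar * g.contrEnd (delbar g.form) g.smooth_delbar
      + g.contrEnd (delbar g.form) g.smooth_delbar * extEnd (delbar g.form) g.smooth_delbar) :=
  (restricts_extMul g.smooth_delbar).anticomm 3 (-3) (by norm_num [zpow_neg])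
    ((restricts_extMul g.smooth_delbar).adj (isL2Adj_ext g.smooth_delbar))

/-! ### The inequalities -/

open ComplexOrder

lemma opLE_laplacian (hg : g.IsSKT) {h : ℝ} (h0 : 0 < h) (h1 : h < 1) :
    g.OpLE ((h : ℂ) ^ 2 • ((1 - (h : ℂ)) • g.Xbar - g.torsionLaplacian))
        (g.laplacian h - (h : ℂ) ^ 2 • g.laplacian 1) := by
  refine opLE_of_restricts
    (((restricts_Xbar.smul _).sub restricts_torsionLaplacian).smul _)
    ((restricts_laplacian h).sub ((restricts_laplacian 1).smul _)) fun u => ?_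
  rw [Complex.ofReal_one, one_smul, one_smul,
    laplacian_comparison (h : ℂ) (laplacian_identity hg), LinearMap.add_apply,
    LinearMap.smul_apply, LinearMap.smul_apply, map_add, map_smul, map_smul, LinearMap.add_apply,
    LinearMap.smul_apply, LinearMap.smul_apply, smul_eq_mul, smul_eq_mul]
  have hB : g.IsL2Adj ((1 - (h : ℂ)) • delbarEnd n X - (h : ℂ) • g.torsionBarEnd)
      ((1 - (h : ℂ)) • g.delbarStarEnd - (h : ℂ) • g.torsionBarStarEnd) := by
    have := (g.isL2Adj_delbar.smul (1 - (h : ℂ))).sub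
      ((isL2Adj_torsionBar (g := g)).smul (h : ℂ))
    rwa [map_sub, map_one, Complex.conj_ofReal] at this
  have c1 : (0 : ℂ) ≤ 1 - (h : ℂ) := by
    rw [← Complex.ofReal_one, ← Complex.ofReal_sub, Complex.zero_le_real]
    linarith
  have c2 : (0 : ℂ) ≤ (h : ℂ) := Complex.zero_le_real.mpr h0.le
  exact add_nonneg (mul_nonneg c1 (l2_anticomm_nonneg (isL2Adj_dOp h) u))
    (mul_nonneg c2 (l2_anticomm_nonneg hB u))

lemma opLE_of_torsionLaplacian_le {C : ℝ} (hC : g.OpLE g.torsionLaplacian ((C : ℂ) • id)) {h : ℝ}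
    (h1 : h < 1) :
    g.OpLE (-((C : ℂ) * (h : ℂ) ^ 2) • id)
      ((h : ℂ) ^ 2 • ((1 - (h : ℂ)) • g.Xbar - g.torsionLaplacian)) := by
  refine opLE_of_restricts (Restricts.id.smul _)
    (((restricts_Xbar.smul _).sub restricts_torsionLaplacian).smul _) fun u => ?_
  have hu := hC u u.2
  have ht : g.l2Inner (g.torsionLaplacian u) u = g.l2 ((g.torsionBarEnd * g.torsionBarStarEnd
      + g.torsionBarStarEnd * g.torsionBarEnd) u) u := by
    rw [restricts_torsionLaplacian u]
    rfl
  have hi : g.l2Inner (((C : ℂ) • (id : Op n X)) u) u = (C : ℂ) * g.l2 u u := by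
    rw [← smul_eq_mul, ← LinearMap.smul_apply, ← map_smul]
    rfl
  rw [ht, hi] at hu
  have hX := l2_anticomm_nonneg (isL2Adj_ext (g := g) g.smooth_delbar) u
  have c1 : (0 : ℂ) ≤ 1 - (h : ℂ) := by
    rw [← Complex.ofReal_one, ← Complex.ofReal_sub, Complex.zero_le_real]
    linarith
  have c2 : (0 : ℂ) ≤ (h : ℂ) ^ 2 := by
    rw [← Complex.ofReal_pow, Complex.zero_le_real]
    positivity
  have key := mul_nonneg c2 (add_nonneg (mul_nonneg c1 hX) (sub_nonneg.mpr hu))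
  refine key.trans_eq ?_
  simp only [LinearMap.sub_apply, LinearMap.smul_apply, map_sub, map_smul, smul_eq_mul,
    Module.End.one_apply]
  ring

end HermitianMetric

end HermitianForms
end

noncomputable section

namespace HermitianForms

variable {n : ℕ}

/-! ### Boundedness of the operators of order zero -/

section fibre

variable {G : Matrix (Idx n) (Idx n) ℝ}

open ComplexOrder in
lemma fibInner_self_re_nonneg (hG : G.PosDef) (u : Fib n) : 0 ≤ (fibInner G u u).re :=
  (Complex.nonneg_iff.mp (fibInner_self_nonneg hG u)).1

lemma fibInner_smul_self_re (c : ℂ) (u : Fib n) :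
    (fibInner G (c • u) (c • u)).re = ‖c‖ ^ 2 * (fibInner G u u).re := by
  rw [LinearMap.map_smulₛₗ, (fibInner G).map_smul, LinearMap.smul_apply, smul_eq_mul, smul_eq_mul,
    ← mul_assoc, mul_comm (starRingEnd ℂ c), Complex.mul_conj, Complex.re_ofReal_mul,
    Complex.normSq_eq_norm_sq]

lemma fibInner_add_self_re_le (hG : G.PosDef) (u v : Fib n) :
    (fibInner G (u + v) (u + v)).re ≤ 2 * (fibInner G u u).re + 2 * (fibInner G v v).re := by
  have h := fibInner_self_re_nonneg hG (u - v)
  simp only [map_add, map_sub, LinearMap.add_apply, LinearMap.sub_apply, Complex.add_re,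
    Complex.sub_re] at h ⊢
  linarith

/-- The exterior multiplication by `dx_a` is bounded, because it satisfies
`ε_a* ε_a + ε_a ε_a* = g^{aa}`. -/
lemma fibInner_eps_self_re_le (hG : G.PosDef) (a : Idx n) (u : Fib n) :
    (fibInner G (eps a u) (eps a u)).re ≤ G a a * (fibInner G u u).re := by
  have ht : G.transpose = G := hG.isHermitian
  have h1 : fibInner G u (epsAdj G a (eps a u)) = G a a * fibInner G u u
      - fibInner G (epsAdj G a u) (epsAdj G a u) := by
    rw [← Module.End.mul_apply, epsAdj_mul_eps, LinearMap.sub_apply, LinearMap.smul_apply,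
      Module.End.one_apply, Module.End.mul_apply, map_sub, LinearMap.map_smulₛₗ,
      Complex.conj_ofReal, smul_eq_mul, (isFibAdj_eps G a).symm ht]
  rw [isFibAdj_eps, h1, Complex.sub_re, Complex.re_ofReal_mul]
  linarith [fibInner_self_re_nonneg hG (epsAdj G a u)]

end fibre

/-- A locally uniform bound for the exterior multiplication by a continuous form. -/
lemma exists_extOp_bound {G : Cn n → Matrix (Idx n) (Idx n) ℝ} {y₀ : Cn n}
    (hG : ∀ a b, ContinuousAt (fun y => G y a b) y₀) (hpos : ∀ᶠ y in nhds y₀, (G y).PosDef)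
    {p : ℕ} {η : Cn n → Alt n p} (hη : ContinuousAt η y₀) :
    ∃ C : ℝ, 0 ≤ C ∧ ∀ᶠ y in nhds y₀, ∀ u : Fib n,
      (fibInner (G y) (extOp (η y) u) (extOp (η y) u)).re ≤ C * (fibInner (G y) u u).re := by
  induction p with
  | zero =>
    have hc : ContinuousAt (fun y => ‖η y ![]‖ ^ 2) y₀ :=
      (((evalCLM ![]).continuous.continuousAt.comp hη).norm).pow 2
    refine ⟨‖η y₀ ![]‖ ^ 2 + 1, by positivity, ?_⟩
    filter_upwards [hpos, hc.eventually_lt_const (lt_add_one _)] with y hy hy' u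
    have h1 : extOp (η y) u = η y ![] • u := rfl
    rw [h1, fibInner_smul_self_re]
    exact mul_le_mul_of_nonneg_right hy'.le (fibInner_self_re_nonneg hy u)
  | succ p ih =>
    -- the sum over a finite set of indices is bounded by induction on the set
    have hs : ∀ s : Finset (Idx n), ∃ C : ℝ, 0 ≤ C ∧ ∀ᶠ y in nhds y₀, ∀ u : Fib n,
        (fibInner (G y) (∑ a ∈ s, eps a (extOp (iotaAlt a (η y)) u))
          (∑ a ∈ s, eps a (extOp (iotaAlt a (η y)) u))).re ≤ C * (fibInner (G y) u u).re := by
      intro s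
      induction s using Finset.induction_on with
      | empty => exact ⟨0, le_rfl, .of_forall fun y u => by simp⟩
      | insert a s ha ihs =>
        obtain ⟨C, hC, h1⟩ := ihs
        obtain ⟨C', hC', h2⟩ := ih (η := fun y => iotaAlt a (η y))
          ((iotaCLM a).continuous.continuousAt.comp hη)
        refine ⟨2 * ((|G y₀ a a| + 1) * C') + 2 * C, by positivity, ?_⟩
        have hGa : ∀ᶠ y in nhds y₀, G y a a < |G y₀ a a| + 1 :=
          (hG a a).eventually_lt_const (by linarith [le_abs_self (G y₀ a a)])
        filter_upwards [hpos, hGa, h1, h2] with y hy hGy h1y h2y u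
        rw [Finset.sum_insert ha]
        refine (fibInner_add_self_re_le hy _ _).trans ?_
        have h3 := fibInner_eps_self_re_le hy a (extOp (iotaAlt a (η y)) u)
        have h4 : G y a a * (fibInner (G y) (extOp (iotaAlt a (η y)) u)
            (extOp (iotaAlt a (η y)) u)).re
            ≤ (|G y₀ a a| + 1) * (C' * (fibInner (G y) u u).re) :=
          mul_le_mul hGy.le (h2y u) (fibInner_self_re_nonneg hy _) (by positivity)
        have h5 := h1y u
        linarith
    obtain ⟨C, hC, h1⟩ := hs Finset.univ
    refine ⟨‖((p : ℂ) + 1)⁻¹‖ ^ 2 * C, by positivity, ?_⟩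
    filter_upwards [h1] with y hy u
    have h2 : extOp (η y) u = ((p : ℂ) + 1)⁻¹ • ∑ a, eps a (extOp (iotaAlt a (η y)) u) := by
      simp only [extOp, LinearMap.smul_apply, LinearMap.sum_apply, Module.End.mul_apply]
    rw [h2, fibInner_smul_self_re, mul_assoc]
    exact mul_le_mul_of_nonneg_left (hy u) (by positivity)

variable {X : Type*} [TopologicalSpace X] [ChartedSpace (Cn n) X] [IsManifold 𝓘(ℂ, Cn n) ω X]

namespace HermitianMetric

lemma exists_ptInner_extMul_bound [CompactSpace X] (g : HermitianMetric n X) {p : ℕ}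
    {η : KForm n X p} (hη : η.IsSmooth) : ∃ C : ℝ, 0 ≤ C ∧ ∀ (u : Form n X) (x : X),
      (g.ptInner (extMul η u) (extMul η u) x).re ≤ C * (g.ptInner u u x).re := by
  have hloc : ∀ x : X, ∃ C : ℝ, 0 ≤ C ∧ ∀ᶠ z in nhds x, ∀ u : Form n X,
      (g.ptInner (extMul η u) (extMul η u) z).re ≤ C * (g.ptInner u u z).re := by
    intro x
    set c := chartAt (Cn n) x with hc
    have hca : c ∈ atlas (Cn n) X := chart_mem_atlas _ x
    have hx : x ∈ c.source := mem_chart_source _ x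
    have ht := c.open_target.mem_nhds (c.map_source hx)
    have hH : ∀ y ∈ c.target, IsHerm (inChart g.form c y) := fun y hy => g.isHerm_inChart hca hy
    obtain ⟨C, hC, h⟩ := exists_extOp_bound (G := fun y => gramInv (inChart g.form c y))
      (y₀ := c x) (fun a b =>
        (contDiffOn_gramInv (g.smooth c hca) hH a b).continuousOn.continuousAt ht)
      (by filter_upwards [ht] with y hy using (hH y hy).posDef_inv)
      ((hη c hca).continuousOn.continuousAt ht)
    refine ⟨C, hC, ?_⟩
    filter_upwards [(c.continuousAt hx).eventually h, c.open_source.mem_nhds hx] with z hz hzs u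
    have h1 := hz (u.inChart c (c z))
    rwa [← inChart_extMul, g.ptInner_inChart hca _ _ (c.map_source hzs),
      g.ptInner_inChart hca _ _ (c.map_source hzs), c.left_inv hzs] at h1
  choose C hC h using hloc
  obtain ⟨t, -, ht⟩ := isCompact_univ.elim_nhds_subcover _ fun x _ => h x
  refine ⟨∑ x ∈ t, C x, Finset.sum_nonneg fun x _ => hC x, fun u z => ?_⟩
  obtain ⟨x, hxt, hz⟩ := Set.mem_iUnion₂.mp (ht (Set.mem_univ z))
  exact (hz u).trans (mul_le_mul_of_nonneg_right
    (Finset.single_le_sum (fun x _ => hC x) hxt) (g.ptInner_self_re_nonneg u z))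

variable [MeasurableSpace X] [BorelSpace X] [CompactSpace X] (g : HermitianMetric n X)

/-- The operator `T` is bounded for the `L²` norm. -/
def IsL2Bounded (T : SmoothEnd n X) : Prop :=
  ∃ C : ℝ, 0 ≤ C ∧ ∀ u, (g.l2 (T u) (T u)).re ≤ C * (g.l2 u u).re

variable {g} {T S : SmoothEnd n X}

open ComplexOrder in
lemma l2_self_re_nonneg (u : smoothForms n X) : 0 ≤ (g.l2 u u).re :=
  (Complex.nonneg_iff.mp (g.l2_self_nonneg u)).1

lemma l2_self_ofReal (u : smoothForms n X) : g.l2 u u = ((g.l2 u u).re : ℂ) := by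
  rw [l2_self_eq, Complex.ofReal_re]

lemma isL2Bounded_extEnd {p : ℕ} {η : KForm n X p} (hη : η.IsSmooth) :
    g.IsL2Bounded (extEnd η hη) := by
  obtain ⟨C, hC, h⟩ := g.exists_ptInner_extMul_bound hη
  refine ⟨C, hC, fun u => ?_⟩
  rw [l2_self_eq, l2_self_eq, Complex.ofReal_re, Complex.ofReal_re,
    ← MeasureTheory.integral_const_mul]
  exact MeasureTheory.integral_mono (g.integrable_ptInner (extEnd η hη u).2 (extEnd η hη u).2).re
    ((g.integrable_ptInner u.2 u.2).re.const_mul C) fun x => h u x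

namespace IsL2Bounded

lemma mul (hT : g.IsL2Bounded T) (hS : g.IsL2Bounded S) : g.IsL2Bounded (T * S) := by
  obtain ⟨C, hC, h⟩ := hT
  obtain ⟨C', hC', h'⟩ := hS
  refine ⟨C * C', by positivity, fun u => (h (S u)).trans ?_⟩
  rw [mul_assoc]
  exact mul_le_mul_of_nonneg_left (h' u) hC

lemma add (hT : g.IsL2Bounded T) (hS : g.IsL2Bounded S) : g.IsL2Bounded (T + S) := by
  obtain ⟨C, hC, h⟩ := hT
  obtain ⟨C', hC', h'⟩ := hS
  refine ⟨2 * C + 2 * C', by positivity, fun u => ?_⟩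
  have h1 := l2_self_re_nonneg (g := g) (T u - S u)
  have h2 := h u
  have h3 := h' u
  simp only [map_add, map_sub, LinearMap.add_apply, LinearMap.sub_apply, Complex.add_re,
    Complex.sub_re] at h1 ⊢
  linarith

lemma neg (hT : g.IsL2Bounded T) : g.IsL2Bounded (-T) := by
  obtain ⟨C, hC, h⟩ := hT
  refine ⟨C, hC, fun u => ?_⟩
  simpa only [LinearMap.neg_apply, map_neg, neg_neg] using h u

lemma sub (hT : g.IsL2Bounded T) (hS : g.IsL2Bounded S) : g.IsL2Bounded (T - S) := by
  rw [sub_eq_add_neg]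
  exact hT.add hS.neg

/-- The adjoint of a bounded operator is bounded. -/
lemma adj (hT : g.IsL2Bounded T) (hS : g.IsL2Adj T S) : g.IsL2Bounded S := by
  obtain ⟨C, hC, h⟩ := hT
  refine ⟨C + 1, by positivity, fun u => ?_⟩
  -- `‖S u‖² = ⟪T S u, u⟫`, and `2(C + 1)⟪T S u, u⟫ ≤ ‖T S u‖² + (C + 1)²‖u‖²`
  have h1 := l2_self_re_nonneg (g := g) (T (S u) - ((C + 1 : ℝ) : ℂ) • u)
  have h2 := h (S u)
  have h3 : (g.l2 (T (S u)) u).re = (g.l2 (S u) (S u)).re := by rw [hS]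
  have h4 : (g.l2 u (T (S u))).re = (g.l2 (S u) (S u)).re := by rw [hS.symm]
  have h5 := l2_self_re_nonneg (g := g) (S u)
  simp only [map_sub, LinearMap.sub_apply, map_smul, LinearMap.smul_apply, LinearMap.map_smulₛₗ,
    Complex.conj_ofReal, smul_eq_mul, Complex.sub_re, Complex.re_ofReal_mul, h3, h4] at h1
  have h6 : (C + 1) * (g.l2 (S u) (S u)).re ≤ (C + 1) * ((C + 1) * (g.l2 u u).re) := by
    linarith
  exact le_of_mul_le_mul_left h6 (by positivity)

end IsL2Bounded

lemma isL2Bounded_torsionBar : g.IsL2Bounded g.torsionBarEnd := by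
  have hN := isL2Bounded_extEnd (g := g) g.smooth_delbar
  have hL := (isL2Bounded_extEnd (g := g) g.smooth).adj (isL2Adj_ext g.smooth)
  exact (hL.mul hN).sub (hN.mul hL)

variable (g) [T2Space X]

/-- The operator `[τ̄, τ̄*]` has order zero, hence it is bounded. -/
lemma torsionLaplacian_bounded : ∃ C : ℝ, 0 ≤ C ∧ ∀ u : Form n X, u.IsSmooth →
    g.l2Norm (g.torsionLaplacian u) ≤ C * g.l2Norm u := by
  have ht := isL2Bounded_torsionBar (g := g)
  have hs := ht.adj isL2Adj_torsionBar
  obtain ⟨C, hC, h⟩ := (ht.mul hs).add (hs.mul ht)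
  refine ⟨√C, Real.sqrt_nonneg _, fun u hu => ?_⟩
  rw [restricts_torsionLaplacian ⟨u, hu⟩, l2Norm, l2Norm, ← Real.sqrt_mul hC]
  exact Real.sqrt_le_sqrt (h ⟨u, hu⟩)

lemma torsionLaplacian_le : ∃ C : ℝ, 0 ≤ C ∧ g.OpLE g.torsionLaplacian ((C : ℂ) • id) := by
  have ht := isL2Bounded_torsionBar (g := g)
  obtain ⟨C', hC', h'⟩ := ht.adj isL2Adj_torsionBar
  obtain ⟨C, hC, h⟩ := ht
  refine ⟨C' + C, by positivity, opLE_of_restricts restricts_torsionLaplacian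
    (Restricts.id.smul _) fun u => ?_⟩
  rw [LinearMap.sub_apply, map_sub, LinearMap.sub_apply, l2_anticomm_eq isL2Adj_torsionBar,
    LinearMap.smul_apply, Module.End.one_apply, map_smul, LinearMap.smul_apply, l2_self_ofReal u,
    l2_self_ofReal (g.torsionBarStarEnd u), l2_self_ofReal (g.torsionBarEnd u), smul_eq_mul,
    ← Complex.ofReal_mul, ← Complex.ofReal_add, ← Complex.ofReal_sub, Complex.zero_le_real]
  linarith [h u, h' u]

end HermitianMetric

end HermitianForms
end

theorem lemma7p2 {n : ℕ} {X : Type*} [TopologicalSpace X] [T2Space X] [CompactSpace X]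
    [ChartedSpace (HermitianForms.Cn n) X] [IsManifold 𝓘(ℂ, HermitianForms.Cn n) ω X]
    [MeasurableSpace X] [BorelSpace X]
    (g : HermitianForms.HermitianMetric n X) (hg : g.IsSKT) :
    -- the first inequality
    (∀ h : ℝ, 0 < h → h < 1 →
      g.OpLE ((h : ℂ) ^ 2 • ((1 - (h : ℂ)) • g.Xbar - g.torsionLaplacian))
        (g.laplacian h - (h : ℂ) ^ 2 • g.laplacian 1)) ∧
    -- the operator `[τ̄, τ̄*]` is bounded
    (∃ C : ℝ, 0 ≤ C ∧ ∀ u : HermitianForms.Form n X, u.IsSmooth →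
      g.l2Norm (g.torsionLaplacian u) ≤ C * g.l2Norm u) ∧
    -- it has an upper bound `C ≥ 0`
    (∃ C : ℝ, 0 ≤ C ∧ g.OpLE g.torsionLaplacian ((C : ℂ) • id)) ∧
    -- the second inequality holds for every upper bound `C`
    (∀ C : ℝ, g.OpLE g.torsionLaplacian ((C : ℂ) • id) → ∀ h : ℝ, 0 < h → h < 1 →
      g.OpLE (-((C : ℂ) * (h : ℂ) ^ 2) • id)
        ((h : ℂ) ^ 2 • ((1 - (h : ℂ)) • g.Xbar - g.torsionLaplacian))) :=
  ⟨fun _ h0 h1 => HermitianForms.HermitianMetric.opLE_laplacian hg h0 h1,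
    g.torsionLaplacian_bounded, g.torsionLaplacian_le,
    fun _ hC _ _ h1 => HermitianForms.HermitianMetric.opLE_of_torsionLaplacian_le hC h1⟩
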